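/- **Setting.** Let $n\ge 1$, $0\le k\le n$, $\beta=(\beta_1,\dots,\beta_n)\in(0,1]^n$, $\epsilon\in[0,1]$. In $\mathbb C^n$ with holomorphic coordinates $z$ let $D=\{z_j=0 \text{ for some } j\le k\}$ and $$g^k_{\beta,\epsilon}=\sum_{j\le k}\frac{\beta_j^2}{(|z_j|^2+\epsilon^2)^{1-\beta_j}}\,dz_j\otimes d\bar z_j+\sum_{j>k}dz_j\otimes d\bar z_j .$$ Polar coordinates $\xi$ are defined by $\xi_j=s_je^{i\theta_j}$ for $j\le k$, where $z_j=|z_j|e^{i\theta_j}$ and $s_j=\int_0^{|z_j|}\beta_j(x^2+\epsilon^2)^{-(1-\beta_j)/2}dx$ (so $s_j=|z_j|^{\beta_j}$ if $\epsilon=0$), and $\xi_j=z_j$ for $j>k$. All balls are Euclidean balls in the polar coordinates; for $Y=(y,s)$ put $C_r(Y)=B_r(y)\times(s-r^2,s)$. All functions and metrics are defined off $D$, and sets, suprema and inequalities are taken off $D$. Let $(g_t)$ be a time-differentiable family of Kähler metrics on $C_r(Y)\setminus D$, each locally Hölder continuous in space off $D$, with $K^{-1}g^k_{\beta,\epsilon}\le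 g_t\le K g^k_{\beta,\epsilon}$ and $\frac{\partial}{\partial t}dvol_{g_t}\le K\,dvol_{g_t}$. A *weak subsolution* of $\frac{\partial u}{\partial t}-\Delta_{g_t}u\le 0$ in $C_r(Y)$ is a bounded function $u$ on $C_r(Y)\setminus D$ which for some $\alpha\in(0,1)$ is locally of class $C^{2+\alpha,1+\alpha/2}$ there and satisfies the inequality classically there. ($\Delta_g$ is the Riemannian Laplacian, $\Delta_g v=4g^{j\bar l}\partial_j\partial_{\bar l}v$ for $g=\sum g_{j\bar l}dz_j\otimes d\bar z_l$.) **Proposition.** For all $n\ge1$, $\beta\in(0,1]^n$, $K>0$, $\kappa>0$ and $R_0>0$ there is $\lambda\in(0,1)$, depending only on $n,\beta,K,\kappa,R_0$, such that the following holds for all $k\le n$, $\epsilon\in[0,1]$, $Y=(y,s)\in\mathbb C^n\times\mathbb R$, $0<r\le R_0$ and all $(g_t)$ as above. Let $u$ be a weak subsolution in $C_r(Y)$. Let $\rho=\kappa r$, $B_\rho(z)\subseteq B_r(y)$ and $$s-r^2\le\tau<s-\frac{r^2}{4}-\rho^2,$$ and suppose $u\le 0$ on $B_\rho(z)\times\{\tau\}$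 (if $\tau=s-r^2$, $u$ is understood to be defined and continuous up to $B_\rho(z)\times\{\tau\}$). Then $$\sup_{C_{r/2}(Y)}u\le(1-\lambda)\sup_{C_r(Y)}u .$$ -/

import Mathlib

open Set Filter Topology
open scoped ComplexOrder

noncomputable section

namespace ConicHeat

/-- `ℂⁿ` with its Euclidean norm. -/
abbrev Cn (n : ℕ) : Type := EuclideanSpace ℂ (Fin n)

/-! ### The divisor, the polar coordinates and the model metrics -/

/-- The divisor `D = {z₁ ⋯ z_k = 0}` in `ℂⁿ` (empty if `k = 0`). -/
def divisor {n : ℕ} (k : ℕ) : Set (Cn n) :=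
  {z | ∃ j : Fin n, j.val < k ∧ z j = 0}

/-- The solution `s` of `ds/dx = b / (x² + ε²)^((1 - b)/2)`, `s(0) = 0`.
For `ε = 0` it is `x ^ b`, see `polarRadius_zero`. -/
def polarRadius (b ε x : ℝ) : ℝ :=
  ∫ σ in (0 : ℝ)..x, b * (σ ^ 2 + ε ^ 2) ^ ((b - 1) / 2)

theorem polarRadius_zero {b x : ℝ} (hb : 0 < b) (hx : 0 ≤ x) :
    polarRadius b 0 x = x ^ b := by
  have h1 : polarRadius b 0 x = ∫ σ in (0 : ℝ)..x, b * σ ^ (b - 1) := by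
    unfold polarRadius
    refine intervalIntegral.integral_congr_ae (Eventually.of_forall fun σ hσ => ?_)
    rw [uIoc_of_le hx] at hσ
    have h2 : (σ ^ 2 + (0 : ℝ) ^ 2) = σ ^ (2 : ℝ) := by
      rw [Real.rpow_two]; ring
    rw [h2, ← Real.rpow_mul hσ.1.le]
    congr 2
    ring
  rw [h1, intervalIntegral.integral_const_mul, integral_rpow (Or.inl (by linarith))]
  rw [sub_add_cancel, Real.zero_rpow hb.ne']
  field_simp
  ring

/-- The polar coordinates `ξ` of the point with holomorphic coordinates `z`:
`ξ_j = s_j(|z_j|) e^{iθ_j}` with `z_j = |z_j| e^{iθ_j}` for the first `k` indices, and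
`ξ_j = z_j` for the others. -/
def polarMap {n : ℕ} (k : ℕ) (β : Fin n → ℝ) (ε : ℝ) (z : Cn n) : Cn n :=
  WithLp.toLp 2 fun j =>
    if j.val < k then ((polarRadius (β j) ε ‖z j‖ / ‖z j‖ : ℝ) : ℂ) * z j else z j

/-- The (diagonal) matrix of the model metric `g^k_{β,ε}` in holomorphic coordinates;
`ε = 0` is the model cone `g^k_β`. -/
def modelMetric {n : ℕ} (k : ℕ) (β : Fin n → ℝ) (ε : ℝ) (z : Cn n) :
    Matrix (Fin n) (Fin n) ℂ :=
  Matrix.diagonal fun j =>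
    if j.val < k then ((β j ^ 2 / (‖z j‖ ^ 2 + ε ^ 2) ^ (1 - β j) : ℝ) : ℂ) else 1

/-- The points (given in holomorphic coordinates) off the divisor whose polar coordinates lie in
the Euclidean ball of radius `r` about `y`. -/
def polarBall {n : ℕ} (k : ℕ) (β : Fin n → ℝ) (ε : ℝ) (y : Cn n) (r : ℝ) : Set (Cn n) :=
  {z | z ∉ divisor k ∧ polarMap k β ε z ∈ Metric.ball y r}

/-- The parabolic cylinder `C_r(Y) = B_r(y) × (s - r², s)`, `Y = (y, s)`, minus the divisor.
The ball is a Euclidean ball in the polar coordinates. -/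
def cylinder {n : ℕ} (k : ℕ) (β : Fin n → ℝ) (ε : ℝ) (y : Cn n) (s r : ℝ) : Set (Cn n × ℝ) :=
  polarBall k β ε y r ×ˢ Ioo (s - r ^ 2) s

/-! ### Kähler metrics and their Laplacian -/

/-- The complex Hessian `(∂² v / ∂z_j ∂z̄_l)` of a real function, where
`∂/∂z = (∂/∂x - i ∂/∂y) / 2` and `∂/∂z̄ = (∂/∂x + i ∂/∂y) / 2`. -/
def complexHessian {n : ℕ} (v : Cn n → ℝ) (z : Cn n) : Matrix (Fin n) (Fin n) ℂ :=
  let H : Cn n → Cn n → ℝ := fun a b => fderiv ℝ (fderiv ℝ v) z a b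
  let X : Fin n → Cn n := fun j => EuclideanSpace.single j 1
  let Y : Fin n → Cn n := fun j => EuclideanSpace.single j Complex.I
  Matrix.of fun j l =>
    (1 / 4 : ℂ) * (((H (X j) (X l) + H (Y j) (Y l) : ℝ) : ℂ)
      + Complex.I * ((H (X j) (Y l) - H (Y j) (X l) : ℝ) : ℂ))

/-- The Laplacian `4 g^{j l̄} ∂_j ∂_l̄ v` of the Kähler metric `g = ∑ g_{j l̄} dz_j ⊗ dz̄_l`; for the
Euclidean metric `∑ dz_j ⊗ dz̄_j` it is the usual real Laplacian. -/
def laplacian {n : ℕ} (g : Cn n → Matrix (Fin n) (Fin n) ℂ) (v : Cn n → ℝ) (z : Cn n) : ℝ :=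
  4 * ((g z)⁻¹ * complexHessian v z).trace.re

/-- Locally Hölder continuous on `U` with exponent `α`. -/
def LocallyHolderOn {n : ℕ} (α : ℝ) (U : Set (Cn n)) (f : Cn n → ℂ) : Prop :=
  ∀ z ∈ U, ∃ N ∈ 𝓝 z, ∃ C : ℝ, ∀ w ∈ N ∩ U, ∀ w' ∈ N ∩ U, ‖f w - f w'‖ ≤ C * ‖w - w'‖ ^ α

/-- `g` is a Hölder continuous Kähler metric on `U`. As `g` need not be differentiable, closedness
of the Kähler form is expressed by local `C²` potentials. -/
structure IsHolderKahlerMetricOn {n : ℕ} (U : Set (Cn n))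
    (g : Cn n → Matrix (Fin n) (Fin n) ℂ) : Prop where
  posDef : ∀ z ∈ U, (g z).PosDef
  holder : ∃ α ∈ Ioo (0 : ℝ) 1, ∀ i j, LocallyHolderOn α U fun z => g z i j
  closed : ∀ z ∈ U, ∃ V : Set (Cn n), IsOpen V ∧ z ∈ V ∧ ∃ φ : Cn n → ℝ,
    ContDiffOn ℝ 2 φ V ∧ ∀ w ∈ V ∩ U, g w = complexHessian φ w

/-- On `B × J` (with `B` a set off the divisor) `g` is a time-differentiable family of
Hölder continuous Kähler metrics with quasi-isometric constant `K` with respect to the model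
`g^k_{β,ε}`: weak-conic if `ε = 0` and `ε`-nearly-conic if `ε > 0`. -/
structure IsConicFamily {n : ℕ} (k : ℕ) (β : Fin n → ℝ) (ε K : ℝ) (B : Set (Cn n)) (J : Set ℝ)
    (g : ℝ → Cn n → Matrix (Fin n) (Fin n) ℂ) : Prop where
  kahler : ∀ t ∈ J, IsHolderKahlerMetricOn B (g t)
  lower : ∀ t ∈ J, ∀ z ∈ B, (g t z - ((K⁻¹ : ℝ) : ℂ) • modelMetric k β ε z).PosSemidef
  upper : ∀ t ∈ J, ∀ z ∈ B, ((K : ℂ) • modelMetric k β ε z - g t z).PosSemidef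
  timeDiff : ∀ t ∈ J, ∀ z ∈ B, ∀ i j, DifferentiableAt ℝ (fun θ => g θ z i j) t

/-- The density of the Riemannian volume form of `g` with respect to Lebesgue measure in
holomorphic coordinates (the determinant of a Hermitian matrix is real). -/
def volDensity {n : ℕ} (g : Cn n → Matrix (Fin n) (Fin n) ℂ) (z : Cn n) : ℝ :=
  (g z).det.re

/-! ### Weak subsolutions of the heat equation -/

/-- Locally Hölder continuous on `Ω` with exponent `α` for the parabolic distance
`max |x - x'| |t - t'|^(1/2)`. -/
def ParabolicHolderOn {n : ℕ} {F : Type*} [NormedAddCommGroup F] (α : ℝ) (Ω : Set (Cn n × ℝ))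
    (f : Cn n × ℝ → F) : Prop :=
  ∀ p ∈ Ω, ∃ N ∈ 𝓝 p, ∃ C : ℝ, ∀ q ∈ N ∩ Ω, ∀ q' ∈ N ∩ Ω,
    ‖f q - f q'‖ ≤ C * (max ‖q.1 - q'.1‖ (Real.sqrt |q.2 - q'.2|)) ^ α

/-- The class `C^{2+α, 1+α/2}` (locally, on an open set `Ω`). -/
structure ParabolicC2On {n : ℕ} (α : ℝ) (Ω : Set (Cn n × ℝ)) (u : Cn n × ℝ → ℝ) : Prop where
  diff_time : ∀ p ∈ Ω, DifferentiableAt ℝ (fun θ => u (p.1, θ)) p.2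
  diff_space : ∀ p ∈ Ω, DifferentiableAt ℝ (fun w => u (w, p.2)) p.1
  diff_space_two : ∀ p ∈ Ω, DifferentiableAt ℝ (fderiv ℝ fun w => u (w, p.2)) p.1
  holder : ParabolicHolderOn α Ω u
  holder_time : ParabolicHolderOn α Ω fun p => deriv (fun θ => u (p.1, θ)) p.2
  holder_space : ParabolicHolderOn α Ω fun p => fderiv ℝ (fun w => u (w, p.2)) p.1
  holder_space_two :
    ParabolicHolderOn α Ω fun p => fderiv ℝ (fderiv ℝ fun w => u (w, p.2)) p.1

/-- `u` is a weak subsolution of `∂u/∂t - Δ_{g_t} u ≤ 0` on `Ω` (a cylinder minus the divisor):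
it is of class `C^{2+α, 1+α/2}` and satisfies the inequality classically off the divisor, and it is
bounded. -/
structure IsWeakSubsolution {n : ℕ} (Ω : Set (Cn n × ℝ))
    (g : ℝ → Cn n → Matrix (Fin n) (Fin n) ℂ) (u : Cn n × ℝ → ℝ) : Prop where
  regular : ∃ α ∈ Ioo (0 : ℝ) 1, ParabolicC2On α Ω u
  bounded : ∃ M : ℝ, ∀ p ∈ Ω, |u p| ≤ M
  inequality : ∀ p ∈ Ω,
    deriv (fun θ => u (p.1, θ)) p.2 - laplacian (g p.2) (fun w => u (w, p.2)) p.1 ≤ 0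

end ConicHeat

end

namespace ConicHeat

/-! ### Second order jets along lines -/

/-! Let M be the supremum of u on the large cylinder. If M ≤ 0 the claim is immediate. Otherwise v =
M - u is a nonnegative supersolution with v ≥ M on a ball at time τ, and it suffices to show v ≥ λM
on the half cylinder. This is done by comparison with explicit barriers. The equation is used in
nondivergence form: at each point the Laplacian is a sum of second derivatives along a frame B_a,
iB_a, and the metric is remembered only through the two-sided bound of that frame by the model
metric (`exists_frame`, `IsFrame`). Derivatives are therefore taken along lines only.

The divisor is harmless because log|z_j| is pluriharmonic, hence has Laplacian zero for every frame.
Subtracting a small multiple of ∑ log|z_j| from v - φ forces the minimum off the divisor without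
disturbing the differential inequality, so bounded functions satisfy a comparison principle with no
condition on the divisor (`comparison`).

The barriers are functions of the polar coordinates ξ. One variable estimates for R = `polarRadius`,
all resting on b R ≤ x R' ≤ R, make their derivatives comparable with the model metric uniformly in
ε. Two barriers are needed.

A bump supported in a small ball that moves along a path, with exponentially decaying height,
transports a lower bound for v along the path (`propagation_along_path`). The Laplacian of |ξ - p|²
is controlled only where |p_j| ≤ 2|ξ_j| in the conic coordinates, so the path has to keep away from
the divisor. It can, since the divisor has real codimension two: a segment is bent sideways in each
complex coordinate. This gives positivity at every point at distance at least dr from the divisor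
(`positivity_away`).

The remaining points are reached by a barrier containing A√(d² + |ξ_j|²), whose Laplacian is at
least of order A/d where |ξ_j| < d. For small d it dominates all other terms, and where all the
small coordinates are at least d in modulus the first step already applies (`filling`,
`positivity_up_to_divisor`).

All lengths are multiples of r and all times multiples of r², so the constants do not depend on r.
-/

/-- `f` is differentiable near `x`, with `f' x = d` and `f'' x = c`. -/
def Jet2 (f : ℝ → ℝ) (x d c : ℝ) : Prop :=
  ∃ f' : ℝ → ℝ, (∀ᶠ y in 𝓝 x, HasDerivAt f (f' y) y) ∧ f' x = d ∧ HasDerivAt f' c x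

namespace Jet2

variable {f g : ℝ → ℝ} {x d c d' c' : ℝ}

theorem hasDerivAt (h : Jet2 f x d c) : HasDerivAt f d x := by
  obtain ⟨f', h1, rfl, -⟩ := h
  exact h1.self_of_nhds

theorem const (a x : ℝ) : Jet2 (fun _ => a) x 0 0 :=
  ⟨fun _ => 0, Eventually.of_forall fun y => hasDerivAt_const y a, rfl, hasDerivAt_const x 0⟩

theorem affine (a b x : ℝ) : Jet2 (fun t => a + t * b) x b 0 :=
  ⟨fun _ => b, Eventually.of_forall fun y => by
    simpa using ((hasDerivAt_id y).mul_const b).const_add a, rfl, hasDerivAt_const x b⟩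

theorem add (hf : Jet2 f x d c) (hg : Jet2 g x d' c') :
    Jet2 (fun y => f y + g y) x (d + d') (c + c') := by
  obtain ⟨f', h1, rfl, h2⟩ := hf
  obtain ⟨g', h3, rfl, h4⟩ := hg
  exact ⟨fun y => f' y + g' y, by filter_upwards [h1, h3] with y a b using a.add b, rfl, h2.add h4⟩

theorem mul (hf : Jet2 f x d c) (hg : Jet2 g x d' c') :
    Jet2 (fun y => f y * g y) x (d * g x + f x * d') (c * g x + 2 * d * d' + f x * c') := by
  have hf0 := hf.hasDerivAt
  have hg0 := hg.hasDerivAt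
  obtain ⟨f', h1, rfl, h2⟩ := hf
  obtain ⟨g', h3, rfl, h4⟩ := hg
  refine ⟨fun y => f' y * g y + f y * g' y, ?_, rfl, ?_⟩
  · filter_upwards [h1, h3] with y a b using a.mul b
  · exact ((h2.mul hg0).add (hf0.mul h4)).congr_deriv (by ring)

theorem comp (hf : Jet2 f x d c) (hg : Jet2 g (f x) d' c') :
    Jet2 (fun y => g (f y)) x (d' * d) (c' * d ^ 2 + d' * c) := by
  have hf0 := hf.hasDerivAt
  obtain ⟨f', h1, rfl, h2⟩ := hf
  obtain ⟨g', h3, rfl, h4⟩ := hg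
  refine ⟨fun y => g' (f y) * f' y, ?_, rfl, ?_⟩
  · filter_upwards [h1, hf0.continuousAt.eventually h3] with y a b using b.comp y a
  · have h5 : HasDerivAt (fun y => g' (f y)) (c' * f' x) x := h4.comp x hf0
    exact (h5.mul h2).congr_deriv (by ring)

theorem congr (hf : Jet2 f x d c) (h : g =ᶠ[𝓝 x] f) : Jet2 g x d c := by
  obtain ⟨f', h1, rfl, h2⟩ := hf
  refine ⟨f', ?_, rfl, h2⟩
  filter_upwards [h1, h.eventuallyEq_nhds] with y a b using a.congr_of_eventuallyEq b

/-- If c < 0, the second derivative test makes x a local maximum as well, so f is constant near x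
and c = 0. -/
theorem nonneg_of_isLocalMin (hf : Jet2 f x d c) (h : IsLocalMin f x) : 0 ≤ c := by
  by_contra hc
  push Not at hc
  have hf0 := hf.hasDerivAt
  obtain ⟨f', h1, rfl, h2⟩ := hf
  have hd : f' x = 0 := h.hasDerivAt_eq_zero hf0
  have hder : deriv f =ᶠ[𝓝 x] f' := by filter_upwards [h1] with y hy using hy.deriv
  have h3 : deriv (deriv f) x < 0 := by
    rw [hder.deriv_eq, h2.deriv]; exact hc
  have h4 : IsLocalMax f x :=
    isLocalMax_of_deriv_deriv_neg h3 (by rw [hf0.deriv, hd]) hf0.continuousAt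
  have h5 : f =ᶠ[𝓝 x] fun _ => f x := by
    filter_upwards [h, h4] with y a b using le_antisymm b a
  have h6 : f' =ᶠ[𝓝 x] fun _ => 0 := by
    filter_upwards [h1, h5.eventuallyEq_nhds] with y a b
    rw [← a.deriv, b.deriv_eq, deriv_const]
  have h7 : c = 0 := by
    rw [← h2.deriv, h6.deriv_eq, deriv_const]
  exact hc.ne h7

end Jet2

variable {n : ℕ}

/-- First (`D`) and second (`Q`) derivatives of `f` at `z` along all real lines through `z`. -/
def HasJet (f : Cn n → ℝ) (z : Cn n) (D Q : Cn n → ℝ) : Prop :=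
  ∀ b : Cn n, Jet2 (fun t : ℝ => f (z + t • b)) 0 (D b) (Q b)

namespace HasJet

variable {f g : Cn n → ℝ} {z : Cn n} {D Q D' Q' : Cn n → ℝ}

theorem const (a : ℝ) (z : Cn n) : HasJet (fun _ => a) z (fun _ => 0) (fun _ => 0) :=
  fun _ => Jet2.const a 0

theorem add (hf : HasJet f z D Q) (hg : HasJet g z D' Q') :
    HasJet (fun w => f w + g w) z (fun b => D b + D' b) (fun b => Q b + Q' b) :=
  fun b => (hf b).add (hg b)

theorem mul (hf : HasJet f z D Q) (hg : HasJet g z D' Q') :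
    HasJet (fun w => f w * g w) z (fun b => D b * g z + f z * D' b)
      (fun b => Q b * g z + 2 * D b * D' b + f z * Q' b) := fun b => by
  simpa using (hf b).mul (hg b)

theorem const_mul (a : ℝ) (hf : HasJet f z D Q) :
    HasJet (fun w => a * f w) z (fun b => a * D b) (fun b => a * Q b) := by
  simpa using (const a z).mul hf

theorem comp {h : ℝ → ℝ} {d c : ℝ} (hf : HasJet f z D Q) (hh : Jet2 h (f z) d c) :
    HasJet (fun w => h (f w)) z (fun b => d * D b) (fun b => c * D b ^ 2 + d * Q b) := fun b => by
  have h0 : f (z + (0 : ℝ) • b) = f z := by simp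
  exact (hf b).comp (g := h) (by simpa only [h0] using hh)

theorem congr (hf : HasJet f z D Q) (h : g =ᶠ[𝓝 z] f) : HasJet g z D Q := fun b => by
  refine (hf b).congr ?_
  have h1 : Tendsto (fun t : ℝ => z + t • b) (𝓝 0) (𝓝 z) := by
    have : Continuous fun t : ℝ => z + t • b := by fun_prop
    simpa using this.tendsto 0
  exact h1.eventually h

theorem sum {ι : Type*} (s : Finset ι) {f : ι → Cn n → ℝ} {D Q : ι → Cn n → ℝ}
    (h : ∀ i ∈ s, HasJet (f i) z (D i) (Q i)) :
    HasJet (fun w => ∑ i ∈ s, f i w) z (fun b => ∑ i ∈ s, D i b) (fun b => ∑ i ∈ s, Q i b) := by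
  classical
  induction s using Finset.induction_on with
  | empty => simpa using const 0 z
  | insert a s ha ih =>
    simp only [Finset.sum_insert ha]
    exact (h a (Finset.mem_insert_self a s)).add
      (ih fun i hi => h i (Finset.mem_insert_of_mem hi))

theorem nonneg_of_isLocalMin (hf : HasJet f z D Q) (h : IsLocalMin f z) (b : Cn n) :
    0 ≤ Q b := by
  refine (hf b).nonneg_of_isLocalMin ?_
  have h1 : Tendsto (fun t : ℝ => z + t • b) (𝓝 0) (𝓝 z) := by
    have : Continuous fun t : ℝ => z + t • b := by fun_prop
    simpa using this.tendsto 0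
  have := h1.eventually h
  simpa [IsLocalMin, IsMinFilter] using this

theorem of_fderiv (h1 : ∀ᶠ w in 𝓝 z, DifferentiableAt ℝ f w)
    (h2 : DifferentiableAt ℝ (fderiv ℝ f) z) :
    HasJet f z (fun b => fderiv ℝ f z b) (fun b => fderiv ℝ (fderiv ℝ f) z b b) := fun b => by
  have hl : ∀ t : ℝ, HasDerivAt (fun t : ℝ => z + t • b) b t := fun t => by
    simpa using ((hasDerivAt_id t).smul_const b).const_add z
  have h3 : Tendsto (fun t : ℝ => z + t • b) (𝓝 0) (𝓝 z) := by
    simpa using (hl 0).continuousAt.tendsto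
  refine ⟨fun t => fderiv ℝ f (z + t • b) b, ?_, by simp, ?_⟩
  · filter_upwards [h3.eventually h1] with t ht
    exact ht.hasFDerivAt.comp_hasDerivAt t (hl t)
  · have h4 : HasFDerivAt (fderiv ℝ f) (fderiv ℝ (fderiv ℝ f) z) (z + (0 : ℝ) • b) := by
      simpa using h2.hasFDerivAt
    have h5 := h4.comp_hasDerivAt (0 : ℝ) (hl 0)
    exact ((ContinuousLinearMap.apply ℝ ℝ b).hasFDerivAt.comp_hasDerivAt (0 : ℝ) h5)

end HasJet

/-- The sum of the second derivatives `Q` along the directions `B a` and `i B a`. -/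
noncomputable def frameLaplacian (B : Fin n → Cn n) (Q : Cn n → ℝ) : ℝ :=
  ∑ a, (Q (B a) + Q (Complex.I • B a))

theorem frameLaplacian_add (B : Fin n → Cn n) (Q Q' : Cn n → ℝ) :
    frameLaplacian B (fun b => Q b + Q' b) = frameLaplacian B Q + frameLaplacian B Q' := by
  simp only [frameLaplacian, ← Finset.sum_add_distrib]
  exact Finset.sum_congr rfl fun a _ => by ring

theorem frameLaplacian_const_mul (B : Fin n → Cn n) (c : ℝ) (Q : Cn n → ℝ) :
    frameLaplacian B (fun b => c * Q b) = c * frameLaplacian B Q := by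
  simp only [frameLaplacian, Finset.mul_sum]
  exact Finset.sum_congr rfl fun a _ => by ring

theorem frameLaplacian_sum {ι : Type*} (s : Finset ι) (B : Fin n → Cn n) (Q : ι → Cn n → ℝ) :
    frameLaplacian B (fun b => ∑ i ∈ s, Q i b) = ∑ i ∈ s, frameLaplacian B (Q i) := by
  simp only [frameLaplacian, ← Finset.sum_add_distrib]
  exact Finset.sum_comm

end ConicHeat

namespace ConicHeat

variable {n : ℕ}

/-! ### Diagonalizing frames for the Laplacian of a Hermitian matrix -/

theorem eq_sum_single (b : Cn n) :
    b = ∑ j, ((b j).re • (EuclideanSpace.single j (1 : ℂ) : Cn n)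
      + (b j).im • (EuclideanSpace.single j Complex.I : Cn n)) := by
  ext i
  have h : ∀ j : Fin n, ((b j).re • (EuclideanSpace.single j (1 : ℂ) : Cn n)
      + (b j).im • (EuclideanSpace.single j Complex.I : Cn n)) i = if i = j then b j else 0 := by
    intro j
    by_cases hij : i = j
    · subst hij
      simp
    · simp [hij]
  rw [WithLp.ofLp_sum, Finset.sum_apply, Finset.sum_congr rfl fun j _ => h j]
  simp

theorem bilinear_apply_self (H : Cn n →L[ℝ] Cn n →L[ℝ] ℝ) (b : Cn n) :
    H b b = ∑ j, ∑ l,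
      ((b j).re * (b l).re * H (EuclideanSpace.single j 1) (EuclideanSpace.single l 1)
      + (b j).re * (b l).im * H (EuclideanSpace.single j 1) (EuclideanSpace.single l Complex.I)
      + (b j).im * (b l).re * H (EuclideanSpace.single j Complex.I) (EuclideanSpace.single l 1)
      + (b j).im * (b l).im
        * H (EuclideanSpace.single j Complex.I) (EuclideanSpace.single l Complex.I)) := by
  conv_lhs => rw [eq_sum_single b]
  simp only [map_sum, map_add, map_smul, sum_apply,
    add_apply, smul_apply, smul_eq_mul]
  rw [Finset.sum_comm]
  simp only [Finset.mul_sum, ← Finset.sum_add_distrib]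
  refine Finset.sum_congr rfl fun j _ => Finset.sum_congr rfl fun l _ => ?_
  ring

/-- The complex Hessian as an operation on real bilinear forms. -/
noncomputable def complexForm (H : Cn n →L[ℝ] Cn n →L[ℝ] ℝ) : Matrix (Fin n) (Fin n) ℂ :=
  let X : Fin n → Cn n := fun j => EuclideanSpace.single j 1
  let Y : Fin n → Cn n := fun j => EuclideanSpace.single j Complex.I
  Matrix.of fun j l =>
    (1 / 4 : ℂ) * (((H (X j) (X l) + H (Y j) (Y l) : ℝ) : ℂ)
      + Complex.I * ((H (X j) (Y l) - H (Y j) (X l) : ℝ) : ℂ))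

/-- Averaging over b and ib cancels the (2,0) and (0,2) parts of a real form, so only its Levi form
survives. -/
theorem bilinear_add_rotate (H : Cn n →L[ℝ] Cn n →L[ℝ] ℝ) (b : Cn n) :
    H b b + H (Complex.I • b) (Complex.I • b)
      = 4 * (∑ l, ∑ j, star (b l) * b j * complexForm H j l).re := by
  rw [bilinear_apply_self, bilinear_apply_self,
    Finset.sum_comm (f := fun l j => star (b l) * b j * complexForm H j l)]
  simp only [Complex.re_sum, Finset.mul_sum, ← Finset.sum_add_distrib]
  refine Finset.sum_congr rfl fun j _ => Finset.sum_congr rfl fun l _ => ?_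
  have h4 : (1 / 4 : ℂ) = ((1 / 4 : ℝ) : ℂ) := by norm_num
  simp only [complexForm, Matrix.of_apply, h4, Complex.mul_re, Complex.mul_im, Complex.add_re,
    Complex.add_im, Complex.ofReal_re, Complex.ofReal_im, Complex.I_re, Complex.I_im,
    PiLp.smul_apply, smul_eq_mul, RCLike.star_def, Complex.conj_re, Complex.conj_im]
  ring

/-- Factor G⁻¹ = X*X and take the rows of X as frame. Then ∑ |B_a j|² is a diagonal entry of G⁻¹ and
the last sum is the quadratic form of G⁻¹, so both bounds say that inversion reverses the
inequalities between G and the diagonal metric m. -/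
theorem exists_frame {G : Matrix (Fin n) (Fin n) ℂ} {m : Fin n → ℝ} {K : ℝ} (hK : 0 < K)
    (hm : ∀ j, 0 < m j) (hG : G.PosDef)
    (hl : (G - ((K⁻¹ : ℝ) : ℂ) • Matrix.diagonal fun j => (m j : ℂ)).PosSemidef)
    (hu : ((K : ℂ) • (Matrix.diagonal fun j => (m j : ℂ)) - G).PosSemidef) :
    ∃ B : Fin n → Cn n,
      (∀ H : Cn n →L[ℝ] Cn n →L[ℝ] ℝ, 4 * (G⁻¹ * complexForm H).trace.re
        = frameLaplacian B fun b => H b b) ∧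
      (∀ j, ∑ a, ‖B a j‖ ^ 2 ≤ K / m j) ∧
      ∀ c : Fin n → ℂ, K⁻¹ * ∑ j, ‖c j‖ ^ 2 / m j ≤ ∑ a, ‖∑ j, c j * B a j‖ ^ 2 := by
  have hdet : IsUnit G.det := (Matrix.isUnit_iff_isUnit_det _).mp hG.isUnit
  obtain ⟨X, hX⟩ : ∃ X : Matrix (Fin n) (Fin n) ℂ, G⁻¹ = X.conjTranspose * X := by
    open scoped MatrixOrder in
    exact CStarAlgebra.nonneg_iff_eq_star_mul_self.mp hG.inv.posSemidef.nonneg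
  have hdiag : ∀ x : Fin n → ℂ,
      (star x ⬝ᵥ (Matrix.diagonal fun j => (m j : ℂ)).mulVec x).re = ∑ j, m j * ‖x j‖ ^ 2 := by
    intro x
    simp only [dotProduct, Matrix.mulVec_diagonal, Complex.re_sum, Pi.star_apply]
    refine Finset.sum_congr rfl fun j _ => ?_
    rw [mul_left_comm, RCLike.star_def, Complex.conj_mul', Complex.re_ofReal_mul]
    norm_cast
  have hlow : ∀ x : Fin n → ℂ, K⁻¹ * ∑ j, m j * ‖x j‖ ^ 2 ≤ (star x ⬝ᵥ G.mulVec x).re := by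
    intro x
    have h := (Complex.le_def.mp (hl.dotProduct_mulVec_nonneg x)).1
    rw [Matrix.sub_mulVec, dotProduct_sub, Matrix.smul_mulVec, dotProduct_smul, Complex.sub_re,
      smul_eq_mul, Complex.re_ofReal_mul, hdiag] at h
    simpa using h
  have hupp : ∀ x : Fin n → ℂ, (star x ⬝ᵥ G.mulVec x).re ≤ K * ∑ j, m j * ‖x j‖ ^ 2 := by
    intro x
    have h := (Complex.le_def.mp (hu.dotProduct_mulVec_nonneg x)).1
    rw [Matrix.sub_mulVec, dotProduct_sub, Matrix.smul_mulVec, dotProduct_smul, Complex.sub_re,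
      smul_eq_mul, Complex.re_ofReal_mul, hdiag] at h
    simpa using h
  have hquad : ∀ c : Fin n → ℂ, (star c ⬝ᵥ G⁻¹.mulVec c).re = ∑ a, ‖∑ j, c j * X a j‖ ^ 2 := by
    intro c
    rw [hX, ← Matrix.mulVec_mulVec, Matrix.dotProduct_mulVec, ← Matrix.star_mulVec]
    simp only [dotProduct, Complex.re_sum, Pi.star_apply]
    refine Finset.sum_congr rfl fun a _ => ?_
    rw [RCLike.star_def, Complex.conj_mul']
    simp only [Matrix.mulVec, dotProduct, mul_comm (X a _)]
    norm_cast
  have hGi : ∀ c : Fin n → ℂ, G.mulVec (G⁻¹.mulVec c) = c := by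
    intro c
    rw [Matrix.mulVec_mulVec, Matrix.mul_nonsing_inv _ hdet, Matrix.one_mulVec]
  have hsymm : ∀ x y : Fin n → ℂ, star x ⬝ᵥ G.mulVec y = star (star y ⬝ᵥ G.mulVec x) := by
    intro x y
    rw [Matrix.star_dotProduct, Matrix.star_mulVec, hG.isHermitian.eq, Matrix.dotProduct_mulVec]
  refine ⟨fun a => WithLp.toLp 2 (X a), fun H => ?_, fun j => ?_, fun c => ?_⟩
  · simp only [frameLaplacian, bilinear_add_rotate]
    rw [hX, ← Finset.mul_sum, ← Complex.re_sum]
    congr 2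
    simp only [Matrix.trace, Matrix.diag_apply, Matrix.mul_apply, Matrix.conjTranspose_apply,
      Finset.sum_mul]
    rw [Finset.sum_comm (s := Finset.univ) (t := Finset.univ)
      (f := fun a l => ∑ j, star (X a l) * X a j * complexForm H j l)]
    refine Finset.sum_congr rfl fun l _ => ?_
    rw [Finset.sum_comm]
  · have h1 := hquad (Pi.single j 1)
    have h2 : ∀ a, ∑ i, (Pi.single j 1 : Fin n → ℂ) i * X a i = X a j := fun a => by
      simp [Pi.single_apply]
    simp only [h2] at h1
    set y := G⁻¹.mulVec (Pi.single j 1) with hy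
    have h3 : (star (Pi.single j 1 : Fin n → ℂ) ⬝ᵥ y) = y j := by
      simp [dotProduct, Pi.single_apply]
    rw [h3] at h1
    have h4 : (star y ⬝ᵥ G.mulVec y).re = (y j).re := by
      rw [hy, hGi, ← hy]
      simp [dotProduct, Pi.single_apply]
    have h5 := hlow y
    rw [h4, h1] at h5
    have h6 : m j * ‖y j‖ ^ 2 ≤ ∑ i, m i * ‖y i‖ ^ 2 :=
      Finset.single_le_sum (f := fun i => m i * ‖y i‖ ^ 2)
        (fun i _ => mul_nonneg (hm i).le (sq_nonneg _)) (Finset.mem_univ j)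
    have h7 : (y j).re ^ 2 ≤ ‖y j‖ ^ 2 := by
      rw [← sq_abs]
      gcongr
      exact Complex.abs_re_le_norm _
    rw [h1] at h7
    set q := ∑ a, ‖X a j‖ ^ 2 with hq
    change q ≤ K / m j
    have hq0 : 0 ≤ q := Finset.sum_nonneg fun a _ => sq_nonneg _
    rw [le_div_iff₀ (hm j)]
    have h8 : m j * q ^ 2 ≤ K * q := by
      have : K⁻¹ * (m j * q ^ 2) ≤ q :=
        le_trans (by have := hm j; gcongr; exact le_trans (by gcongr) h6) h5
      rwa [inv_mul_le_iff₀ hK] at this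
    rcases hq0.eq_or_lt with h0 | h0
    · rw [← h0]; simpa using hK.le
    · nlinarith
  · rw [← hquad]
    set y := G⁻¹.mulVec c with hy
    set d : Fin n → ℂ := fun j => ((m j)⁻¹ : ℝ) * c j with hd
    set S := ∑ j, ‖c j‖ ^ 2 / m j with hS
    have e1 : (star d ⬝ᵥ c).re = S := by
      simp only [dotProduct, Complex.re_sum, hS, Pi.star_apply]
      refine Finset.sum_congr rfl fun j _ => ?_
      rw [hd]
      simp only [star_mul', RCLike.star_def, Complex.conj_ofReal, mul_assoc]
      rw [Complex.conj_mul', Complex.re_ofReal_mul, div_eq_inv_mul]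
      norm_cast
    have e2 : ∑ j, m j * ‖d j‖ ^ 2 = S := by
      refine Finset.sum_congr rfl fun j _ => ?_
      have := hm j
      rw [hd]
      simp only [norm_mul, Complex.norm_real, norm_inv, Real.norm_eq_abs, abs_of_pos this]
      field_simp
    have e3 := hupp d
    rw [e2] at e3
    -- Completing the square: with y = G⁻¹c and d = m⁻¹c, nonnegativity of the G-form at y - K⁻¹d,
    -- together with d*Gd ≤ K S, gives c*G⁻¹c ≥ K⁻¹S.
    have e4 := hlow (y - ((K⁻¹ : ℝ) : ℂ) • d)
    have e5 : 0 ≤ K⁻¹ * ∑ j, m j * ‖(y - ((K⁻¹ : ℝ) : ℂ) • d) j‖ ^ 2 :=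
      mul_nonneg (inv_pos.mpr hK).le
        (Finset.sum_nonneg fun i _ => mul_nonneg (hm i).le (sq_nonneg _))
    have e6 : (star (y - ((K⁻¹ : ℝ) : ℂ) • d) ⬝ᵥ G.mulVec (y - ((K⁻¹ : ℝ) : ℂ) • d)).re
        = (star c ⬝ᵥ y).re - 2 * K⁻¹ * S + K⁻¹ ^ 2 * (star d ⬝ᵥ G.mulVec d).re := by
      have f1 : star y ⬝ᵥ G.mulVec d = star (star d ⬝ᵥ c) := by
        rw [hsymm, hy, hGi]
      have f2 : star y ⬝ᵥ c = star (star c ⬝ᵥ y) := by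
        rw [Matrix.star_dotProduct]
      simp only [Matrix.mulVec_sub, Matrix.mulVec_smul, star_sub, star_smul, sub_dotProduct,
        dotProduct_sub, smul_dotProduct, dotProduct_smul, f1]
      rw [hy, hGi, ← hy, f2]
      simp only [smul_eq_mul, RCLike.star_def, Complex.conj_ofReal, Complex.sub_re,
        Complex.re_ofReal_mul, Complex.conj_re, e1]
      ring
    have e7 : K⁻¹ ^ 2 * (star d ⬝ᵥ G.mulVec d).re ≤ K⁻¹ * S := by
      have : K⁻¹ ^ 2 * (star d ⬝ᵥ G.mulVec d).re ≤ K⁻¹ ^ 2 * (K * S) := by gcongr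
      refine this.trans (le_of_eq ?_)
      field_simp
    linarith [e4, e5, e6, e7]

end ConicHeat

namespace ConicHeat

/-! ### The polar radius -/

section Radius

variable {b ε x : ℝ}

/-- The derivative of the polar radius. -/
noncomputable def radialSpeed (b ε x : ℝ) : ℝ := b * (x ^ 2 + ε ^ 2) ^ ((b - 1) / 2)

theorem radialSpeed_pos (hb : 0 < b) (hx : 0 < x) : 0 < radialSpeed b ε x := by
  unfold radialSpeed; positivity

theorem radialSpeed_sq (hx : 0 < x) :
    radialSpeed b ε x ^ 2 = b ^ 2 / (x ^ 2 + ε ^ 2) ^ (1 - b) := by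
  have h : 0 < x ^ 2 + ε ^ 2 := by positivity
  rw [radialSpeed, mul_pow, ← Real.rpow_natCast (_ ^ _), ← Real.rpow_mul h.le, div_eq_mul_inv (b ^ 2),
    ← Real.rpow_neg h.le]
  congr 2
  push_cast
  ring

theorem radialSpeed_anti (hb0 : 0 < b) (hb1 : b ≤ 1) {y : ℝ} (hx : 0 < x) (hxy : x ≤ y) :
    radialSpeed b ε y ≤ radialSpeed b ε x := by
  unfold radialSpeed
  refine mul_le_mul_of_nonneg_left ?_ hb0.le
  exact Real.rpow_le_rpow_of_nonpos (by positivity) (by gcongr) (by linarith)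

/-- x^(1-b) times the speed equals b (x²/(x²+ε²))^((1-b)/2), which increases in x. This controls the
speed near 0 by an integrable power, with no constant depending on ε. -/
theorem radialSpeed_le (hb0 : 0 < b) (hb1 : b ≤ 1) {y : ℝ} (hx : 0 < x) (hxy : x ≤ y) :
    radialSpeed b ε x ≤ x ^ (b - 1) * (y ^ (1 - b) * radialSpeed b ε y) := by
  have hy : 0 < y := hx.trans_le hxy
  have h1 : x ^ (1 - b) * radialSpeed b ε x ≤ y ^ (1 - b) * radialSpeed b ε y := by
    have h2 : ∀ t : ℝ, 0 < t →
        t ^ (1 - b) * radialSpeed b ε t = b * (t ^ 2 / (t ^ 2 + ε ^ 2)) ^ ((1 - b) / 2) := by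
      intro t ht
      have h3 : t ^ (1 - b) = (t ^ 2) ^ ((1 - b) / 2) := by
        rw [← Real.rpow_natCast, ← Real.rpow_mul ht.le]
        congr 1
        push_cast
        ring
      rw [Real.div_rpow (by positivity) (by positivity), radialSpeed, h3,
        show (b - 1) / 2 = -((1 - b) / 2) by ring, Real.rpow_neg (by positivity)]
      ring
    rw [h2 x hx, h2 y hy]
    refine mul_le_mul_of_nonneg_left ?_ hb0.le
    refine Real.rpow_le_rpow (by positivity) ?_ (by linarith)
    rw [div_le_div_iff₀ (by positivity) (by positivity)]
    have : x ^ 2 ≤ y ^ 2 := by gcongr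
    nlinarith [mul_le_mul_of_nonneg_right this (sq_nonneg ε)]
  calc radialSpeed b ε x = x ^ (b - 1) * (x ^ (1 - b) * radialSpeed b ε x) := by
        rw [← mul_assoc, ← Real.rpow_add hx]; simp
    _ ≤ _ := by gcongr

theorem intervalIntegrable_radialSpeed (hb0 : 0 < b) (hb1 : b ≤ 1) (hx : 0 < x) :
    IntervalIntegrable (radialSpeed b ε) MeasureTheory.volume 0 x := by
  have h1 : IntervalIntegrable (fun t : ℝ => t ^ (b - 1) * (x ^ (1 - b) * radialSpeed b ε x))
      MeasureTheory.volume 0 x :=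
    (intervalIntegral.intervalIntegrable_rpow' (by linarith)).mul_const _
  refine h1.mono_fun ?_ ?_
  · refine Measurable.aestronglyMeasurable ?_
    unfold radialSpeed
    fun_prop
  · rw [uIoc_of_le hx.le]
    refine (MeasureTheory.ae_restrict_mem measurableSet_Ioc).mono fun t ht => ?_
    change ‖radialSpeed b ε t‖ ≤ _
    rw [Real.norm_of_nonneg (radialSpeed_pos hb0 ht.1).le]
    exact (radialSpeed_le hb0 hb1 ht.1 ht.2).trans (le_abs_self _)

theorem polarRadius_eq_integral : polarRadius b ε x = ∫ t in (0 : ℝ)..x, radialSpeed b ε t := rfl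

theorem hasDerivAt_polarRadius (hb0 : 0 < b) (hb1 : b ≤ 1) (hx : 0 < x) :
    HasDerivAt (polarRadius b ε) (radialSpeed b ε x) x := by
  refine intervalIntegral.integral_hasDerivAt_right (intervalIntegrable_radialSpeed hb0 hb1 hx)
    (Measurable.stronglyMeasurable ?_).stronglyMeasurableAtFilter ?_
  · fun_prop
  · have h : x ^ 2 + ε ^ 2 ≠ 0 := by positivity
    exact continuousAt_const.mul (ContinuousAt.rpow_const (by fun_prop) (Or.inl h))

/-- The speed decreases, so its integral over (0, x) is at least x times its final value. Together
with `le_mul_radialSpeed` this says that the radial stretching R' and the angular stretching R/x of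
the polar map agree up to the factor b, uniformly in ε. -/
theorem mul_radialSpeed_le (hb0 : 0 < b) (hb1 : b ≤ 1) (hx : 0 < x) :
    x * radialSpeed b ε x ≤ polarRadius b ε x := by
  have h : ∫ _ in (0 : ℝ)..x, radialSpeed b ε x ≤ ∫ t in (0 : ℝ)..x, radialSpeed b ε t :=
    intervalIntegral.integral_mono_on_of_le_Ioo hx.le intervalIntegrable_const
      (intervalIntegrable_radialSpeed hb0 hb1 hx)
      fun t ht => radialSpeed_anti hb0 hb1 ht.1 ht.2.le
  simpa [polarRadius_eq_integral] using h

theorem le_mul_radialSpeed (hb0 : 0 < b) (hb1 : b ≤ 1) (hx : 0 < x) :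
    b * polarRadius b ε x ≤ x * radialSpeed b ε x := by
  have h : ∫ t in (0 : ℝ)..x, radialSpeed b ε t
      ≤ ∫ t in (0 : ℝ)..x, t ^ (b - 1) * (x ^ (1 - b) * radialSpeed b ε x) :=
    intervalIntegral.integral_mono_on_of_le_Ioo hx.le
      (intervalIntegrable_radialSpeed hb0 hb1 hx)
      ((intervalIntegral.intervalIntegrable_rpow' (by linarith)).mul_const _)
      fun t ht => radialSpeed_le hb0 hb1 ht.1 ht.2.le
  rw [intervalIntegral.integral_mul_const, integral_rpow (Or.inl (by linarith)),
    sub_add_cancel, Real.zero_rpow hb0.ne', sub_zero, ← polarRadius_eq_integral] at h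
  have h2 : x ^ b / b * (x ^ (1 - b) * radialSpeed b ε x) = x * radialSpeed b ε x / b := by
    have : x ^ b * x ^ (1 - b) = x := by rw [← Real.rpow_add hx]; simp
    rw [div_mul_eq_mul_div, ← mul_assoc, this]
  rw [h2, le_div_iff₀ hb0] at h
  linarith

theorem polarRadius_pos (hb0 : 0 < b) (hb1 : b ≤ 1) (hx : 0 < x) : 0 < polarRadius b ε x :=
  (mul_pos hx (radialSpeed_pos hb0 hx)).trans_le (mul_radialSpeed_le hb0 hb1 hx)

/-- The polar radius tends to infinity. -/
theorem tendsto_polarRadius (hb0 : 0 < b) (hb1 : b ≤ 1) (hε : 0 ≤ ε) :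
    Tendsto (polarRadius b ε) atTop atTop := by
  have h1 : Tendsto (fun x : ℝ => b * 2 ^ ((b - 1) / 2) * x ^ b) atTop atTop :=
    (tendsto_rpow_atTop hb0).const_mul_atTop (by positivity)
  refine tendsto_atTop_mono' atTop ?_ h1
  filter_upwards [eventually_ge_atTop (ε + 1)] with x hx
  have hx0 : 0 < x := by linarith
  refine le_trans ?_ (mul_radialSpeed_le hb0 hb1 hx0)
  -- Here ε ≤ x, so x² + ε² ≤ 2x², and the exponent is nonpositive.
  have h2 : (2 * x ^ 2) ^ ((b - 1) / 2) ≤ (x ^ 2 + ε ^ 2) ^ ((b - 1) / 2) :=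
    Real.rpow_le_rpow_of_nonpos (by positivity) (by nlinarith) (by linarith)
  have h3 : x * (x ^ 2) ^ ((b - 1) / 2) = x ^ b := by
    rw [← Real.rpow_natCast, ← Real.rpow_mul hx0.le]
    nth_rewrite 1 [← Real.rpow_one x]
    rw [← Real.rpow_add hx0]
    congr 1
    push_cast
    ring
  rw [Real.mul_rpow (by norm_num) (by positivity)] at h2
  calc b * 2 ^ ((b - 1) / 2) * x ^ b
      = x * (b * (2 ^ ((b - 1) / 2) * (x ^ 2) ^ ((b - 1) / 2))) := by rw [← h3]; ring
    _ ≤ x * radialSpeed b ε x := by unfold radialSpeed; gcongr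

theorem continuousOn_polarRadius (hb0 : 0 < b) (hb1 : b ≤ 1) :
    ContinuousOn (polarRadius b ε) (Ioi 0) := fun _ hx =>
  (hasDerivAt_polarRadius hb0 hb1 hx).continuousAt.continuousWithinAt

/-- The factor `k` with `A' = k A`, where `A = x R'(x)` as a function of `log x`. -/
noncomputable def radialRatio (b ε x : ℝ) : ℝ := 1 + (b - 1) * (x ^ 2 / (x ^ 2 + ε ^ 2))

theorem radialRatio_mem (hb1 : b ≤ 1) (hx : 0 < x) : radialRatio b ε x ∈ Icc b 1 := by
  have h0 : 0 ≤ x ^ 2 / (x ^ 2 + ε ^ 2) := by positivity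
  have h1 : x ^ 2 / (x ^ 2 + ε ^ 2) ≤ 1 := by
    rw [div_le_one (by positivity)]
    nlinarith [sq_nonneg ε]
  unfold radialRatio
  constructor <;> nlinarith

theorem hasDerivAt_mul_radialSpeed (hx : 0 < x) :
    HasDerivAt (fun x => x * radialSpeed b ε x) (radialRatio b ε x * radialSpeed b ε x) x := by
  have h : 0 < x ^ 2 + ε ^ 2 := by positivity
  have h1 : HasDerivAt (fun x : ℝ => x ^ 2 + ε ^ 2) (2 * x) x := by
    simpa using ((hasDerivAt_id x).pow 2).add_const (ε ^ 2)
  have h2 := (h1.rpow_const (p := (b - 1) / 2) (Or.inl h.ne')).const_mul b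
  refine ((hasDerivAt_id x).mul h2).congr_deriv ?_
  simp only [radialSpeed, radialRatio, id]
  rw [Real.rpow_sub_one h.ne']
  field_simp

/-- The polar radius as a function of the logarithm of `x`. -/
theorem jet2_polarRadius_exp (hb0 : 0 < b) (hb1 : b ≤ 1) (σ : ℝ) :
    Jet2 (fun s => polarRadius b ε (Real.exp s)) σ
      (Real.exp σ * radialSpeed b ε (Real.exp σ))
      (radialRatio b ε (Real.exp σ) * (Real.exp σ * radialSpeed b ε (Real.exp σ))) := by
  refine ⟨fun s => Real.exp s * radialSpeed b ε (Real.exp s), Eventually.of_forall fun s => ?_,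
    rfl, ?_⟩
  · have := (hasDerivAt_polarRadius (ε := ε) hb0 hb1 (Real.exp_pos s)).comp s (Real.hasDerivAt_exp s)
    exact this.congr_deriv (mul_comm _ _)
  · have := (hasDerivAt_mul_radialSpeed (b := b) (ε := ε) (Real.exp_pos σ)).comp σ
      (Real.hasDerivAt_exp σ)
    exact this.congr_deriv (by ring)

end Radius

/-! ### Jets of real functions on the plane -/

/-- At `z`, the derivative of `U` is `b ↦ Re (c b)` and the Laplacian is `2 τ` (as a trace over
the frame `b, i b` it is `τ |b|²`). -/
def HasPlaneJet (U : ℂ → ℝ) (z c : ℂ) (τ : ℝ) : Prop :=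
  ∃ Q : ℂ → ℝ, (∀ b : ℂ, Jet2 (fun t : ℝ => U (z + t * b)) 0 (c * b).re (Q b)) ∧
    ∀ b : ℂ, Q b + Q (Complex.I * b) = τ * ‖b‖ ^ 2

namespace HasPlaneJet

variable {U V : ℂ → ℝ} {z c c' : ℂ} {τ τ' : ℝ}

theorem const (a : ℝ) (z : ℂ) : HasPlaneJet (fun _ => a) z 0 0 :=
  ⟨fun _ => 0, fun b => by simpa using Jet2.const a 0, fun b => by simp⟩

theorem re_mul (p z : ℂ) : HasPlaneJet (fun w => (p * w).re) z p 0 :=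
  ⟨fun _ => 0, fun b => by
    have := Jet2.affine (p * z).re (p * b).re 0
    refine this.congr (Eventually.of_forall fun t => ?_)
    change (p * (z + t * b)).re = (p * z).re + t * (p * b).re
    rw [mul_add, Complex.add_re, mul_left_comm, Complex.re_ofReal_mul], fun b => by simp⟩

theorem add (hU : HasPlaneJet U z c τ) (hV : HasPlaneJet V z c' τ') :
    HasPlaneJet (fun w => U w + V w) z (c + c') (τ + τ') := by
  obtain ⟨Q, h1, h2⟩ := hU
  obtain ⟨Q', h3, h4⟩ := hV
  refine ⟨fun b => Q b + Q' b, fun b => ?_, fun b => by linear_combination h2 b + h4 b⟩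
  rw [add_mul, Complex.add_re]
  exact (h1 b).add (h3 b)

theorem mul (hU : HasPlaneJet U z c τ) (hV : HasPlaneJet V z c' τ') :
    HasPlaneJet (fun w => U w * V w) z (c * V z + U z * c')
      (τ * V z + 2 * (c * star c').re + U z * τ') := by
  obtain ⟨Q, h1, h2⟩ := hU
  obtain ⟨Q', h3, h4⟩ := hV
  refine ⟨fun b => Q b * V z + 2 * (c * b).re * (c' * b).re + U z * Q' b, fun b => ?_,
    fun b => ?_⟩
  · have h := (h1 b).mul (h3 b)
    simp only [Complex.ofReal_zero, zero_mul, add_zero] at h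
    convert h using 1
    simp only [add_mul, Complex.add_re, Complex.mul_re, Complex.mul_im, Complex.ofReal_re,
      Complex.ofReal_im]
    ring
  · rw [show Q b * V z + 2 * (c * b).re * (c' * b).re + U z * Q' b
      + (Q (Complex.I * b) * V z + 2 * (c * (Complex.I * b)).re * (c' * (Complex.I * b)).re
        + U z * Q' (Complex.I * b)) = (Q b + Q (Complex.I * b)) * V z
        + U z * (Q' b + Q' (Complex.I * b)) + 2 * ((c * b).re * (c' * b).re
        + (c * (Complex.I * b)).re * (c' * (Complex.I * b)).re) by ring, h2, h4,
      ← Complex.normSq_eq_norm_sq]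
    simp only [Complex.mul_re, Complex.mul_im, Complex.I_re, Complex.I_im, Complex.normSq_apply,
      RCLike.star_def, Complex.conj_re, Complex.conj_im]
    ring

theorem comp {h : ℝ → ℝ} {d e : ℝ} (hU : HasPlaneJet U z c τ) (hh : Jet2 h (U z) d e) :
    HasPlaneJet (fun w => h (U w)) z (d * c) (e * ‖c‖ ^ 2 + d * τ) := by
  obtain ⟨Q, h1, h2⟩ := hU
  refine ⟨fun b => e * (c * b).re ^ 2 + d * Q b, fun b => ?_, fun b => ?_⟩
  · have h0 : U (z + ((0 : ℝ) : ℂ) * b) = U z := by simp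
    rw [mul_assoc, Complex.re_ofReal_mul]
    exact (h1 b).comp (g := h) (by simpa only [h0] using hh)
  · rw [show e * (c * b).re ^ 2 + d * Q b + (e * (c * (Complex.I * b)).re ^ 2
      + d * Q (Complex.I * b)) = e * ((c * b).re ^ 2 + (c * (Complex.I * b)).re ^ 2)
      + d * (Q b + Q (Complex.I * b)) by ring, h2, ← Complex.normSq_eq_norm_sq,
      ← Complex.normSq_eq_norm_sq]
    simp only [Complex.mul_re, Complex.mul_im, Complex.I_re, Complex.I_im, Complex.normSq_apply]
    ring

theorem congr (hU : HasPlaneJet U z c τ) (h : V =ᶠ[𝓝 z] U) : HasPlaneJet V z c τ := by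
  obtain ⟨Q, h1, h2⟩ := hU
  refine ⟨Q, fun b => (h1 b).congr ?_, h2⟩
  have h3 : Tendsto (fun t : ℝ => z + t * b) (𝓝 0) (𝓝 z) := by
    have : Continuous fun t : ℝ => z + t * b := by fun_prop
    simpa using this.tendsto 0
  exact h3.eventually h

theorem normSq (z : ℂ) : HasPlaneJet (fun w => ‖w‖ ^ 2) z (2 * star z) 4 := by
  refine ⟨fun b => 2 * ‖b‖ ^ 2, fun b => ?_, fun b => ?_⟩
  · have h1 := (Jet2.affine z.re b.re 0).mul (Jet2.affine z.re b.re 0)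
    have h2 := (Jet2.affine z.im b.im 0).mul (Jet2.affine z.im b.im 0)
    have h3 : Jet2 (fun t : ℝ => ‖z + t * b‖ ^ 2) 0 _ _ := (h1.add h2).congr
      (Eventually.of_forall fun t => by
        change ‖z + t * b‖ ^ 2 = (z.re + t * b.re) * (z.re + t * b.re)
          + (z.im + t * b.im) * (z.im + t * b.im)
        rw [← Complex.normSq_eq_norm_sq, Complex.normSq_apply]
        simp [Complex.mul_re, Complex.mul_im])
    convert h3 using 1
    · simp only [Complex.mul_re, Complex.mul_im, RCLike.star_def, Complex.conj_re,
        Complex.conj_im, Complex.re_ofNat, Complex.im_ofNat]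
      ring
    · beta_reduce
      rw [← Complex.normSq_eq_norm_sq, Complex.normSq_apply]
      ring
  · beta_reduce
    rw [norm_mul, Complex.norm_I]
    ring

theorem log_norm (hz : z ≠ 0) : HasPlaneJet (fun w => Real.log ‖w‖) z z⁻¹ 0 := by
  have hz' : 0 < ‖z‖ := norm_pos_iff.mpr hz
  have h1 : Jet2 (fun s : ℝ => (1 / 2) * Real.log s) (‖z‖ ^ 2) (1 / 2 * (‖z‖ ^ 2)⁻¹)
      (1 / 2 * (-(((‖z‖ ^ 2) ^ 2)⁻¹))) := by
    refine ⟨fun s => 1 / 2 * s⁻¹, ?_, rfl, ?_⟩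
    · filter_upwards [eventually_ne_nhds (by positivity : ‖z‖ ^ 2 ≠ 0)] with s hs
      exact (Real.hasDerivAt_log hs).const_mul _
    · exact (hasDerivAt_inv (by positivity)).const_mul _
  have h2 := (normSq z).comp h1
  have h3 : (fun w : ℂ => 1 / 2 * Real.log (‖w‖ ^ 2)) = fun w => Real.log ‖w‖ := by
    ext w
    rw [Real.log_pow]
    push_cast
    ring
  rw [h3] at h2
  convert h2 using 1
  · rw [Complex.inv_def, Complex.normSq_eq_norm_sq]
    simp only [RCLike.star_def]
    push_cast
    ring
  · rw [norm_mul, norm_star]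
    norm_num
    field_simp
    ring

end HasPlaneJet

end ConicHeat

namespace ConicHeat

/-! ### Squared distances and regularized radii in one polar coordinate -/

section PlaneJets

variable {b ε : ℝ} {z p : ℂ}

/-- The polar coordinate of one complex variable. -/
noncomputable def polarCoord (b ε : ℝ) (w : ℂ) : ℂ := ((polarRadius b ε ‖w‖ / ‖w‖ : ℝ) : ℂ) * w

theorem norm_polarCoord (hb0 : 0 < b) (hb1 : b ≤ 1) (hz : z ≠ 0) :
    ‖polarCoord b ε z‖ = polarRadius b ε ‖z‖ := by
  have hz' : 0 < ‖z‖ := norm_pos_iff.mpr hz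
  have := polarRadius_pos (ε := ε) hb0 hb1 hz'
  rw [polarCoord, norm_mul, Complex.norm_real, Real.norm_of_nonneg (by positivity)]
  field_simp

theorem continuousAt_polarCoord (hb0 : 0 < b) (hb1 : b ≤ 1) (hz : z ≠ 0) :
    ContinuousAt (polarCoord b ε) z := by
  have hz' : 0 < ‖z‖ := norm_pos_iff.mpr hz
  have h1 : ContinuousAt (fun w : ℂ => polarRadius b ε ‖w‖) z :=
    ((hasDerivAt_polarRadius hb0 hb1 hz').continuousAt).comp
      (f := fun w : ℂ => ‖w‖) continuous_norm.continuousAt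
  unfold polarCoord
  exact (Complex.continuous_ofReal.continuousAt.comp
    (h1.div continuous_norm.continuousAt hz'.ne')).mul continuousAt_id

/-- Since log|z| is harmonic with gradient 1/z, a radial function written in σ = log|z| has
Laplacian proportional to its plain second derivative in σ. Every radial computation below is done
in this variable. -/
theorem planeJet_comp_log {h : ℝ → ℝ} {d e : ℝ} (hz : z ≠ 0)
    (hh : Jet2 h (Real.log ‖z‖) d e) :
    HasPlaneJet (fun w => h (Real.log ‖w‖)) z (d * z⁻¹) (e / ‖z‖ ^ 2) := by
  have := (HasPlaneJet.log_norm hz).comp hh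
  rwa [norm_inv, inv_pow, mul_zero, add_zero, ← div_eq_mul_inv] at this

theorem planeJet_polarRadius (hb0 : 0 < b) (hb1 : b ≤ 1) (hz : z ≠ 0) :
    HasPlaneJet (fun w => polarRadius b ε ‖w‖) z ((‖z‖ * radialSpeed b ε ‖z‖ : ℝ) * z⁻¹)
      (radialRatio b ε ‖z‖ * (‖z‖ * radialSpeed b ε ‖z‖) / ‖z‖ ^ 2) := by
  have hz' : 0 < ‖z‖ := norm_pos_iff.mpr hz
  have h := planeJet_comp_log hz (jet2_polarRadius_exp (ε := ε) hb0 hb1 (Real.log ‖z‖))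
  rw [Real.exp_log hz'] at h
  refine h.congr ?_
  filter_upwards [eventually_ne_nhds hz] with w hw
  rw [Real.exp_log (norm_pos_iff.mpr hw)]

theorem planeJet_polarRadius_div (hb0 : 0 < b) (hb1 : b ≤ 1) (hz : z ≠ 0) :
    HasPlaneJet (fun w => polarRadius b ε ‖w‖ / ‖w‖) z
      (((‖z‖ * radialSpeed b ε ‖z‖ - polarRadius b ε ‖z‖) / ‖z‖ : ℝ) * z⁻¹)
      ((radialRatio b ε ‖z‖ * (‖z‖ * radialSpeed b ε ‖z‖) - 2 * (‖z‖ * radialSpeed b ε ‖z‖)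
        + polarRadius b ε ‖z‖) / ‖z‖ / ‖z‖ ^ 2) := by
  have hz' : 0 < ‖z‖ := norm_pos_iff.mpr hz
  have h0 : Jet2 (fun s => Real.exp (-s)) (Real.log ‖z‖) (-Real.exp (-Real.log ‖z‖))
      (Real.exp (-Real.log ‖z‖)) := by
    have h1 : ∀ s : ℝ, HasDerivAt (fun s => Real.exp (-s)) (-Real.exp (-s)) s := fun s => by
      simpa using (hasDerivAt_neg s).exp
    exact ⟨fun s => -Real.exp (-s), Eventually.of_forall h1, rfl, (h1 _).neg.congr_deriv (neg_neg _)⟩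
  have h := planeJet_comp_log hz ((jet2_polarRadius_exp (ε := ε) hb0 hb1 (Real.log ‖z‖)).mul h0)
  rw [Real.exp_neg, Real.exp_log hz'] at h
  refine HasPlaneJet.congr (U := fun w => polarRadius b ε (Real.exp (Real.log ‖w‖))
    * Real.exp (-Real.log ‖w‖)) ?_ ?_
  · convert h using 2
    · congr 1
      ring
    · ring
  · filter_upwards [eventually_ne_nhds hz] with w hw
    rw [Real.exp_neg, Real.exp_log (norm_pos_iff.mpr hw)]
    rfl

/-- The constant bounding the Laplacian of a squared distance. -/
noncomputable def distConst (b : ℝ) : ℝ := 2 + 2 / b + 4 / b ^ 2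

theorem four_le_distConst (hb0 : 0 < b) (hb1 : b ≤ 1) : 4 ≤ distConst b := by
  have h1 : 2 ≤ 2 / b := by rw [le_div_iff₀ hb0]; linarith
  have h2 : 0 < 4 / b ^ 2 := by positivity
  unfold distConst
  linarith

/-- The polar map stretches lengths by S = R' radially and by R/x ≥ S tangentially, so the squared
gradient of |ξ - p|² is at least 4S²|ξ - p|². The cross term Re(p̄ z)R/x has Laplacian of order
R|p|/x², which blows up relative to S² at the vertex; the condition |p| ≤ 2R makes it O(R²/x²) =
O(S²). -/
theorem planeJet_sqDist (hb0 : 0 < b) (hb1 : b ≤ 1) (hz : z ≠ 0) (p : ℂ) :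
    ∃ c τ, HasPlaneJet (fun w => ‖polarCoord b ε w - p‖ ^ 2) z c τ ∧
      4 * radialSpeed b ε ‖z‖ ^ 2 * ‖polarCoord b ε z - p‖ ^ 2 ≤ ‖c‖ ^ 2 ∧
      (‖p‖ ≤ 2 * polarRadius b ε ‖z‖ → |τ| ≤ distConst b * radialSpeed b ε ‖z‖ ^ 2) := by
  have hz' : 0 < ‖z‖ := norm_pos_iff.mpr hz
  have hR := polarRadius_pos (ε := ε) hb0 hb1 hz'
  have hAR := mul_radialSpeed_le (ε := ε) hb0 hb1 hz'
  have hRA := le_mul_radialSpeed (ε := ε) hb0 hb1 hz'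
  obtain ⟨hk0, hk1⟩ := radialRatio_mem (ε := ε) hb1 hz'
  have hs := radialSpeed_pos (ε := ε) hb0 hz'
  have j1 := planeJet_polarRadius (ε := ε) hb0 hb1 hz
  have j2 := planeJet_polarRadius_div (ε := ε) hb0 hb1 hz
  have j3 := ((j1.mul j1).add ((HasPlaneJet.const (-2) z).mul
    (j2.mul (HasPlaneJet.re_mul (star p) z)))).add (HasPlaneJet.const (‖p‖ ^ 2) z)
  have hexp : ∀ w : ℂ, w ≠ 0 → ‖polarCoord b ε w - p‖ ^ 2 =
      polarRadius b ε ‖w‖ * polarRadius b ε ‖w‖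
      + -2 * (polarRadius b ε ‖w‖ / ‖w‖ * (star p * w).re) + ‖p‖ ^ 2 := by
    intro w hw
    have hw' : 0 < ‖w‖ := norm_pos_iff.mpr hw
    have e1 : ‖polarCoord b ε w - p‖ ^ 2
        = (polarRadius b ε ‖w‖ / ‖w‖) ^ 2 * ‖w‖ ^ 2
          + -2 * (polarRadius b ε ‖w‖ / ‖w‖ * (star p * w).re) + ‖p‖ ^ 2 := by
      rw [← Complex.normSq_eq_norm_sq, ← Complex.normSq_eq_norm_sq, ← Complex.normSq_eq_norm_sq,
        Complex.normSq_apply, Complex.normSq_apply, Complex.normSq_apply]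
      simp only [polarCoord, Complex.sub_re, Complex.sub_im, Complex.mul_re, Complex.mul_im,
        Complex.ofReal_re, Complex.ofReal_im, RCLike.star_def, Complex.conj_re, Complex.conj_im]
      ring
    rw [e1]
    field_simp
  have hev : (fun w => ‖polarCoord b ε w - p‖ ^ 2) =ᶠ[𝓝 z] _ :=
    (eventually_ne_nhds hz).mono fun w hw => hexp w hw
  have j4 := j3.congr hev
  clear j3 hev
  set R := polarRadius b ε ‖z‖ with hRdef
  set S := radialSpeed b ε ‖z‖ with hSdef
  set k := radialRatio b ε ‖z‖ with hkdef
  set l := (star p * z).re with hl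
  set x := ‖z‖ with hx
  have hzinv : z⁻¹ = star z * ((x ^ 2)⁻¹ : ℝ) := by
    rw [Complex.inv_def, Complex.normSq_eq_norm_sq, RCLike.star_def]
  have hl2 : l ^ 2 ≤ x ^ 2 * ‖p‖ ^ 2 := by
    have h1 : |l| ≤ x * ‖p‖ := by
      have := Complex.abs_re_le_norm (star p * z)
      rwa [norm_mul, norm_star, mul_comm ‖p‖] at this
    rw [← mul_pow, ← sq_abs l]
    gcongr
  have j5 : HasPlaneJet (fun w => ‖polarCoord b ε w - p‖ ^ 2) z
      (((2 * R * S / x - 2 * (x * S - R) * l / x ^ 3 : ℝ) : ℂ) * star z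
        - ((2 * R / x : ℝ) : ℂ) * star p)
      (2 * S ^ 2 + 2 * R * k * S / x - 2 * (k * (x * S) - R) * l / x ^ 3) := by
    have hxc : (x : ℂ) ≠ 0 := by exact_mod_cast hz'.ne'
    convert j4 using 1
    · rw [hzinv]
      push_cast
      field_simp
      ring
    · have e1 : (((x * S : ℝ) : ℂ) * z⁻¹ * star (((x * S : ℝ) : ℂ) * z⁻¹)).re = S ^ 2 := by
        rw [RCLike.star_def, Complex.mul_conj', norm_mul, norm_inv, Complex.norm_real, ← hx,
          Real.norm_of_nonneg (by positivity)]
        norm_cast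
        field_simp
      have e2 : ((((x * S - R) / x : ℝ) : ℂ) * z⁻¹ * star (star p)).re
          = (x * S - R) / x * (l / x ^ 2) := by
        rw [mul_assoc, Complex.re_ofReal_mul, hzinv, mul_right_comm,
          mul_comm _ (((x ^ 2)⁻¹ : ℝ) : ℂ), Complex.re_ofReal_mul, hl]
        simp only [Complex.mul_re, RCLike.star_def, Complex.conj_re, Complex.conj_im]
        ring
      rw [e1, e2]
      simp only [zero_mul, Complex.zero_re]
      field_simp
      ring
  refine ⟨_, _, j5, ?_, ?_⟩
  · rw [hexp z hz]
    have e3 : ∀ α γ : ℝ, ‖(α : ℂ) * star z - (γ : ℂ) * star p‖ ^ 2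
        = α ^ 2 * x ^ 2 - 2 * α * γ * l + γ ^ 2 * ‖p‖ ^ 2 := by
      intro α γ
      rw [hx, hl, ← Complex.normSq_eq_norm_sq, ← Complex.normSq_eq_norm_sq,
        ← Complex.normSq_eq_norm_sq, Complex.normSq_apply, Complex.normSq_apply,
        Complex.normSq_apply]
      simp only [Complex.sub_re, Complex.sub_im, Complex.mul_re, Complex.mul_im,
        Complex.ofReal_re, Complex.ofReal_im, RCLike.star_def, Complex.conj_re, Complex.conj_im]
      ring
    rw [e3, ← hx, ← hl, ← hRdef]
    -- The defect in the gradient bound is a product of two factors, nonnegative by xS ≤ R and by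
    -- Cauchy–Schwarz for l = Re(p̄ z).
    have e4 : (2 * R * S / x - 2 * (x * S - R) * l / x ^ 3) ^ 2 * x ^ 2
        - 2 * (2 * R * S / x - 2 * (x * S - R) * l / x ^ 3) * (2 * R / x) * l
        + (2 * R / x) ^ 2 * ‖p‖ ^ 2 - 4 * S ^ 2 * (R * R + -2 * (R / x * l) + ‖p‖ ^ 2)
        = 4 / x ^ 4 * ((R ^ 2 - (x * S) ^ 2) * (x ^ 2 * ‖p‖ ^ 2 - l ^ 2)) := by
      field_simp
      ring
    have e5 : 0 ≤ 4 / x ^ 4 * ((R ^ 2 - (x * S) ^ 2) * (x ^ 2 * ‖p‖ ^ 2 - l ^ 2)) := by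
      have h1 : (x * S) ^ 2 ≤ R ^ 2 := by gcongr
      exact mul_nonneg (by positivity) (mul_nonneg (by linarith) (by linarith))
    linarith
  · intro hp
    have hSx : R / x ≤ S / b := by
      rw [div_le_div_iff₀ hz' hb0]
      linarith
    have h1 : 0 ≤ 2 * S ^ 2 + 2 * R * k * S / x := by
      have : 0 < k := hb0.trans_le hk0
      positivity
    have h2 : 2 * R * k * S / x ≤ 2 / b * S ^ 2 := by
      calc 2 * R * k * S / x = 2 * (R / x) * S * k := by ring
        _ ≤ 2 * (S / b) * S * 1 := by
          have : 0 ≤ k := hb0.le.trans hk0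
          gcongr
        _ = 2 / b * S ^ 2 := by ring
    have h3 : |2 * (k * (x * S) - R) * l / x ^ 3| ≤ 4 / b ^ 2 * S ^ 2 := by
      have h4 : |k * (x * S) - R| ≤ R := by
        have h5 : 0 ≤ k * (x * S) := mul_nonneg (hb0.le.trans hk0) (by positivity)
        have h6 : k * (x * S) ≤ 1 * R := mul_le_mul hk1 hAR (by positivity) zero_le_one
        rw [abs_le]
        constructor <;> linarith
      have h5 : |l| ≤ x * (2 * R) := by
        refine abs_le_of_sq_le_sq ?_ (by positivity)
        refine hl2.trans ?_
        rw [mul_pow]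
        gcongr
      rw [abs_div, abs_mul, abs_mul, abs_of_pos (by positivity : (0 : ℝ) < x ^ 3), abs_two]
      calc 2 * |k * (x * S) - R| * |l| / x ^ 3 ≤ 2 * R * (x * (2 * R)) / x ^ 3 := by gcongr
        _ = 4 * (R / x) ^ 2 := by field_simp; ring
        _ ≤ 4 * (S / b) ^ 2 := by gcongr
        _ = 4 / b ^ 2 * S ^ 2 := by ring
    have h4 := abs_le.mp h3
    unfold distConst
    rw [abs_le]
    have h5 : 0 ≤ 2 / b * S ^ 2 := by positivity
    constructor <;> nlinarith [sq_nonneg S]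

/-- The function s ↦ √(d² + s²) is convex, so the gradient contribution to the Laplacian can be
dropped. What remains is its slope times the Laplacian of R, bounded below by k ≥ b and R/x ≥ S. -/
theorem planeJet_sqrt (hb0 : 0 < b) (hb1 : b ≤ 1) (hz : z ≠ 0) {d : ℝ} (hd : 0 < d) :
    ∃ c τ, HasPlaneJet (fun w => Real.sqrt (d ^ 2 + polarRadius b ε ‖w‖ ^ 2)) z c τ ∧
      b * radialSpeed b ε ‖z‖ ^ 2 / Real.sqrt (d ^ 2 + polarRadius b ε ‖z‖ ^ 2) ≤ τ := by
  have hz' : 0 < ‖z‖ := norm_pos_iff.mpr hz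
  have hR := polarRadius_pos (ε := ε) hb0 hb1 hz'
  have hAR := mul_radialSpeed_le (ε := ε) hb0 hb1 hz'
  obtain ⟨hk0, hk1⟩ := radialRatio_mem (ε := ε) hb1 hz'
  have hs := radialSpeed_pos (ε := ε) hb0 hz'
  have j1 := planeJet_polarRadius (ε := ε) hb0 hb1 hz
  set R := polarRadius b ε ‖z‖ with hRdef
  have hpos : 0 < d ^ 2 + R ^ 2 := by positivity
  have j2 : Jet2 (fun s : ℝ => Real.sqrt (d ^ 2 + s * s)) R (R / Real.sqrt (d ^ 2 + R ^ 2))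
      (d ^ 2 / Real.sqrt (d ^ 2 + R ^ 2) ^ 3) := by
    have h1 : ∀ s : ℝ, HasDerivAt (fun s : ℝ => Real.sqrt (d ^ 2 + s * s))
        (s / Real.sqrt (d ^ 2 + s ^ 2)) s := fun s => by
      have h2 : 0 < d ^ 2 + s * s := by nlinarith [sq_nonneg s, pow_pos hd 2]
      have h3 : HasDerivAt (fun s : ℝ => d ^ 2 + s * s) (1 * s + s * 1) s :=
        ((hasDerivAt_id s).mul (hasDerivAt_id s)).const_add (d ^ 2)
      refine (h3.sqrt h2.ne').congr_deriv ?_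
      rw [pow_two s]
      ring
    refine ⟨fun s => s / Real.sqrt (d ^ 2 + s ^ 2), Eventually.of_forall h1, rfl, ?_⟩
    have h4 : 0 < Real.sqrt (d ^ 2 + R ^ 2) := Real.sqrt_pos.mpr hpos
    have h5 : HasDerivAt (fun s : ℝ => Real.sqrt (d ^ 2 + s ^ 2))
        (R / Real.sqrt (d ^ 2 + R ^ 2)) R := by simpa only [pow_two] using h1 R
    refine ((hasDerivAt_id R).div h5 h4.ne').congr_deriv ?_
    have h6 := Real.sq_sqrt hpos.le
    simp only [id]
    field_simp
    rw [h6]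
    ring
  have j3 := j1.comp j2
  simp only [← pow_two] at j3
  refine ⟨_, _, j3, ?_⟩
  have h4 : 0 < Real.sqrt (d ^ 2 + R ^ 2) := Real.sqrt_pos.mpr hpos
  set S := radialSpeed b ε ‖z‖
  set k := radialRatio b ε ‖z‖
  have h7 : b * S ^ 2 / Real.sqrt (d ^ 2 + R ^ 2)
      ≤ R / Real.sqrt (d ^ 2 + R ^ 2) * (k * (‖z‖ * S) / ‖z‖ ^ 2) := by
    have : R / Real.sqrt (d ^ 2 + R ^ 2) * (k * (‖z‖ * S) / ‖z‖ ^ 2)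
        = k * S * (R / ‖z‖) / Real.sqrt (d ^ 2 + R ^ 2) := by
      field_simp
    rw [this]
    have h8 : S ≤ R / ‖z‖ := by rw [le_div_iff₀ hz']; linarith
    have h9 : 0 ≤ k * S := mul_nonneg (hb0.le.trans hk0) hs.le
    gcongr ?_ / _
    calc b * S ^ 2 = b * S * S := by ring
      _ ≤ k * S * (R / ‖z‖) := by gcongr
  refine h7.trans (le_add_of_nonneg_left ?_)
  positivity

end PlaneJets

end ConicHeat

namespace ConicHeat

variable {n k : ℕ} {β : Fin n → ℝ} {ε K : ℝ}

/-! ### Estimates for the model metric -/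

/-- The diagonal entries of the model metric off the divisor. -/
noncomputable def modelCoeff (k : ℕ) (β : Fin n → ℝ) (ε : ℝ) (z : Cn n) (j : Fin n) : ℝ :=
  if j.val < k then radialSpeed (β j) ε ‖z j‖ ^ 2 else 1

theorem coord_ne_zero {z : Cn n} (hz : z ∉ divisor k) {j : Fin n} (hj : j.val < k) : z j ≠ 0 :=
  fun h => hz ⟨j, hj, h⟩

theorem modelCoeff_pos (hβ : ∀ j, 0 < β j ∧ β j ≤ 1) {z : Cn n} (hz : z ∉ divisor k) (j : Fin n) :
    0 < modelCoeff k β ε z j := by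
  unfold modelCoeff
  split_ifs with h
  · exact pow_pos (radialSpeed_pos (hβ j).1 (norm_pos_iff.mpr (coord_ne_zero hz h))) 2
  · exact one_pos

theorem modelMetric_eq {z : Cn n} (hz : z ∉ divisor k) :
    modelMetric k β ε z = Matrix.diagonal fun j => (modelCoeff k β ε z j : ℂ) := by
  unfold modelMetric modelCoeff
  congr 1
  ext j
  split_ifs with h
  · rw [radialSpeed_sq (norm_pos_iff.mpr (coord_ne_zero hz h))]
  · simp

theorem polarMap_apply_of_lt (z : Cn n) {j : Fin n} (hj : j.val < k) :
    polarMap k β ε z j = polarCoord (β j) ε (z j) := by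
  simp [polarMap, polarCoord, hj]

theorem polarMap_apply_of_not_lt (z : Cn n) {j : Fin n} (hj : ¬ j.val < k) :
    polarMap k β ε z j = z j := by
  simp [polarMap, hj]

theorem norm_polarMap_apply (hβ : ∀ j, 0 < β j ∧ β j ≤ 1) {z : Cn n} (hz : z ∉ divisor k)
    {j : Fin n} (hj : j.val < k) : ‖polarMap k β ε z j‖ = polarRadius (β j) ε ‖z j‖ := by
  rw [polarMap_apply_of_lt z hj, norm_polarCoord (hβ j).1 (hβ j).2 (coord_ne_zero hz hj)]

theorem continuousAt_polarMap (hβ : ∀ j, 0 < β j ∧ β j ≤ 1) {z : Cn n} (hz : z ∉ divisor k) :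
    ContinuousAt (polarMap k β ε) z := by
  refine (PiLp.continuous_toLp 2 _).continuousAt.comp (continuousAt_pi.mpr fun j => ?_)
  have hc : ContinuousAt (fun w : Cn n => w j) z := by fun_prop
  by_cases hj : j.val < k
  · simp only [hj, if_true]
    exact ContinuousAt.comp (f := fun w : Cn n => w j)
      (continuousAt_polarCoord (ε := ε) (hβ j).1 (hβ j).2 (coord_ne_zero hz hj)) hc
  · simpa only [hj, if_false] using hc

theorem isOpen_compl_divisor : IsOpen {z : Cn n | z ∉ divisor k} := by
  have : {z : Cn n | z ∉ divisor k} = ⋂ j : Fin n, {z : Cn n | j.val < k → z j ≠ 0} := by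
    ext z
    simp [divisor]
  rw [this]
  refine isOpen_iInter_of_finite fun j => ?_
  by_cases hj : j.val < k
  · simp only [hj, forall_true_left]
    exact isOpen_ne_fun (by fun_prop) continuous_const
  · simp [hj]

theorem isOpen_polarBall (hβ : ∀ j, 0 < β j ∧ β j ≤ 1) (y : Cn n) (r : ℝ) :
    IsOpen (polarBall k β ε y r) := by
  refine isOpen_iff_mem_nhds.mpr fun z hz => ?_
  filter_upwards [isOpen_compl_divisor.mem_nhds hz.1,
    (continuousAt_polarMap hβ hz.1).preimage_mem_nhds (Metric.isOpen_ball.mem_nhds hz.2)]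
    with w h1 h2 using ⟨h1, h2⟩

/-- A frame whose size is controlled by the diagonal metric `m`. -/
structure IsFrame (K : ℝ) (m : Fin n → ℝ) (B : Fin n → Cn n) : Prop where
  upper : ∀ j, ∑ a, ‖B a j‖ ^ 2 ≤ K / m j
  lower : ∀ c : Fin n → ℂ, K⁻¹ * ∑ j, ‖c j‖ ^ 2 / m j ≤ ∑ a, ‖∑ j, c j * B a j‖ ^ 2

theorem IsFrame.lower_coord {m : Fin n → ℝ} {B : Fin n → Cn n} (hB : IsFrame K m B) (j : Fin n) :
    K⁻¹ / m j ≤ ∑ a, ‖B a j‖ ^ 2 := by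
  have h := hB.lower (Pi.single j 1)
  have h1 : ∑ i, ‖(Pi.single j 1 : Fin n → ℂ) i‖ ^ 2 / m i = 1 / m j := by
    rw [Finset.sum_eq_single j (fun i _ hi => by simp [hi]) (by simp)]
    simp
  rw [h1] at h
  simpa [Pi.single_apply, div_eq_mul_inv] using h

theorem HasPlaneJet.lift {U : ℂ → ℝ} {z : Cn n} {j : Fin n} {c : ℂ} {τ : ℝ}
    (h : HasPlaneJet U (z j) c τ) :
    ∃ Q, HasJet (fun w => U (w j)) z (fun b => (c * b j).re) Q ∧
      ∀ B : Fin n → Cn n, frameLaplacian B Q = τ * ∑ a, ‖B a j‖ ^ 2 := by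
  obtain ⟨Q, h1, h2⟩ := h
  refine ⟨fun b => Q (b j), fun b => ?_, fun B => ?_⟩
  · simpa using h1 (b j)
  · rw [frameLaplacian, Finset.mul_sum]
    refine Finset.sum_congr rfl fun a _ => ?_
    rw [← h2]
    simp

/-- Treats conic and flat coordinates alike: for a flat one the metric coefficient is 1, the
gradient bound is an equality and the trace is 4. -/
theorem jet_sqDist_coord (hβ : ∀ j, 0 < β j ∧ β j ≤ 1) {z : Cn n} (hz : z ∉ divisor k)
    (p : ℂ) (j : Fin n) :
    ∃ c τ Q, HasJet (fun w => ‖polarMap k β ε w j - p‖ ^ 2) z (fun b => (c * b j).re) Q ∧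
      (∀ B : Fin n → Cn n, frameLaplacian B Q = τ * ∑ a, ‖B a j‖ ^ 2) ∧
      4 * modelCoeff k β ε z j * ‖polarMap k β ε z j - p‖ ^ 2 ≤ ‖c‖ ^ 2 ∧
      ((j.val < k → ‖p‖ ≤ 2 * ‖polarMap k β ε z j‖) →
        |τ| ≤ distConst (β j) * modelCoeff k β ε z j) := by
  by_cases hj : j.val < k
  · obtain ⟨c, τ, h1, h2, h3⟩ :=
      planeJet_sqDist (ε := ε) (hβ j).1 (hβ j).2 (coord_ne_zero hz hj) p
    obtain ⟨Q, h4, h5⟩ := h1.lift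
    refine ⟨c, τ, Q, ?_, h5, ?_, ?_⟩
    · simpa only [polarMap_apply_of_lt _ hj] using h4
    · simpa only [polarMap_apply_of_lt _ hj, modelCoeff, hj, if_true] using h2
    · intro hp
      have := h3 (by rw [← norm_polarMap_apply hβ hz hj]; exact hp hj)
      simpa only [modelCoeff, hj, if_true] using this
  · have h1 : HasPlaneJet (fun w : ℂ => ‖w - p‖ ^ 2) (z j) (2 * star (z j - p)) 4 := by
      obtain ⟨Q, h2, h3⟩ := HasPlaneJet.normSq (z j - p)
      refine ⟨Q, fun b => (h2 b).congr (Eventually.of_forall fun t => ?_), h3⟩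
      beta_reduce
      rw [sub_add_eq_add_sub]
    obtain ⟨Q, h4, h5⟩ := h1.lift
    refine ⟨2 * star (z j - p), 4, Q, ?_, h5, ?_, ?_⟩
    · simpa only [polarMap_apply_of_not_lt _ hj] using h4
    · rw [polarMap_apply_of_not_lt _ hj, norm_mul, norm_star]
      simp only [modelCoeff, hj, if_false, mul_pow]
      norm_num
    · intro _
      simp only [modelCoeff, hj, if_false, mul_one]
      rw [abs_of_pos (by norm_num)]
      exact four_le_distConst (hβ j).1 (hβ j).2

/-- Jets of a weighted squared distance in polar coordinates. -/
theorem jet_sqDist (hβ : ∀ j, 0 < β j ∧ β j ≤ 1) {C : ℝ} (hC : ∀ j, distConst (β j) ≤ C)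
    (hK : 0 < K) {z : Cn n} (hz : z ∉ divisor k) {p : Fin n → ℂ} {Λ : Fin n → ℝ} (hΛ : ∀ j, 0 ≤ Λ j)
    (hp : ∀ j : Fin n, j.val < k → ‖p j‖ ≤ 2 * ‖polarMap k β ε z j‖) :
    ∃ D Q, HasJet (fun w => ∑ j, Λ j * ‖polarMap k β ε w j - p j‖ ^ 2) z D Q ∧
      ∀ B, IsFrame K (modelCoeff k β ε z) B →
        |frameLaplacian B Q| ≤ C * K * ∑ j, Λ j ∧
        4 * K⁻¹ * ∑ j, Λ j ^ 2 * ‖polarMap k β ε z j - p j‖ ^ 2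
          ≤ frameLaplacian B fun b => D b ^ 2 := by
  choose c τ Q h1 h2 h3 h4 using fun j => jet_sqDist_coord (ε := ε) hβ hz (p j) j
  have hm := modelCoeff_pos (ε := ε) hβ hz
  refine ⟨_, _, HasJet.sum Finset.univ fun j _ => (h1 j).const_mul (Λ j), fun B hB => ⟨?_, ?_⟩⟩
  · rw [frameLaplacian_sum, Finset.mul_sum]
    refine (Finset.abs_sum_le_sum_abs _ _).trans (Finset.sum_le_sum fun j _ => ?_)
    rw [frameLaplacian_const_mul, h2, abs_mul, abs_mul, abs_of_nonneg (hΛ j),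
      abs_of_nonneg (Finset.sum_nonneg fun a _ => sq_nonneg ‖B a j‖), mul_comm (C * K)]
    refine mul_le_mul_of_nonneg_left ?_ (hΛ j)
    have h5 := (h4 j (hp j)).trans (mul_le_mul_of_nonneg_right (hC j) (hm j).le)
    calc |τ j| * ∑ a, ‖B a j‖ ^ 2 ≤ (C * modelCoeff k β ε z j) * (K / modelCoeff k β ε z j) :=
          mul_le_mul h5 (hB.upper j) (Finset.sum_nonneg fun a _ => sq_nonneg _)
            ((abs_nonneg _).trans h5)
      _ = C * K := by
          have := (hm j).ne'
          field_simp
  · have h5 : frameLaplacian B (fun b => (∑ j, Λ j * (c j * b j).re) ^ 2)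
        = ∑ a, ‖∑ j, (Λ j * c j) * B a j‖ ^ 2 := by
      refine Finset.sum_congr rfl fun a _ => ?_
      rw [← Complex.normSq_eq_norm_sq, Complex.normSq_apply]
      have e1 : ∑ j, Λ j * (c j * B a j).re = (∑ j, (Λ j * c j) * B a j).re := by
        rw [Complex.re_sum]
        exact Finset.sum_congr rfl fun j _ => by rw [mul_assoc, Complex.re_ofReal_mul]
      have e2 : ∑ j, Λ j * (c j * (Complex.I • B a) j).re = -(∑ j, (Λ j * c j) * B a j).im := by
        rw [Complex.im_sum, ← Finset.sum_neg_distrib]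
        refine Finset.sum_congr rfl fun j _ => ?_
        simp only [PiLp.smul_apply, smul_eq_mul, Complex.mul_re, Complex.mul_im, Complex.I_re,
          Complex.I_im, Complex.ofReal_re, Complex.ofReal_im]
        ring
      beta_reduce
      rw [e1, e2]
      ring
    rw [h5]
    refine le_trans ?_ (hB.lower _)
    rw [mul_comm 4, mul_assoc]
    refine mul_le_mul_of_nonneg_left ?_ (inv_pos.mpr hK).le
    rw [Finset.mul_sum]
    refine Finset.sum_le_sum fun j _ => ?_
    rw [le_div_iff₀ (hm j), norm_mul, Complex.norm_real, mul_pow, Real.norm_eq_abs, sq_abs]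
    nlinarith [mul_le_mul_of_nonneg_left (h3 j) (sq_nonneg (Λ j))]

/-- Jets of the regularized polar radii. -/
theorem jet_sqrt (hβ : ∀ j, 0 < β j ∧ β j ≤ 1) (hK : 0 < K) {z : Cn n} (hz : z ∉ divisor k)
    {d : ℝ} (hd : 0 < d) (S : Finset (Fin n)) (hS : ∀ j ∈ S, j.val < k) :
    ∃ D Q, HasJet (fun w => ∑ j ∈ S, Real.sqrt (d ^ 2 + ‖polarMap k β ε w j‖ ^ 2)) z D Q ∧
      ∀ B, IsFrame K (modelCoeff k β ε z) B → ∀ i ∈ S,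
        K⁻¹ * β i / Real.sqrt (d ^ 2 + ‖polarMap k β ε z i‖ ^ 2) ≤ frameLaplacian B Q := by
  have hm := modelCoeff_pos (ε := ε) hβ hz
  have key : ∀ j : Fin n, ∃ D Q, j ∈ S →
      HasJet (fun w => Real.sqrt (d ^ 2 + ‖polarMap k β ε w j‖ ^ 2)) z D Q ∧
      ∀ B, IsFrame K (modelCoeff k β ε z) B →
        K⁻¹ * β j / Real.sqrt (d ^ 2 + ‖polarMap k β ε z j‖ ^ 2) ≤ frameLaplacian B Q := by
    intro j
    by_cases hjS : j ∈ S
    · have hj := hS j hjS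
      obtain ⟨c, τ, h1, h2⟩ := planeJet_sqrt (ε := ε) (hβ j).1 (hβ j).2 (coord_ne_zero hz hj) hd
      obtain ⟨Q, h3, h4⟩ := h1.lift
      refine ⟨_, Q, fun _ => ⟨h3.congr ?_, fun B hB => ?_⟩⟩
      · filter_upwards [isOpen_compl_divisor.mem_nhds hz] with w hw
        rw [norm_polarMap_apply hβ hw hj]
      · rw [h4, norm_polarMap_apply hβ hz hj]
        have h5 := hB.lower_coord j
        have hr := radialSpeed_pos (ε := ε) (hβ j).1 (norm_pos_iff.mpr (coord_ne_zero hz hj))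
        have h6 := hm j
        simp only [modelCoeff, hj, if_true] at h5 h6
        have hβj := (hβ j).1
        have h7 : 0 ≤ K⁻¹ / radialSpeed (β j) ε ‖z j‖ ^ 2 := by positivity
        refine le_trans (le_of_eq ?_) (mul_le_mul h2 h5 h7 (le_trans (by positivity) h2))
        field_simp
    · exact ⟨fun _ => 0, fun _ => 0, fun h => absurd h hjS⟩
  choose D Q h using key
  refine ⟨_, _, HasJet.sum S fun j hj => (h j hj).1, fun B hB i hi => ?_⟩
  rw [frameLaplacian_sum]
  refine ((h i hi).2 B hB).trans
    (Finset.single_le_sum (f := fun j => frameLaplacian B (Q j)) (fun j hj => ?_) hi)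
  refine le_trans ?_ ((h j hj).2 B hB)
  have := (hβ j).1
  positivity

/-- Pluriharmonicity of log|z_j|: the Laplacian vanishes for every frame, which is what lets it
serve as a correction for an unknown metric. -/
theorem jet_sum_log {z : Cn n} (hz : z ∉ divisor k) (S : Finset (Fin n)) (hS : ∀ j ∈ S, j.val < k) :
    ∃ D Q, HasJet (fun w => ∑ j ∈ S, Real.log ‖w j‖) z D Q ∧ ∀ B, frameLaplacian B Q = 0 := by
  have key : ∀ j : Fin n, ∃ D Q, j ∈ S → HasJet (fun w => Real.log ‖w j‖) z D Q ∧
      ∀ B, frameLaplacian B Q = 0 := by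
    intro j
    by_cases hjS : j ∈ S
    · obtain ⟨Q, h1, h2⟩ := (HasPlaneJet.log_norm (coord_ne_zero hz (hS j hjS))).lift
      exact ⟨_, Q, fun _ => ⟨h1, fun B => by rw [h2, zero_mul]⟩⟩
    · exact ⟨fun _ => 0, fun _ => 0, fun h => absurd h hjS⟩
  choose D Q h using key
  refine ⟨_, _, HasJet.sum S fun j hj => (h j hj).1, fun B => ?_⟩
  rw [frameLaplacian_sum]
  exact Finset.sum_eq_zero fun j hj => (h j hj).2 B

end ConicHeat

namespace ConicHeat

variable {n k : ℕ} {β : Fin n → ℝ} {ε K : ℝ}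

/-! ### The comparison principle across the divisor -/

theorem exists_norm_coord_le (hβ : ∀ j, 0 < β j ∧ β j ≤ 1) (hε : 0 ≤ ε) (M : ℝ) :
    ∃ C : ℝ, 1 ≤ C ∧ ∀ z : Cn n, z ∉ divisor k → ‖polarMap k β ε z‖ ≤ M → ∀ j, ‖z j‖ ≤ C := by
  have h1 : ∀ j : Fin n, ∀ᶠ x in atTop, M < polarRadius (β j) ε x := fun j =>
    (tendsto_polarRadius (hβ j).1 (hβ j).2 hε).eventually_gt_atTop M
  obtain ⟨C, hC⟩ := eventually_atTop.mp (eventually_all.mpr h1)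
  refine ⟨max 1 (max C M), le_max_left _ _, fun z hz hM j => ?_⟩
  have h2 : ‖polarMap k β ε z j‖ ≤ M := (PiLp.norm_apply_le _ j).trans hM
  by_cases hj : j.val < k
  · by_contra hlt
    push Not at hlt
    rw [norm_polarMap_apply hβ hz hj] at h2
    exact absurd (hC ‖z j‖ (((le_max_left _ _).trans (le_max_right _ _)).trans hlt.le) j)
      (not_lt.mpr h2)
  · rw [polarMap_apply_of_not_lt z hj] at h2
    exact h2.trans ((le_max_right _ _).trans (le_max_right _ _))

/-- The points off the divisor whose polar coordinates lie in a space-time set `Z`. -/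
def polarRegion (k : ℕ) (β : Fin n → ℝ) (ε : ℝ) (Z : Set (Cn n × ℝ)) : Set (Cn n × ℝ) :=
  {p | p.1 ∉ divisor k ∧ (polarMap k β ε p.1, p.2) ∈ Z}

/-- The polar map is continuous at distance δ from the divisor, which gives closedness; boundedness
of z follows from that of ξ because the polar radius tends to infinity. -/
theorem isCompact_polarRegion_inter (hβ : ∀ j, 0 < β j ∧ β j ≤ 1) (hε : 0 ≤ ε)
    {Z : Set (Cn n × ℝ)} (hZ : IsCompact Z) {δ : ℝ} (hδ : 0 < δ) :
    IsCompact (polarRegion k β ε Z ∩ {p | ∀ j : Fin n, j.val < k → δ ≤ ‖p.1 j‖}) := by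
  set T : Set (Cn n × ℝ) := {p | ∀ j : Fin n, j.val < k → δ ≤ ‖p.1 j‖} with hT
  have hTD : ∀ p ∈ T, p.1 ∉ divisor k := by
    rintro p hp ⟨j, hj, h0⟩
    have := hp j hj
    rw [h0, norm_zero] at this
    linarith
  have hTc : IsClosed T := by
    have : T = ⋂ j : Fin n, {p : Cn n × ℝ | j.val < k → δ ≤ ‖p.1 j‖} := by
      ext p
      simp [hT]
    rw [this]
    refine isClosed_iInter fun j => ?_
    by_cases hj : j.val < k
    · simp only [hj, forall_true_left]
      exact isClosed_le continuous_const (by fun_prop)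
    · simp [hj]
  have hcont : ContinuousOn (fun p : Cn n × ℝ => (polarMap k β ε p.1, p.2)) T := fun p hp =>
    (((continuousAt_polarMap hβ (hTD p hp)).comp continuousAt_fst).prodMk
      continuousAt_snd).continuousWithinAt
  have hcl : IsClosed (polarRegion k β ε Z ∩ T) := by
    have := hcont.preimage_isClosed_of_isClosed hTc hZ.isClosed
    convert this using 1
    ext p
    exact ⟨fun h => ⟨h.2, h.1.2⟩, fun h => ⟨⟨hTD p h.1, h.2⟩, h.1⟩⟩
  refine Metric.isCompact_of_isClosed_isBounded hcl ?_
  obtain ⟨M, hM⟩ := hZ.isBounded.exists_norm_le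
  obtain ⟨C, -, hC⟩ := exists_norm_coord_le (n := n) (k := k) hβ hε M
  refine (Metric.isBounded_closedBall (x := (0 : Cn n × ℝ))
    (r := max (∑ _j : Fin n, C) M)).subset fun p hp => ?_
  rw [mem_closedBall_zero_iff]
  have h1 := hM _ hp.1.2
  refine max_le_max ?_ ((le_max_right _ _).trans h1)
  have h2 := hC p.1 hp.1.1 ((le_max_left _ _).trans h1)
  calc ‖p.1‖ = ‖∑ j, EuclideanSpace.single j (p.1 j)‖ := by
        congr 1
        ext i
        simp [Pi.single_apply]
    _ ≤ ∑ j, ‖p.1 j‖ := (norm_sum_le _ _).trans (Finset.sum_le_sum fun j _ => by simp)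
    _ ≤ ∑ _j : Fin n, C := Finset.sum_le_sum fun j _ => h2 j

/-- `v` is a classical supersolution on `Ω` of some heat equation whose metric is, at each point,
`K`-quasi-isometric to the model metric. -/
def IsSupersolution (k : ℕ) (β : Fin n → ℝ) (ε K : ℝ) (Ω : Set (Cn n × ℝ)) (v : Cn n × ℝ → ℝ) :
    Prop :=
  ∀ p ∈ Ω, ∃ B D Q v', IsFrame K (modelCoeff k β ε p.1) B ∧
    HasJet (fun z => v (z, p.2)) p.1 D Q ∧ HasDerivAt (fun θ => v (p.1, θ)) v' p.2 ∧
    frameLaplacian B Q ≤ v'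

/-- `φ` is strictly a subsolution at `p` for all metrics which are `K`-quasi-isometric to the
model metric. -/
def IsStrictSubAt (k : ℕ) (β : Fin n → ℝ) (ε K : ℝ) (φ : Cn n × ℝ → ℝ) (p : Cn n × ℝ) : Prop :=
  ∃ D Q φ', HasJet (fun z => φ (z, p.2)) p.1 D Q ∧ HasDerivAt (fun θ => φ (p.1, θ)) φ' p.2 ∧
    ∀ B, IsFrame K (modelCoeff k β ε p.1) B → φ' < frameLaplacian B Q

theorem deriv_nonpos_of_eventually_left {f : ℝ → ℝ} {d t : ℝ} (hf : HasDerivAt f d t)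
    (h : ∀ᶠ s in 𝓝[<] t, f t ≤ f s) : d ≤ 0 := by
  have h1 : Tendsto (slope f t) (𝓝[<] t) (𝓝 d) := by
    have := (hasDerivWithinAt_iff_tendsto_slope' (by simp)).mp (hf.hasDerivWithinAt (s := Iio t))
    exact this
  refine le_of_tendsto h1 ?_
  filter_upwards [h, self_mem_nhdsWithin] with s hs hst
  rw [slope_def_field]
  exact div_nonpos_of_nonneg_of_nonpos (by linarith) (sub_nonpos.mpr (le_of_lt hst))

/-- A strict subsolution cannot touch a supersolution from below, even after a multiple of the
pluriharmonic function `∑ log |z_j|` has been subtracted. -/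
theorem IsStrictSubAt.not_isMin {v φ : Cn n × ℝ → ℝ} {p : Cn n × ℝ} {W : Set (Cn n × ℝ)}
    (hφ : IsStrictSubAt k β ε K φ p) (hv : IsSupersolution k β ε K {p} v) (hp : p.1 ∉ divisor k)
    {S : Finset (Fin n)} (hS : ∀ j ∈ S, j.val < k) (c η : ℝ)
    (hsp : ∀ᶠ z in 𝓝 p.1, (z, p.2) ∈ W) (htm : ∀ᶠ t in 𝓝[<] p.2, (p.1, t) ∈ W)
    (hmin : ∀ q ∈ W, v p + -1 * φ p + η * (c + -1 * ∑ j ∈ S, Real.log ‖p.1 j‖)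
      ≤ v q + -1 * φ q + η * (c + -1 * ∑ j ∈ S, Real.log ‖q.1 j‖)) : False := by
  obtain ⟨Dφ, Qφ, φ', hj1, hd1, hlap⟩ := hφ
  obtain ⟨B, Dv, Qv, v', hB, hj2, hd2, hsup⟩ := hv p rfl
  obtain ⟨Dl, Ql, hj3, hl3⟩ := jet_sum_log hp S hS
  have hjw := (hj2.add (hj1.const_mul (-1))).add
    (((HasJet.const c p.1).add (hj3.const_mul (-1))).const_mul η)
  have hQ := hjw.nonneg_of_isLocalMin (hsp.mono fun z hz => hmin (z, p.2) hz)
  have h1 : 0 ≤ frameLaplacian B fun b => Qv b + -1 * Qφ b + η * (0 + -1 * Ql b) :=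
    Finset.sum_nonneg fun a _ => add_nonneg (hQ _) (hQ _)
  have h2 : frameLaplacian B (fun _ : Cn n => (0 : ℝ)) = 0 := by simp [frameLaplacian]
  rw [frameLaplacian_add, frameLaplacian_add, frameLaplacian_const_mul, frameLaplacian_const_mul,
    frameLaplacian_add, frameLaplacian_const_mul, hl3, h2] at h1
  have hdw := (hd2.add (hd1.const_mul (-1))).add_const
    (η * (c + -1 * ∑ j ∈ S, Real.log ‖p.1 j‖))
  -- The contradiction is the chain v' ≤ φ' < Δφ ≤ Δv ≤ v' for the frame B of the supersolution;
  -- this frame is unknown, so strictness of φ is required for all admissible frames.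
  have h3 := deriv_nonpos_of_eventually_left hdw (htm.mono fun t ht => hmin (p.1, t) ht)
  have h4 := hlap B hB
  linarith

/-- The minimum of v - φ + ηζ, with ζ = ∑ (log C - log|z_j|) ≥ 0, is attained off the divisor and
contradicts `IsStrictSubAt.not_isMin`. The parabolic boundary is encoded in `hcontact`: wherever v <
φ, the point must be interior in space and have a past inside the region. A left neighbourhood
suffices in time, so the final time slice is included. -/
theorem comparison (hβ : ∀ j, 0 < β j ∧ β j ≤ 1) (hε : 0 ≤ ε) {Ω Z : Set (Cn n × ℝ)}
    {v φ : Cn n × ℝ → ℝ} (hv : IsSupersolution k β ε K Ω v) (hvc : ContinuousOn v Ω)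
    (hv0 : ∀ p ∈ Ω, 0 ≤ v p) (hZ : IsCompact Z) (hZΩ : polarRegion k β ε Z ⊆ Ω)
    (hφc : ContinuousOn φ (polarRegion k β ε Z)) {M : ℝ} (hφM : ∀ p ∈ polarRegion k β ε Z, φ p ≤ M)
    (hcontact : ∀ p ∈ polarRegion k β ε Z, v p < φ p →
      (∀ᶠ z in 𝓝 p.1, (z, p.2) ∈ polarRegion k β ε Z) ∧
      (∀ᶠ t in 𝓝[<] p.2, (p.1, t) ∈ polarRegion k β ε Z) ∧ IsStrictSubAt k β ε K φ p) :
    ∀ p ∈ polarRegion k β ε Z, φ p ≤ v p := by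
  by_contra hcon
  push Not at hcon
  obtain ⟨p0, hp0, hlt⟩ := hcon
  set W := polarRegion k β ε Z with hW
  obtain ⟨M', hM'⟩ := hZ.isBounded.exists_norm_le
  obtain ⟨C, hC1, hC⟩ := exists_norm_coord_le (n := n) (k := k) hβ hε M'
  have hCW : ∀ p ∈ W, ∀ j, ‖p.1 j‖ ≤ C := fun p hp => by
    have h1 : ‖(polarMap k β ε p.1, p.2)‖ ≤ M' := hM' _ hp.2
    exact hC p.1 hp.1 ((norm_fst_le _).trans h1)
  set S : Finset (Fin n) := Finset.univ.filter fun j => j.val < k with hS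
  have hSk : ∀ j ∈ S, j.val < k := fun j hj => (Finset.mem_filter.mp hj).2
  have hpos : ∀ p ∈ W, ∀ j ∈ S, 0 < ‖p.1 j‖ := fun p hp j hj =>
    norm_pos_iff.mpr (coord_ne_zero hp.1 (hSk j hj))
  set c0 : ℝ := ∑ _j ∈ S, Real.log C with hc0
  set ζ : Cn n × ℝ → ℝ := fun p => c0 + -1 * ∑ j ∈ S, Real.log ‖p.1 j‖ with hζ
  have hζsum : ∀ p, ζ p = ∑ j ∈ S, (Real.log C - Real.log ‖p.1 j‖) := fun p => by
    rw [Finset.sum_sub_distrib, hζ]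
    ring
  have hterm : ∀ p ∈ W, ∀ j ∈ S, 0 ≤ Real.log C - Real.log ‖p.1 j‖ := fun p hp j hj =>
    sub_nonneg.mpr (Real.log_le_log (hpos p hp j hj) (hCW p hp j))
  have hζ0 : ∀ p ∈ W, 0 ≤ ζ p := fun p hp => by
    rw [hζsum]
    exact Finset.sum_nonneg (hterm p hp)
  -- Small enough that the correction ηζ leaves v - φ negative at p0.
  set η : ℝ := (φ p0 - v p0) / (ζ p0 + 1) with hη
  have hζp0 := hζ0 p0 hp0
  have hη0 : 0 < η := div_pos (by linarith) (by linarith)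
  have hηe : η * ζ p0 < φ p0 - v p0 := by
    have : η * (ζ p0 + 1) = φ p0 - v p0 := by
      rw [hη]
      field_simp
    nlinarith
  set w : Cn n × ℝ → ℝ := fun p => v p + -1 * φ p + η * ζ p with hw
  have hwp0 : w p0 < 0 := by
    simp only [hw]
    linarith
  -- Where w ≤ w(p0) < 0, the bounds v ≥ 0 and φ ≤ M give ζ < M/η, hence |z_j| ≥ C exp(-M/η).
  set δ : ℝ := C * Real.exp (-(M / η)) with hδ
  have hδ0 : 0 < δ := by positivity
  have hfar : ∀ p ∈ W, w p ≤ w p0 → ∀ j : Fin n, j.val < k → δ ≤ ‖p.1 j‖ := by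
    intro p hp hle j hj
    have hjS : j ∈ S := Finset.mem_filter.mpr ⟨Finset.mem_univ j, hj⟩
    have h1 : Real.log C - Real.log ‖p.1 j‖ ≤ ζ p := by
      rw [hζsum]
      exact Finset.single_le_sum (hterm p hp) hjS
    have h2 : η * ζ p < M := by
      have e1 := hv0 p (hZΩ hp)
      have e2 := hφM p hp
      simp only [hw] at hle hwp0
      linarith
    have h3 : ζ p < M / η := by
      rw [lt_div_iff₀ hη0]
      linarith
    have h4 : Real.log δ ≤ Real.log ‖p.1 j‖ := by
      rw [hδ, Real.log_mul (by linarith) (Real.exp_pos _).ne', Real.log_exp]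
      linarith
    exact (Real.log_le_log_iff hδ0 (hpos p hp j hjS)).mp h4
  have hcomp := isCompact_polarRegion_inter (k := k) hβ hε hZ hδ0
  have hwc : ContinuousOn w W := by
    have h0 : ContinuousOn (fun p : Cn n × ℝ => ∑ j ∈ S, Real.log ‖p.1 j‖) W := by
      refine continuousOn_finsetSum _ fun j hj => ContinuousOn.log ?_ fun p hp => ?_
      · fun_prop
      · exact (hpos p hp j hj).ne'
    have h1 : ContinuousOn ζ W := continuousOn_const.add (continuousOn_const.mul h0)
    exact ((hvc.mono hZΩ).add (continuousOn_const.mul hφc)).add (continuousOn_const.mul h1)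
  obtain ⟨p1, hp1, hmin⟩ := hcomp.exists_isMinOn ⟨p0, hp0, hfar p0 hp0 le_rfl⟩
    (hwc.mono inter_subset_left)
  have hp10 : w p1 ≤ w p0 := hmin ⟨hp0, hfar p0 hp0 le_rfl⟩
  have hmin' : ∀ p ∈ W, w p1 ≤ w p := by
    intro p hp
    by_contra hlt'
    push Not at hlt'
    exact absurd (hmin ⟨hp, hfar p hp (hlt'.le.trans hp10)⟩) (not_le.mpr hlt')
  have hp1W : p1 ∈ W := hp1.1
  have hcon1 : v p1 < φ p1 := by
    have h1 := hp10.trans_lt hwp0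
    have h2 := mul_nonneg hη0.le (hζ0 p1 hp1W)
    simp only [hw] at h1
    linarith
  obtain ⟨hsp, htm, hstrict⟩ := hcontact p1 hp1W hcon1
  have hv1 : IsSupersolution k β ε K {p1} v := fun q hq => hv q (hZΩ (by rwa [mem_singleton_iff.mp hq]))
  exact hstrict.not_isMin hv1 hp1W.1 hSk c0 η hsp htm hmin'

end ConicHeat

namespace ConicHeat

variable {n k : ℕ} {β : Fin n → ℝ} {ε K : ℝ}

/-! ### Weak subsolutions -/

theorem ParabolicHolderOn.continuousOn {F : Type*} [NormedAddCommGroup F] {α : ℝ} (hα : 0 < α)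
    {Ω : Set (Cn n × ℝ)} {f : Cn n × ℝ → F} (hf : ParabolicHolderOn α Ω f) :
    ContinuousOn f Ω := by
  intro p hp
  obtain ⟨N, hN, C, hC⟩ := hf p hp
  have h1 : Tendsto (fun q : Cn n × ℝ => C * (max ‖q.1 - p.1‖ (Real.sqrt |q.2 - p.2|)) ^ α)
      (𝓝[Ω] p) (𝓝 0) := by
    have h2 : ContinuousAt (fun q : Cn n × ℝ =>
        C * (max ‖q.1 - p.1‖ (Real.sqrt |q.2 - p.2|)) ^ α) p := by
      refine continuousAt_const.mul (ContinuousAt.rpow_const ?_ (Or.inr hα.le))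
      fun_prop
    have h3 := h2.tendsto
    simp only [sub_self, norm_zero, abs_zero, Real.sqrt_zero, max_self, Real.zero_rpow hα.ne',
      mul_zero] at h3
    exact h3.mono_left nhdsWithin_le_nhds
  rw [ContinuousWithinAt, tendsto_iff_norm_sub_tendsto_zero]
  refine squeeze_zero' (Eventually.of_forall fun _ => norm_nonneg _) ?_ h1
  filter_upwards [mem_nhdsWithin_of_mem_nhds hN, self_mem_nhdsWithin] with q hq hqΩ
  exact hC q ⟨hq, hqΩ⟩ p ⟨mem_of_mem_nhds hN, hp⟩

theorem IsWeakSubsolution.continuousOn {Ω : Set (Cn n × ℝ)}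
    {g : ℝ → Cn n → Matrix (Fin n) (Fin n) ℂ} {u : Cn n × ℝ → ℝ} (hu : IsWeakSubsolution Ω g u) :
    ContinuousOn u Ω := by
  obtain ⟨α, hα, h⟩ := hu.regular
  exact h.holder.continuousOn hα.1

theorem IsWeakSubsolution.isSupersolution (hβ : ∀ j, 0 < β j ∧ β j ≤ 1) (hK : 0 < K)
    {y : Cn n} {r : ℝ} {J : Set ℝ} {g : ℝ → Cn n → Matrix (Fin n) (Fin n) ℂ}
    (hg : IsConicFamily k β ε K (polarBall k β ε y r) J g) {u : Cn n × ℝ → ℝ}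
    (hu : IsWeakSubsolution (polarBall k β ε y r ×ˢ J) g u) (M : ℝ) :
    IsSupersolution k β ε K (polarBall k β ε y r ×ˢ J) fun p => M - u p := by
  rintro ⟨z, t⟩ hp
  obtain ⟨α, -, hreg⟩ := hu.regular
  have hzD : z ∉ divisor k := hp.1.1
  have hl := hg.lower t hp.2 z hp.1
  have hup := hg.upper t hp.2 z hp.1
  rw [modelMetric_eq hzD] at hl hup
  obtain ⟨B, hB1, hB2, hB3⟩ := exists_frame hK (modelCoeff_pos (ε := ε) hβ hzD)
    ((hg.kahler t hp.2).posDef z hp.1) hl hup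
  have hj : HasJet (fun w => u (w, t)) z _ _ := HasJet.of_fderiv (by
    filter_upwards [(isOpen_polarBall hβ y r).mem_nhds hp.1] with w hw
    exact hreg.diff_space (w, t) ⟨hw, hp.2⟩) (hreg.diff_space_two (z, t) hp)
  have hj2 := (HasJet.const M z).add (hj.const_mul (-1))
  have hd := (hreg.diff_time (z, t) hp).hasDerivAt.const_sub M
  have hineq := hu.inequality (z, t) hp
  refine ⟨B, _, _, _, ⟨hB2, hB3⟩, hj2.congr (Eventually.of_forall fun w => ?_), hd, ?_⟩
  · ring
  · have h1 : laplacian (g t) (fun w => u (w, t)) z = frameLaplacian B fun b =>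
        fderiv ℝ (fderiv ℝ fun w => u (w, t)) z b b := hB1 _
    have h2 : frameLaplacian B (fun _ : Cn n => (0 : ℝ)) = 0 := by simp [frameLaplacian]
    rw [frameLaplacian_add, frameLaplacian_const_mul, h2, ← h1]
    dsimp only at hineq
    linarith

/-! ### Propagation of positivity along a path which avoids the divisor -/

/-- The competition inside the bump, g being its profile: near the edge (g small) the gradient term
b(1 - g) wins, near the centre the decay term in g² does. The difference of the two sides is a sum
of squares. -/
theorem quadratic_pos {b c g : ℝ} (hb : 0 < b) :
    c * g < (b + c) ^ 2 / (2 * b) * g ^ 2 + b * (1 - g) := by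
  have h : (b + c) ^ 2 / (2 * b) * g ^ 2 + b * (1 - g) - c * g
      = (((b + c) * g - b) ^ 2 + b ^ 2) / (2 * b) := by
    field_simp
    ring
  have h2 : 0 < (((b + c) * g - b) ^ 2 + b ^ 2) / (2 * b) := by positivity
  linarith

theorem sum_sq_eq (ξ p : Cn n) : ∑ j, 1 * ‖ξ j - p j‖ ^ 2 = ‖ξ - p‖ ^ 2 := by
  rw [EuclideanSpace.norm_sq_eq]
  simp

theorem continuousAt_polarMap_prod (hβ : ∀ j, 0 < β j ∧ β j ≤ 1) {p : Cn n × ℝ}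
    (hp : p.1 ∉ divisor k) : ContinuousAt (fun q : Cn n × ℝ => polarMap k β ε q.1) p :=
  ContinuousAt.comp (f := Prod.fst) (continuousAt_polarMap hβ hp) continuousAt_fst

/-- The profile G = 1 - |ξ - c|²/w² is squared so that the gradient term (8/K)(1 - G) does not
vanish at the edge, whereas the errors from ΔE and from the motion of the centre carry a factor G.
The rate a is the one for which `quadratic_pos` applies. The distance 2w from the divisor gives
|c_j| ≤ 2|ξ_j| on the bump. -/
theorem isStrictSubAt_bump (hβ : ∀ j, 0 < β j ∧ β j ≤ 1) {C : ℝ} (hC : ∀ j, distConst (β j) ≤ C)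
    (hK : 0 < K) {c p' : ℝ → Cn n} (hc : ∀ t j, HasDerivAt (fun s => c s j) (p' t j) t)
    {m w V t0 : ℝ} (hm : 0 < m) (hw : 0 < w) {z : Cn n} {t : ℝ} (hz : z ∉ divisor k)
    (hV : ∀ j, ‖p' t j‖ ≤ V)
    (hfar : ∀ j : Fin n, j.val < k → 2 * w ≤ ‖c t j‖) (hlt : ‖polarMap k β ε z - c t‖ < w)
    {a : ℝ} (ha : a = (8 / K + 2 * (2 * n * w * V + C * K * n)) ^ 2 / (2 * (8 / K)) / w ^ 2) :
    IsStrictSubAt k β ε K (fun p => m * Real.exp (-a * (p.2 - t0))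
      * (1 - ‖polarMap k β ε p.1 - c p.2‖ ^ 2 / w ^ 2) ^ 2) (z, t) := by
  set ξ := polarMap k β ε z with hξ
  have hcoord : ∀ j, ‖ξ j - c t j‖ ≤ w := fun j =>
    (PiLp.norm_apply_le (ξ - c t) j).trans hlt.le
  have hp : ∀ j : Fin n, j.val < k → ‖c t j‖ ≤ 2 * ‖ξ j‖ := by
    intro j hj
    have h1 := hfar j hj
    have h2 := hcoord j
    have h3 := norm_sub_norm_le (c t j) (ξ j)
    rw [norm_sub_rev] at h3
    linarith
  obtain ⟨D, Q, hjet, hlap⟩ := jet_sqDist (ε := ε) hβ hC hK hz (Λ := fun _ => 1)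
    (fun _ => zero_le_one) hp
  set E := ‖ξ - c t‖ ^ 2 with hE
  set e := m * Real.exp (-a * (t - t0)) with he
  have he0 : 0 < e := by positivity
  have hEw : E < w ^ 2 := by
    rw [hE]
    gcongr
  set G := 1 - E / w ^ 2 with hG
  have hG0 : 0 < G := by
    have : E / w ^ 2 < 1 := by rwa [div_lt_one (by positivity)]
    linarith
  have hh : Jet2 (fun s => e * (1 - s / w ^ 2) ^ 2) (∑ j, 1 * ‖ξ j - c t j‖ ^ 2)
      (e * (2 * G * (-(1 / w ^ 2)))) (e * (2 / w ^ 4)) := by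
    have h1 : ∀ s : ℝ, HasDerivAt (fun s => 1 - s / w ^ 2) (-(1 / w ^ 2)) s := fun s =>
      ((hasDerivAt_id s).div_const (w ^ 2)).const_sub 1
    refine ⟨fun s => e * (2 * (1 - s / w ^ 2) * (-(1 / w ^ 2))), Eventually.of_forall fun s => ?_,
      ?_, ?_⟩
    · exact (((h1 s).pow 2).const_mul e).congr_deriv (by norm_num)
    · beta_reduce
      rw [sum_sq_eq, ← hE]
    · refine ((((h1 _).const_mul 2).mul_const (-(1 / w ^ 2))).const_mul e).congr_deriv ?_
      field_simp
  have hjet2 := hjet.comp hh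
  set E' : ℝ := ∑ j, 2 * inner ℝ (ξ j - c t j) (-(p' t j)) with hE'
  have hdE : HasDerivAt (fun θ => ‖ξ - c θ‖ ^ 2) E' t := by
    have h1 : HasDerivAt (fun θ => ∑ j, ‖ξ j - c θ j‖ ^ 2) E' t :=
      HasDerivAt.fun_sum fun j _ => ((hc t j).const_sub (ξ j)).norm_sq
    refine h1.congr_of_eventuallyEq (Eventually.of_forall fun θ => ?_)
    beta_reduce
    rw [← sum_sq_eq]
    simp
  have hE'b : |E'| ≤ 2 * n * w * V := by
    refine (Finset.abs_sum_le_sum_abs _ _).trans ?_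
    have h1 : ∀ j ∈ (Finset.univ : Finset (Fin n)),
        |2 * inner ℝ (ξ j - c t j) (-(p' t j))| ≤ 2 * (w * V) := by
      intro j _
      rw [abs_mul, abs_two]
      refine mul_le_mul_of_nonneg_left ?_ zero_le_two
      refine (abs_real_inner_le_norm _ _).trans ?_
      rw [norm_neg]
      exact mul_le_mul (hcoord j) (hV j) (norm_nonneg _) hw.le
    refine (Finset.sum_le_sum h1).trans (le_of_eq ?_)
    simp
    ring
  have hdt : HasDerivAt (fun θ => m * Real.exp (-a * (θ - t0)) * (1 - ‖ξ - c θ‖ ^ 2 / w ^ 2) ^ 2)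
      (e * (-a * G ^ 2 - 2 * G * (E' / w ^ 2))) t := by
    have h1 : HasDerivAt (fun θ : ℝ => -a * (θ - t0)) (-a) t := by
      simpa using ((hasDerivAt_id t).sub_const t0).const_mul (-a)
    have h2 := (h1.exp.const_mul m).mul (((hdE.div_const (w ^ 2)).const_sub 1).pow 2)
    refine h2.congr_deriv ?_
    rw [he]
    simp only [Pi.pow_apply, Nat.cast_ofNat, Nat.add_one_sub_one, pow_one]
    rw [← hE, ← hG]
    ring
  refine ⟨_, _, _, hjet2.congr (Eventually.of_forall fun w => ?_), hdt, fun B hB => ?_⟩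
  · beta_reduce
    rw [sum_sq_eq]
  · obtain ⟨hB1, hB2⟩ := hlap B hB
    have hsum : ∑ _j : Fin n, (1 : ℝ) = n := by simp
    simp only [one_pow] at hB2
    rw [sum_sq_eq, ← hE] at hB2
    rw [hsum] at hB1
    rw [frameLaplacian_add, frameLaplacian_const_mul, frameLaplacian_const_mul]
    have hB3 := (abs_le.mp hB1).2
    have hE4 := (abs_le.mp hE'b).1
    have hEG : E = w ^ 2 * (1 - G) := by
      rw [hG]
      field_simp
      ring
    have hq := quadratic_pos (b := 8 / K) (c := 2 * (2 * n * w * V + C * K * n)) (g := G)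
      (by positivity)
    have haw : a * w ^ 2 = (8 / K + 2 * (2 * n * w * V + C * K * n)) ^ 2 / (2 * (8 / K)) := by
      rw [ha]
      field_simp
    rw [← haw] at hq
    have h1 : e * (2 / w ^ 4) * (4 * K⁻¹ * E) + e * (2 * G * (-(1 / w ^ 2))) * (C * K * n)
        ≤ e * (2 / w ^ 4) * frameLaplacian B (fun b => D b ^ 2)
          + e * (2 * G * (-(1 / w ^ 2))) * frameLaplacian B Q := by
      refine add_le_add (mul_le_mul_of_nonneg_left hB2 (by positivity)) ?_
      refine mul_le_mul_of_nonpos_left hB3 ?_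
      have : 0 ≤ e * (2 * G * (1 / w ^ 2)) := by positivity
      linarith
    refine lt_of_lt_of_le ?_ h1
    have h2 : e * (2 / w ^ 4) * (4 * K⁻¹ * E) + e * (2 * G * (-(1 / w ^ 2))) * (C * K * n)
        - e * (-a * G ^ 2 - 2 * G * (E' / w ^ 2))
        = e / w ^ 2 * (a * w ^ 2 * G ^ 2 + 8 / K * (1 - G) - 2 * G * (C * K * n - E')) := by
      rw [hEG]
      field_simp
      ring
    have h3 : 0 < a * w ^ 2 * G ^ 2 + 8 / K * (1 - G) - 2 * G * (C * K * n - E') := by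
      nlinarith
    have h4 : 0 < e / w ^ 2 * (a * w ^ 2 * G ^ 2 + 8 / K * (1 - G) - 2 * G * (C * K * n - E')) := by
      positivity
    linarith

end ConicHeat

namespace ConicHeat

variable {n k : ℕ} {β : Fin n → ℝ} {ε K : ℝ}

/-- Compare v with the moving bump on the tube of radius w about the path. The bump vanishes on the
lateral boundary, is at most m initially, and at its final centre equals m times the accumulated
decay. -/
theorem propagation_along_path (hβ : ∀ j, 0 < β j ∧ β j ≤ 1) (hε : 0 ≤ ε) {C : ℝ}
    (hC : ∀ j, distConst (β j) ≤ C) (hK : 0 < K) {Ω : Set (Cn n × ℝ)} {v : Cn n × ℝ → ℝ}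
    (hv : IsSupersolution k β ε K Ω v) (hvc : ContinuousOn v Ω) (hv0 : ∀ p ∈ Ω, 0 ≤ v p)
    {c p' : ℝ → Cn n} (hc : ∀ t j, HasDerivAt (fun s => c s j) (p' t j) t)
    {m w V t0 t1 : ℝ} (hm : 0 < m) (hw : 0 < w) (ht : t0 ≤ t1)
    (hV : ∀ t ∈ Icc t0 t1, ∀ j, ‖p' t j‖ ≤ V)
    (hfar : ∀ t ∈ Icc t0 t1, ∀ j : Fin n, j.val < k → 2 * w ≤ ‖c t j‖)
    (hΩ : ∀ z ∉ divisor k, ∀ t ∈ Icc t0 t1, ‖polarMap k β ε z - c t‖ ≤ w → (z, t) ∈ Ω)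
    (hinit : ∀ z ∉ divisor k, ‖polarMap k β ε z - c t0‖ ≤ w → m ≤ v (z, t0))
    {z : Cn n} (hz : z ∉ divisor k) (hzc : polarMap k β ε z = c t1) :
    m * Real.exp (-((8 / K + 2 * (2 * n * w * V + C * K * n)) ^ 2 / (2 * (8 / K)) / w ^ 2)
      * (t1 - t0)) ≤ v (z, t1) := by
  set a : ℝ := (8 / K + 2 * (2 * n * w * V + C * K * n)) ^ 2 / (2 * (8 / K)) / w ^ 2 with ha
  have ha0 : 0 ≤ a := by positivity
  have hcc : Continuous c := by
    have h1 : Continuous fun t => (fun j => c t j : Fin n → ℂ) :=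
      continuous_pi fun j => continuous_iff_continuousAt.mpr fun t => (hc t j).continuousAt
    exact (PiLp.continuous_toLp 2 _).comp h1
  set Z : Set (Cn n × ℝ) := {q | q.2 ∈ Icc t0 t1 ∧ ‖q.1 - c q.2‖ ≤ w} with hZdef
  have hZ : IsCompact Z := by
    refine Metric.isCompact_of_isClosed_isBounded ?_ ?_
    · exact (isClosed_Icc.preimage continuous_snd).inter
        (isClosed_le ((continuous_fst.sub (hcc.comp continuous_snd)).norm) continuous_const)
    · obtain ⟨R, hR⟩ := (isCompact_Icc.image hcc).isBounded.exists_norm_le (s := c '' Icc t0 t1)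
      refine ((Metric.isBounded_closedBall (x := (0 : Cn n)) (r := w + R)).prod
        (Metric.isBounded_Icc t0 t1)).subset ?_
      rintro ⟨ξ, t⟩ ⟨h1, h2⟩
      refine ⟨?_, h1⟩
      rw [mem_closedBall_zero_iff]
      have h3 := hR (c t) (mem_image_of_mem c h1)
      calc ‖ξ‖ = ‖(ξ - c t) + c t‖ := by rw [sub_add_cancel]
        _ ≤ _ := (norm_add_le _ _).trans (add_le_add h2 h3)
  set φ : Cn n × ℝ → ℝ := fun p => m * Real.exp (-a * (p.2 - t0))
      * (1 - ‖polarMap k β ε p.1 - c p.2‖ ^ 2 / w ^ 2) ^ 2 with hφ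
  have hG : ∀ p ∈ polarRegion k β ε Z, 0 ≤ 1 - ‖polarMap k β ε p.1 - c p.2‖ ^ 2 / w ^ 2 ∧
      1 - ‖polarMap k β ε p.1 - c p.2‖ ^ 2 / w ^ 2 ≤ 1 := by
    intro p hp
    have h1 : ‖polarMap k β ε p.1 - c p.2‖ ≤ w := hp.2.2
    constructor
    · rw [sub_nonneg, div_le_one (by positivity)]
      gcongr
    · rw [sub_le_self_iff]
      positivity
  have hexp : ∀ p ∈ polarRegion k β ε Z, Real.exp (-a * (p.2 - t0)) ≤ 1 := by
    intro p hp
    rw [Real.exp_le_one_iff]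
    have h1 : t0 ≤ p.2 := hp.2.1.1
    nlinarith
  have hφm : ∀ p ∈ polarRegion k β ε Z, φ p ≤ m := by
    intro p hp
    obtain ⟨h1, h2⟩ := hG p hp
    have h3 := hexp p hp
    calc φ p ≤ m * 1 * 1 ^ 2 := by simp only [hφ]; gcongr
      _ = m := by ring
  have hφc : ContinuousOn φ (polarRegion k β ε Z) := fun p hp => by
    have h1 := continuousAt_polarMap_prod (ε := ε) hβ hp.1
    have h2 : ContinuousAt (fun q : Cn n × ℝ => c q.2) p := by fun_prop
    refine ContinuousAt.continuousWithinAt (ContinuousAt.mul (by fun_prop) ?_)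
    exact ((continuousAt_const.sub (((h1.sub h2).norm.pow 2).div_const _)).pow 2)
  have key := comparison hβ hε hv hvc hv0 hZ (φ := φ)
    (fun p hp => hΩ p.1 hp.1 p.2 hp.2.1 hp.2.2) hφc hφm ?_ (z, t1)
    ⟨hz, ⟨right_mem_Icc.mpr ht, by rw [hzc, sub_self, norm_zero]; exact hw.le⟩⟩
  · refine le_trans (le_of_eq ?_) key
    simp only [hφ]
    rw [hzc, sub_self, norm_zero]
    simp
  · rintro ⟨x, t⟩ hp hlt
    have hpw : ‖polarMap k β ε x - c t‖ ≤ w := hp.2.2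
    have hpt : t ∈ Icc t0 t1 := hp.2.1
    have hne : ‖polarMap k β ε x - c t‖ < w := by
      refine lt_of_le_of_ne hpw fun heq => ?_
      have h1 : φ (x, t) = 0 := by
        simp only [hφ]
        rw [heq, div_self (by positivity)]
        simp
      have h2 := hv0 _ (hΩ x hp.1 t hpt hpw)
      linarith
    have ht0 : t0 < t := by
      refine lt_of_le_of_ne hpt.1 fun heq => ?_
      subst heq
      exact absurd (hφm _ hp) (not_le.mpr ((hinit x hp.1 hpw).trans_lt hlt))
    refine ⟨?_, ?_, ?_⟩
    · have h1 : ContinuousAt (fun z => ‖polarMap k β ε z - c t‖) x :=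
        ((continuousAt_polarMap hβ hp.1).sub continuousAt_const).norm
      filter_upwards [isOpen_compl_divisor.mem_nhds hp.1, h1.eventually_lt_const hne]
        with z hz1 hz2
      exact ⟨hz1, hpt, hz2.le⟩
    · have h1 : ContinuousAt (fun s => ‖polarMap k β ε x - c s‖) t := by fun_prop
      filter_upwards [nhdsWithin_le_nhds (h1.eventually_lt_const hne),
        nhdsWithin_le_nhds (eventually_gt_nhds ht0), self_mem_nhdsWithin] with s hs1 hs2 hs3
      exact ⟨hp.1, ⟨hs2.le, (le_of_lt hs3).trans hpt.2⟩, hs1.le⟩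
    · exact isStrictSubAt_bump hβ hC hK hc hm hw hp.1 (hV t hpt) (hfar t hpt) hne ha

/-! ### Filling in a neighbourhood of the divisor -/

/-- At a point with |ξ_i| < d the root is at most 2d, so the i-th term alone contributes A b0/(2Kd)
to the Laplacian. This beats the time derivative μ plus the Laplacian of the squared distance; the
other roots are subharmonic. -/
theorem isStrictSubAt_filling (hβ : ∀ j, 0 < β j ∧ β j ≤ 1) {C b0 : ℝ}
    (hC : ∀ j, distConst (β j) ≤ C) (hb0 : ∀ j, b0 ≤ β j) (hK : 0 < K)
    {Λ : Fin n → ℝ} (hΛ : ∀ j, 0 ≤ Λ j)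
    {p : Fin n → ℂ} {S : Finset (Fin n)} (hS : ∀ j ∈ S, j.val < k) {c μ A d D0 t0 : ℝ}
    (hc : 0 < c) (hd : 0 < d) (hA : 0 ≤ A)
    (hμ : μ + C * K * ∑ j, Λ j < A * (K⁻¹ * b0 / (2 * d))) {z : Cn n} (hz : z ∉ divisor k)
    (hp : ∀ j : Fin n, j.val < k → ‖p j‖ ≤ 2 * ‖polarMap k β ε z j‖)
    (hnear : ∃ i ∈ S, ‖polarMap k β ε z i‖ < d) (t : ℝ) :
    IsStrictSubAt k β ε K (fun q => c * (μ * (q.2 - t0)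
      + A * ∑ j ∈ S, Real.sqrt (d ^ 2 + ‖polarMap k β ε q.1 j‖ ^ 2)
      + -1 * ∑ j, Λ j * ‖polarMap k β ε q.1 j - p j‖ ^ 2 + D0)) (z, t) := by
  obtain ⟨D, Q, hj1, hl1⟩ := jet_sqDist (ε := ε) hβ hC hK hz hΛ hp
  obtain ⟨D', Q', hj2, hl2⟩ := jet_sqrt (ε := ε) hβ hK hz hd S hS
  have hj := ((((HasJet.const (μ * (t - t0)) z).add (hj2.const_mul A)).add
    (hj1.const_mul (-1))).add (HasJet.const D0 z)).const_mul c
  have hdt : ∀ a b : ℝ, HasDerivAt (fun θ : ℝ => c * (μ * (θ - t0) + a + b + D0)) (c * μ) t := by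
    intro a b
    have h1 : HasDerivAt (fun θ : ℝ => μ * (θ - t0)) μ t := by
      simpa using ((hasDerivAt_id t).sub_const t0).const_mul μ
    exact (((h1.add_const a).add_const b).add_const D0).const_mul c
  refine ⟨_, _, _, hj, hdt (A * ∑ j ∈ S, Real.sqrt (d ^ 2 + ‖polarMap k β ε z j‖ ^ 2))
    (-1 * ∑ j, Λ j * ‖polarMap k β ε z j - p j‖ ^ 2), fun B hB => ?_⟩
  have h0 : frameLaplacian B (fun _ : Cn n => (0 : ℝ)) = 0 := by simp [frameLaplacian]
  rw [frameLaplacian_const_mul, frameLaplacian_add, frameLaplacian_add, frameLaplacian_add,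
    frameLaplacian_const_mul, frameLaplacian_const_mul, h0]
  refine mul_lt_mul_of_pos_left ?_ hc
  obtain ⟨i, hi, hid⟩ := hnear
  have h1 := (abs_le.mp (hl1 B hB).1).2
  have h2 := hl2 B hB i hi
  have h3 : Real.sqrt (d ^ 2 + ‖polarMap k β ε z i‖ ^ 2) ≤ 2 * d := by
    rw [Real.sqrt_le_left (by positivity)]
    nlinarith [norm_nonneg (polarMap k β ε z i)]
  have h4 : K⁻¹ * b0 / (2 * d)
      ≤ K⁻¹ * β i / Real.sqrt (d ^ 2 + ‖polarMap k β ε z i‖ ^ 2) := by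
    have := hb0 i
    have hβi := (hβ i).1
    have h5 : 0 < Real.sqrt (d ^ 2 + ‖polarMap k β ε z i‖ ^ 2) :=
      Real.sqrt_pos.mpr (by positivity)
    gcongr
  have h5 := mul_le_mul_of_nonneg_left (h4.trans h2) hA
  linarith

/-- Where all |ξ_j| ≥ d for j in S, v ≥ m is given and the barrier is at most m; elsewhere the
barrier is a strict subsolution. It is nonpositive at t0 and on F = H, F being the weighted squared
distance to p, and the slope μ raises it to at least m/2 at t1 where F ≤ H/4. -/
theorem filling (hβ : ∀ j, 0 < β j ∧ β j ≤ 1) (hε : 0 ≤ ε) {C b0 : ℝ}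
    (hC : ∀ j, distConst (β j) ≤ C) (hb0 : ∀ j, b0 ≤ β j) (hK : 0 < K)
    {Ω : Set (Cn n × ℝ)} {v : Cn n × ℝ → ℝ}
    (hv : IsSupersolution k β ε K Ω v) (hvc : ContinuousOn v Ω) (hv0 : ∀ p ∈ Ω, 0 ≤ v p)
    {Λ : Fin n → ℝ} (hΛ : ∀ j, 1 ≤ Λ j)
    {p : Fin n → ℂ} {S : Finset (Fin n)} (hS : ∀ j ∈ S, j.val < k) {m H μ A d t0 t1 : ℝ}
    (hm : 0 < m) (hH : 0 < H) (hd : 0 < d) (hA : 0 ≤ A) (ht : t0 ≤ t1) (hμt : μ * (t1 - t0) = H)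
    (hμ0 : 0 ≤ μ) (hμ : μ + C * K * ∑ j, Λ j < A * (K⁻¹ * b0 / (2 * d)))
    (hp : ∀ z : Cn n, z ∉ divisor k → ∑ j, Λ j * ‖polarMap k β ε z j - p j‖ ^ 2 ≤ H →
      (∀ j : Fin n, j.val < k → ‖p j‖ ≤ 2 * ‖polarMap k β ε z j‖) ∧
      A * ∑ j ∈ S, ‖polarMap k β ε z j‖ ≤ H / 4 ∧ (∀ t ∈ Icc t0 t1, (z, t) ∈ Ω) ∧
      ((∀ j ∈ S, d ≤ ‖polarMap k β ε z j‖) → ∀ t ∈ Icc t0 t1, m ≤ v (z, t)))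
    {z : Cn n} (hz : z ∉ divisor k) (hzp : ∑ j, Λ j * ‖polarMap k β ε z j - p j‖ ^ 2 ≤ H / 4) :
    m / 2 ≤ v (z, t1) := by
  have hΛ0 : ∀ j, 0 ≤ Λ j := fun j => zero_le_one.trans (hΛ j)
  set F : Cn n → ℝ := fun ξ => ∑ j, Λ j * ‖ξ j - p j‖ ^ 2 with hF
  have hFc : Continuous F := by
    rw [hF]
    fun_prop
  have hF0 : ∀ ξ, 0 ≤ F ξ := fun ξ => Finset.sum_nonneg fun j _ =>
    mul_nonneg (hΛ0 j) (sq_nonneg _)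
  set Z : Set (Cn n × ℝ) := {q | q.2 ∈ Icc t0 t1 ∧ F q.1 ≤ H} with hZdef
  have hZ : IsCompact Z := by
    refine Metric.isCompact_of_isClosed_isBounded ?_ ?_
    · exact (isClosed_Icc.preimage continuous_snd).inter
        (isClosed_le (hFc.comp continuous_fst) continuous_const)
    · set P : Cn n := WithLp.toLp 2 p with hP
      refine ((Metric.isBounded_closedBall (x := P) (r := Real.sqrt H)).prod
        (Metric.isBounded_Icc t0 t1)).subset ?_
      rintro ⟨ξ, t⟩ ⟨h1, h2⟩
      refine ⟨?_, h1⟩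
      rw [mem_closedBall_iff_norm]
      refine Real.le_sqrt_of_sq_le (le_trans ?_ h2)
      rw [← sum_sq_eq]
      exact Finset.sum_le_sum fun j _ => mul_le_mul_of_nonneg_right (hΛ j) (sq_nonneg _)
  set c : ℝ := m / H with hc
  have hc0 : 0 < c := div_pos hm hH
  -- The roots lie between |S|d and |S|d + ∑|ξ_j|, and A∑|ξ_j| ≤ H/4. This shift makes the roots and
  -- D0 together nonpositive and at least -H/4.
  set D0 : ℝ := -(A * (S.card * d)) - H / 4 with hD0
  set φ : Cn n × ℝ → ℝ := fun q => c * (μ * (q.2 - t0)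
      + A * ∑ j ∈ S, Real.sqrt (d ^ 2 + ‖polarMap k β ε q.1 j‖ ^ 2)
      + -1 * ∑ j, Λ j * ‖polarMap k β ε q.1 j - p j‖ ^ 2 + D0) with hφ
  have hsq1 : ∀ ξ : Cn n, ∑ j ∈ S, Real.sqrt (d ^ 2 + ‖ξ j‖ ^ 2) ≤ S.card * d + ∑ j ∈ S, ‖ξ j‖ := by
    intro ξ
    have h1 : ∀ j ∈ S, Real.sqrt (d ^ 2 + ‖ξ j‖ ^ 2) ≤ d + ‖ξ j‖ := fun j _ => by
      rw [Real.sqrt_le_left (by positivity)]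
      nlinarith [mul_nonneg hd.le (norm_nonneg (ξ j))]
    refine (Finset.sum_le_sum h1).trans (le_of_eq ?_)
    rw [Finset.sum_add_distrib]
    simp
  have hsq2 : ∀ ξ : Cn n, S.card * d ≤ ∑ j ∈ S, Real.sqrt (d ^ 2 + ‖ξ j‖ ^ 2) := by
    intro ξ
    have h1 : ∀ j ∈ S, d ≤ Real.sqrt (d ^ 2 + ‖ξ j‖ ^ 2) := fun j _ =>
      Real.le_sqrt_of_sq_le (by nlinarith [sq_nonneg ‖ξ j‖])
    refine le_trans (le_of_eq ?_) (Finset.sum_le_sum h1)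
    simp
  have hφle : ∀ q ∈ polarRegion k β ε Z,
      φ q ≤ c * (μ * (q.2 - t0) - F (polarMap k β ε q.1)) := by
    intro q hq
    have h1 := (hp q.1 hq.1 hq.2.2).2.1
    have h2 := mul_le_mul_of_nonneg_left (hsq1 (polarMap k β ε q.1)) hA
    simp only [hφ, hD0, hF]
    refine mul_le_mul_of_nonneg_left ?_ hc0.le
    linarith
  have hμle : ∀ t ∈ Icc t0 t1, μ * (t - t0) ≤ H := by
    intro t hts
    rw [← hμt]
    have := hts.2
    gcongr
  have hcH : c * H = m := by
    rw [hc]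
    field_simp
  have hφm : ∀ q ∈ polarRegion k β ε Z, φ q ≤ m := by
    intro q hq
    refine (hφle q hq).trans ?_
    rw [← hcH]
    have h1 := hF0 (polarMap k β ε q.1)
    have h2 := hμle q.2 hq.2.1
    gcongr
    linarith
  have hφc : ContinuousOn φ (polarRegion k β ε Z) := fun q hq => by
    have h1 := continuousAt_polarMap_prod (ε := ε) hβ hq.1
    have h2 : Continuous fun ξ : Cn n => A * ∑ j ∈ S, Real.sqrt (d ^ 2 + ‖ξ j‖ ^ 2) := by
      fun_prop
    have h3 : ContinuousAt (fun q : Cn n × ℝ => μ * (q.2 - t0)) q := by fun_prop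
    have h4 := ContinuousAt.comp (f := fun q : Cn n × ℝ => polarMap k β ε q.1)
      h2.continuousAt h1
    have h5 := ContinuousAt.comp (f := fun q : Cn n × ℝ => polarMap k β ε q.1)
      hFc.continuousAt h1
    exact (continuousAt_const.mul (((h3.add h4).add (continuousAt_const.mul h5)).add
      continuousAt_const)).continuousWithinAt
  have key := comparison hβ hε hv hvc hv0 hZ (φ := φ)
    (fun q hq => (hp q.1 hq.1 hq.2.2).2.2.1 q.2 hq.2.1) hφc hφm ?_ (z, t1)
    ⟨hz, ⟨right_mem_Icc.mpr ht, hzp.trans (by linarith)⟩⟩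
  · refine le_trans ?_ key
    have h1 := mul_le_mul_of_nonneg_left (hsq2 (polarMap k β ε z)) hA
    have h2 : c * (H / 2) ≤ φ (z, t1) := by
      simp only [hφ, hD0]
      refine mul_le_mul_of_nonneg_left ?_ hc0.le
      rw [hμt]
      linarith
    linarith
  · rintro ⟨x, t⟩ hq hlt
    have hFx : F (polarMap k β ε x) ≤ H := hq.2.2
    have hts : t ∈ Icc t0 t1 := hq.2.1
    obtain ⟨hp1, hp2, hp3, hp4⟩ := hp x hq.1 hFx
    have hpos : 0 < φ (x, t) := (hv0 _ (hp3 t hts)).trans_lt hlt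
    have hpos2 : 0 < μ * (t - t0) - F (polarMap k β ε x) :=
      pos_of_mul_pos_right (hpos.trans_le (hφle _ hq)) hc0.le
    have hFlt : F (polarMap k β ε x) < H := by linarith [hμle t hts]
    have ht0 : t0 < t := by
      refine lt_of_le_of_ne hts.1 fun heq => ?_
      rw [← heq, sub_self, mul_zero] at hpos2
      linarith [hF0 (polarMap k β ε x)]
    have hnear : ∃ i ∈ S, ‖polarMap k β ε x i‖ < d := by
      by_contra hcon
      push Not at hcon
      exact absurd (hφm _ hq) (not_le.mpr ((hp4 hcon t hts).trans_lt hlt))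
    refine ⟨?_, ?_, ?_⟩
    · have h1 : ContinuousAt (fun z => F (polarMap k β ε z)) x :=
        ContinuousAt.comp (f := polarMap k β ε) hFc.continuousAt (continuousAt_polarMap hβ hq.1)
      filter_upwards [isOpen_compl_divisor.mem_nhds hq.1, h1.eventually_lt_const hFlt]
        with z hz1 hz2
      exact ⟨hz1, hts, hz2.le⟩
    · filter_upwards [nhdsWithin_le_nhds (eventually_gt_nhds ht0), self_mem_nhdsWithin] with s hs2 hs3
      exact ⟨hq.1, ⟨hs2.le, (le_of_lt hs3).trans hts.2⟩, hFx⟩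
    · exact isStrictSubAt_filling hβ hC hb0 hK hΛ0 hS hc0 hd hA hμ hq.1 hp1 hnear t

end ConicHeat

namespace ConicHeat

variable {n k : ℕ} {β : Fin n → ℝ} {ε K : ℝ}

/-! ### Positivity away from the divisor -/

/-- A direction in which pushing the segment from a to b moves it away from 0: orthogonal to b - a
and not pointing towards the origin from a. -/
theorem exists_unit_normal (a b : ℂ) :
    ∃ e : ℂ, ‖e‖ = 1 ∧ (star e * (b - a)).re = 0 ∧ 0 ≤ (star e * a).re := by
  have h1 : ∃ e : ℂ, ‖e‖ = 1 ∧ (star e * (b - a)).re = 0 := by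
    by_cases h : b - a = 0
    · exact ⟨1, by simp, by simp [h]⟩
    · have hn : ‖b - a‖ ≠ 0 := norm_ne_zero_iff.mpr h
      refine ⟨Complex.I * ((b - a) * ((‖b - a‖⁻¹ : ℝ) : ℂ)), ?_, ?_⟩
      · rw [norm_mul, norm_mul, Complex.norm_I, Complex.norm_real, norm_inv, norm_norm]
        field_simp
      · simp only [star_mul', RCLike.star_def, Complex.conj_I, Complex.conj_ofReal, Complex.mul_re,
          Complex.mul_im, Complex.neg_re, Complex.neg_im, Complex.I_re, Complex.I_im,
          Complex.conj_re, Complex.conj_im, Complex.ofReal_re, Complex.ofReal_im]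
        ring
  obtain ⟨e, he1, he2⟩ := h1
  rcases le_total 0 (star e * a).re with h | h
  · exact ⟨e, he1, he2, h⟩
  · refine ⟨-e, by rwa [norm_neg], ?_, ?_⟩
    · rw [star_neg, neg_mul, Complex.neg_re, he2, neg_zero]
    · rw [star_neg, neg_mul, Complex.neg_re]
      linarith

/-- Near either end, the curve is within δ/2 of a point of modulus at least δ. In the middle its
component along e is at least x(1 - x)h. -/
theorem norm_detour_ge {a b e : ℂ} {δ h r x : ℝ} (hr : 0 < r) (hδ : 0 < δ) (hh : 0 < h) (hhr : h ≤ r) (ha : δ ≤ ‖a‖) (hb : δ ≤ ‖b‖) (hab : ‖b - a‖ ≤ 2 * r)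
    (he : ‖e‖ = 1) (he1 : (star e * (b - a)).re = 0) (he2 : 0 ≤ (star e * a).re)
    (hx0 : 0 ≤ x) (hx1 : x ≤ 1) :
    h * δ / (16 * r) ≤ ‖a + x * (b - a) + (x * (1 - x) * h : ℝ) * e‖ := by
  have hmin : h * δ / (16 * r) ≤ δ / 2 := by
    rw [div_le_div_iff₀ (by positivity) (by norm_num)]
    nlinarith
  by_cases h1 : x ≤ δ / (8 * r)
  · rw [le_div_iff₀ (by positivity)] at h1
    have e1 : ‖x * (b - a) + (x * (1 - x) * h : ℝ) * e‖ ≤ δ / 2 := by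
      refine (norm_add_le _ _).trans ?_
      rw [norm_mul, norm_mul, Complex.norm_real, Complex.norm_real, he,
        Real.norm_of_nonneg hx0, Real.norm_of_nonneg
          (mul_nonneg (mul_nonneg hx0 (sub_nonneg.mpr hx1)) hh.le)]
      have f1 : x * ‖b - a‖ ≤ x * (2 * r) := by gcongr
      have f2 : x * (1 - x) * h ≤ x * 1 * r := by
        gcongr
        · linarith
      linarith
    have e2 := norm_sub_norm_le a (-(x * (b - a) + (x * (1 - x) * h : ℝ) * e))
    rw [norm_neg, sub_neg_eq_add, ← add_assoc] at e2
    linarith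
  · by_cases h2 : 1 - x ≤ δ / (8 * r)
    · rw [le_div_iff₀ (by positivity)] at h2
      have hx2 : 0 ≤ 1 - x := sub_nonneg.mpr hx1
      have e0 : a + x * (b - a) + (x * (1 - x) * h : ℝ) * e
          = b + (-(((1 - x : ℝ) : ℂ) * (b - a)) + (x * (1 - x) * h : ℝ) * e) := by
        push_cast
        ring
      have e1 : ‖-(((1 - x : ℝ) : ℂ) * (b - a)) + (x * (1 - x) * h : ℝ) * e‖ ≤ δ / 2 := by
        refine (norm_add_le _ _).trans ?_
        rw [norm_neg, norm_mul, norm_mul, Complex.norm_real, Complex.norm_real, he,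
          Real.norm_of_nonneg hx2, Real.norm_of_nonneg (mul_nonneg (mul_nonneg hx0 hx2) hh.le)]
        have f1 : (1 - x) * ‖b - a‖ ≤ (1 - x) * (2 * r) := by gcongr
        have f2 : x * (1 - x) * h ≤ 1 * (1 - x) * r := by gcongr
        linarith
      have e2 := norm_sub_norm_le b (-(-(((1 - x : ℝ) : ℂ) * (b - a))
        + (x * (1 - x) * h : ℝ) * e))
      rw [norm_neg, sub_neg_eq_add] at e2
      rw [e0]
      linarith
    · push Not at h1 h2
      have e1 : (star e * (a + x * (b - a) + (x * (1 - x) * h : ℝ) * e)).re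
          = (star e * a).re + x * (1 - x) * h := by
        have f1 : star e * (a + x * (b - a) + (x * (1 - x) * h : ℝ) * e)
            = star e * a + x * (star e * (b - a)) + (x * (1 - x) * h : ℝ) * (star e * e) := by
          ring
        have f2 : star e * e = 1 := by
          rw [RCLike.star_def, Complex.conj_mul', he]
          simp
        rw [f1, f2, Complex.add_re, Complex.add_re, Complex.re_ofReal_mul, he1, mul_one,
          Complex.ofReal_re]
        ring
      have e2 : (star e * (a + x * (b - a) + (x * (1 - x) * h : ℝ) * e)).re
          ≤ ‖a + x * (b - a) + (x * (1 - x) * h : ℝ) * e‖ := by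
        refine (Complex.re_le_norm _).trans (le_of_eq ?_)
        rw [norm_mul, norm_star, he, one_mul]
      have e3 : δ / (16 * r) ≤ x * (1 - x) := by
        have f1 : δ / (8 * r) = 2 * (δ / (16 * r)) := by
          field_simp
          norm_num
        rw [f1] at h1 h2
        rcases le_total x (1 / 2) with hx | hx <;> nlinarith
      have e4 : h * δ / (16 * r) ≤ x * (1 - x) * h := by
        have := mul_le_mul_of_nonneg_right e3 hh.le
        calc h * δ / (16 * r) = δ / (16 * r) * h := by ring
          _ ≤ _ := this
      linarith

theorem norm_le_sum_coord (ξ : Cn n) : ‖ξ‖ ≤ ∑ j, ‖ξ j‖ := by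
  calc ‖ξ‖ = ‖∑ j, EuclideanSpace.single j (ξ j)‖ := by
        congr 1
        ext i
        simp [Pi.single_apply]
    _ ≤ ∑ j, ‖ξ j‖ := (norm_sum_le _ _).trans (Finset.sum_le_sum fun j _ => by simp)

/-- The segment from `a` to `b`, deformed in the directions `e j` so as to avoid the divisor. -/
noncomputable def detour (a b : Cn n) (e : Fin n → ℂ) (h x : ℝ) : Cn n :=
  WithLp.toLp 2 fun j => a j + x * (b j - a j) + (x * (1 - x) * h : ℝ) * e j

theorem norm_detour_sub_le {a b y : Cn n} {e : Fin n → ℂ} {h x ρ : ℝ} (hh : 0 ≤ h)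
    (he : ∀ j, ‖e j‖ = 1) (hx0 : 0 ≤ x) (hx1 : x ≤ 1) (ha : ‖a - y‖ ≤ ρ) (hb : ‖b - y‖ ≤ ρ) :
    ‖detour a b e h x - y‖ ≤ ρ + n * h := by
  have hx2 : 0 ≤ 1 - x := sub_nonneg.mpr hx1
  obtain ⟨E, hE⟩ : ∃ E : Cn n, E = WithLp.toLp 2 fun j => ((x * (1 - x) * h : ℝ) : ℂ) * e j :=
    ⟨_, rfl⟩
  have hEj : ∀ j, E j = ((x * (1 - x) * h : ℝ) : ℂ) * e j := fun j => by rw [hE]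
  have h1 : detour a b e h x - y = ((1 - x) • (a - y) + x • (b - y)) + E := by
    ext j
    simp only [detour, PiLp.sub_apply, PiLp.add_apply, PiLp.smul_apply, Complex.real_smul, hEj]
    push_cast
    ring
  have h2 : ‖E‖ ≤ n * h := by
    refine (norm_le_sum_coord E).trans ?_
    have h3 : ∀ j ∈ (Finset.univ : Finset (Fin n)), ‖E j‖ ≤ 1 * 1 * h := by
      intro j _
      rw [hEj, norm_mul, Complex.norm_real, he, mul_one, Real.norm_of_nonneg
        (mul_nonneg (mul_nonneg hx0 hx2) hh)]
      gcongr
      linarith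
    refine (Finset.sum_le_sum h3).trans (le_of_eq ?_)
    simp
  have h4 : ‖(1 - x) • (a - y) + x • (b - y)‖ ≤ (1 - x) * ρ + x * ρ := by
    refine (norm_add_le _ _).trans ?_
    rw [norm_smul, norm_smul, Real.norm_of_nonneg hx0, Real.norm_of_nonneg hx2]
    gcongr
  rw [h1]
  refine (norm_add_le _ _).trans ?_
  linarith

theorem hasDerivAt_detour (a b : Cn n) (e : Fin n → ℂ) (h : ℝ) {f : ℝ → ℝ} {f' θ : ℝ}
    (hf : HasDerivAt f f' θ) (j : Fin n) :
    HasDerivAt (fun s => detour a b e h (f s) j)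
      ((f' : ℂ) * (b j - a j) + (f' * (1 - 2 * f θ) * h : ℝ) * e j) θ := by
  have h2 : HasDerivAt (fun s : ℝ => f s * (1 - f s) * h) (f' * (1 - 2 * f θ) * h) θ :=
    ((hf.mul (hf.const_sub 1)).mul_const h).congr_deriv (by ring)
  exact ((hf.ofReal_comp.mul_const (b j - a j)).const_add (a j)).add
    (h2.ofReal_comp.mul_const (e j))

/-- Transport the bump from a to the target along the bent segment. The elapsed time is between
κ²r²/2 and r², which bounds the speed by a multiple of 1/r and the total decay independently of r.
-/
theorem positivity_away (hn : 0 < n) (hβ : ∀ j, 0 < β j ∧ β j ≤ 1) (hK : 0 < K) {κ d : ℝ}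
    (hκ : 0 < κ) (hκ1 : κ ≤ 1) (hd : 0 < d) {C : ℝ} (hC : ∀ j, distConst (β j) ≤ C) :
    ∃ w c : ℝ, 0 < w ∧ w ≤ κ / (8 * n) ∧ 0 < c ∧ c ≤ 1 ∧
      ∀ (k : ℕ) (ε : ℝ), 0 ≤ ε → ∀ (y : Cn n) (s r : ℝ), 0 < r → ∀ v : Cn n × ℝ → ℝ,
        IsSupersolution k β ε K (cylinder k β ε y s r) v →
        ContinuousOn v (cylinder k β ε y s r) → (∀ p ∈ cylinder k β ε y s r, 0 ≤ v p) →
        ∀ (a : Cn n) (m t0 : ℝ), ‖a - y‖ ≤ (1 - 3 / 4 * κ) * r →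
          (∀ j : Fin n, j.val < k → κ / (4 * n) * r ≤ ‖a j‖) → 0 < m → s - r ^ 2 < t0 →
          (∀ z ∉ divisor k, ‖polarMap k β ε z - a‖ ≤ w * r → m ≤ v (z, t0)) →
          ∀ z ∉ divisor k, ‖polarMap k β ε z - y‖ ≤ 3 / 4 * r →
            (∀ j : Fin n, j.val < k → d * r ≤ ‖polarMap k β ε z j‖) →
            ∀ t, t0 + κ ^ 2 / 2 * r ^ 2 ≤ t → t < s → c * m ≤ v (z, t) := by
  have hn1 : (1 : ℝ) ≤ n := by exact_mod_cast hn
  have hn0 : (0 : ℝ) < n := by linarith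
  set δ : ℝ := min (κ / (4 * n)) d with hδdef
  have hδ : 0 < δ := lt_min (by positivity) hd
  have hδ1 : δ ≤ 1 := by
    refine (min_le_left _ _).trans ?_
    rw [div_le_one (by positivity)]
    linarith
  -- Bending all coordinates moves the path by at most n h r = κr/8, which still leaves a margin
  -- κr/8 in the ball for the tube of radius at most κr/32.
  set h : ℝ := κ / (8 * n) with hhdef
  have hh : 0 < h := by positivity
  have hh1 : h ≤ 1 := by
    rw [hhdef, div_le_one (by positivity)]
    linarith
  -- `norm_detour_ge` keeps the path at distance hδr/16 from the divisor, which must be at least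
  -- 2wr.
  set w : ℝ := κ * h * δ / 32 with hwdef
  have hw : 0 < w := by positivity
  have hwκ : w ≤ κ / 32 := by
    rw [hwdef]
    have : κ * h * δ ≤ κ * 1 * 1 := by gcongr
    linarith
  have hwh : 2 * w ≤ h * δ / 16 := by
    rw [hwdef]
    have : κ * h * δ ≤ 1 * h * δ := by gcongr
    linarith
  set A : ℝ := (8 / K + 2 * (2 * n * w * (6 / κ ^ 2) + C * K * n)) ^ 2 / (2 * (8 / K)) with hA
  have hA0 : 0 ≤ A := by positivity
  have hwn : w ≤ κ / (8 * n) := by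
    rw [hwdef]
    have h1 : κ * h * δ ≤ κ * h * 1 := by gcongr
    have h2 : κ * h ≤ 1 * h := by gcongr
    linarith
  refine ⟨w, Real.exp (-(A / w ^ 2)), hw, hwn, Real.exp_pos _,
    Real.exp_le_one_iff.mpr (by have : 0 ≤ A / w ^ 2 := by positivity
                                linarith), ?_⟩
  intro k ε hε y s r hr v hv hvc hv0 a m t0 ha haj hm ht0 hinit z hz hzy hzj t ht hts
  set b := polarMap k β ε z with hb
  have hT : 0 < t - t0 := by
    have : 0 < κ ^ 2 / 2 * r ^ 2 := by positivity
    linarith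
  have hay : ‖a - y‖ ≤ (1 - κ / 4) * r := ha.trans (mul_le_mul_of_nonneg_right (by linarith) hr.le)
  have hby : ‖b - y‖ ≤ (1 - κ / 4) * r := hzy.trans (mul_le_mul_of_nonneg_right (by linarith) hr.le)
  have hκr : 0 < κ * r := mul_pos hκ hr
  have hba : ∀ j, ‖b j - a j‖ ≤ 2 * r := by
    intro j
    have h1 : ‖b j - a j‖ ≤ ‖b - a‖ := PiLp.norm_apply_le (b - a) j
    have h2 : ‖b - a‖ ≤ ‖b - y‖ + ‖a - y‖ := by
      have := norm_sub_le (b - y) (a - y)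
      rwa [sub_sub_sub_cancel_right] at this
    linarith
  choose e he1 he2 he3 using fun j => exists_unit_normal (a j) (b j)
  obtain ⟨c, hc⟩ : ∃ c : ℝ → Cn n, c = fun θ => detour a b e (h * r) ((θ - t0) / (t - t0)) :=
    ⟨_, rfl⟩
  obtain ⟨c', hc'⟩ : ∃ c' : ℝ → Cn n, ∀ θ j, c' θ j = ((1 / (t - t0) : ℝ) : ℂ) * (b j - a j)
      + (1 / (t - t0) * (1 - 2 * ((θ - t0) / (t - t0))) * (h * r) : ℝ) * e j :=
    ⟨fun θ => WithLp.toLp 2 fun j => _, fun θ j => rfl⟩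
  have hx : ∀ θ ∈ Icc t0 t, 0 ≤ (θ - t0) / (t - t0) ∧ (θ - t0) / (t - t0) ≤ 1 := by
    intro θ hθ
    refine ⟨div_nonneg (sub_nonneg.mpr hθ.1) hT.le, ?_⟩
    rw [div_le_one hT]
    linarith [hθ.2]
  have hcd : ∀ θ j, HasDerivAt (fun s => c s j) (c' θ j) θ := by
    intro θ j
    have h1 : HasDerivAt (fun θ : ℝ => (θ - t0) / (t - t0)) (1 / (t - t0)) θ :=
      ((hasDerivAt_id θ).sub_const t0).div_const _
    rw [hc, hc']
    exact hasDerivAt_detour a b e (h * r) h1 j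
  have hV : ∀ θ ∈ Icc t0 t, ∀ j, ‖c' θ j‖ ≤ 6 / (κ ^ 2 * r) := by
    intro θ hθ j
    obtain ⟨hx0, hx1⟩ := hx θ hθ
    have h1 : ‖c' θ j‖ ≤ 1 / (t - t0) * (2 * r) + 1 / (t - t0) * 1 * (1 * r) := by
      rw [hc']
      refine (norm_add_le _ _).trans (add_le_add ?_ ?_)
      · rw [norm_mul, Complex.norm_real, Real.norm_of_nonneg (by positivity)]
        gcongr
        exact hba j
      · rw [norm_mul, Complex.norm_real, he1, mul_one, norm_mul, norm_mul,
          Real.norm_of_nonneg (by positivity : 0 ≤ 1 / (t - t0)),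
          Real.norm_of_nonneg (by positivity : 0 ≤ h * r)]
        gcongr
        rw [Real.norm_eq_abs, abs_le]
        constructor <;> linarith
    have h2 : 1 / (t - t0) ≤ 1 / (κ ^ 2 / 2 * r ^ 2) := by
      gcongr
      linarith
    calc ‖c' θ j‖ ≤ 1 / (t - t0) * (3 * r) := by linarith
      _ ≤ 1 / (κ ^ 2 / 2 * r ^ 2) * (3 * r) := by gcongr
      _ = 6 / (κ ^ 2 * r) := by
        field_simp
        norm_num
  have hfar : ∀ θ ∈ Icc t0 t, ∀ j : Fin n, j.val < k → 2 * (w * r) ≤ ‖c θ j‖ := by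
    intro θ hθ j hj
    obtain ⟨hx0, hx1⟩ := hx θ hθ
    have h1 := norm_detour_ge (δ := δ * r) (h := h * r) hr (by positivity) (by positivity)
      (mul_le_of_le_one_left hr.le hh1) (le_trans (by gcongr; exact min_le_left _ _) (haj j hj))
      (le_trans (by gcongr; exact min_le_right _ _) (hzj j hj)) (hba j) (he1 j) (he2 j) (he3 j)
      hx0 hx1
    rw [hc]
    refine le_trans ?_ h1
    have h2 : h * r * (δ * r) / (16 * r) = h * δ / 16 * r := by
      field_simp
    rw [h2, ← mul_assoc]
    exact mul_le_mul_of_nonneg_right hwh hr.le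
  have hball : ∀ θ ∈ Icc t0 t, ‖c θ - y‖ ≤ (1 - κ / 8) * r := by
    intro θ hθ
    obtain ⟨hx0, hx1⟩ := hx θ hθ
    rw [hc]
    refine (norm_detour_sub_le (by positivity) he1 hx0 hx1 hay hby).trans (le_of_eq ?_)
    rw [hhdef]
    field_simp
    ring
  have hc0 : c t0 = a := by
    rw [hc]
    ext j
    simp [detour]
  have hc1 : c t = b := by
    rw [hc]
    ext j
    simp [detour, div_self hT.ne']
  have hmain := propagation_along_path (t0 := t0) (t1 := t) (w := w * r) hβ hε hC hK hv hvc hv0 hcd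
    hm (by positivity) (by linarith) hV hfar ?_ (by rwa [hc0]) hz (by rw [hc1])
  · refine le_trans ?_ hmain
    rw [mul_comm]
    have e1 : 2 * n * (w * r) * (6 / (κ ^ 2 * r)) = 2 * n * w * (6 / κ ^ 2) := by
      field_simp
    rw [e1, ← hA]
    refine mul_le_mul_of_nonneg_left (Real.exp_le_exp.mpr ?_) hm.le
    have e2 : A / (w * r) ^ 2 * (t - t0) ≤ A / (w * r) ^ 2 * r ^ 2 := by
      gcongr
      linarith
    have e3 : A / (w * r) ^ 2 * r ^ 2 = A / w ^ 2 := by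
      field_simp
    linarith
  · intro x hx θ hθ hle
    refine ⟨⟨hx, ?_⟩, ?_, ?_⟩
    · rw [mem_ball_iff_norm]
      have h1 := norm_add_le (polarMap k β ε x - c θ) (c θ - y)
      rw [sub_add_sub_cancel] at h1
      have h2 := hball θ hθ
      have h3 : w * r ≤ κ / 32 * r := by gcongr
      linarith
    · exact ht0.trans_le hθ.1
    · exact hθ.2.trans_lt hts

end ConicHeat

namespace ConicHeat

variable {n k : ℕ} {β : Fin n → ℝ} {ε K : ℝ}

/-! ### Positivity up to the divisor -/

/-- Apply `filling` around the target q, with S the conic coordinates in which q is close to the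
divisor and centre p obtained from q by setting those to 0. Where the S-coordinates are at least dr,
the hypothesis v ≥ m of `filling` comes from `positivity_away`. -/
theorem positivity_up_to_divisor (hn : 0 < n) (hβ : ∀ j, 0 < β j ∧ β j ≤ 1) (hK : 0 < K) {κ : ℝ}
    (hκ : 0 < κ) (hκ1 : κ ≤ 1) {C b0 : ℝ} (hC : ∀ j, distConst (β j) ≤ C) (hC0 : 0 ≤ C)
    (hb0 : ∀ j, b0 ≤ β j) (hb00 : 0 < b0) :
    ∃ w c : ℝ, 0 < w ∧ w ≤ κ / (8 * n) ∧ 0 < c ∧ c ≤ 1 ∧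
      ∀ (k : ℕ) (ε : ℝ), 0 ≤ ε → ∀ (y : Cn n) (s r : ℝ), 0 < r → ∀ v : Cn n × ℝ → ℝ,
        IsSupersolution k β ε K (cylinder k β ε y s r) v →
        ContinuousOn v (cylinder k β ε y s r) → (∀ p ∈ cylinder k β ε y s r, 0 ≤ v p) →
        ∀ (a : Cn n) (m t0 : ℝ), ‖a - y‖ ≤ (1 - 3 / 4 * κ) * r →
          (∀ j : Fin n, j.val < k → κ / (4 * n) * r ≤ ‖a j‖) → 0 < m → s - r ^ 2 < t0 →
          (∀ z ∉ divisor k, ‖polarMap k β ε z - a‖ ≤ w * r → m ≤ v (z, t0)) →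
          ∀ z ∉ divisor k, ‖polarMap k β ε z - y‖ ≤ r / 2 →
            ∀ t, t0 + 3 / 4 * κ ^ 2 * r ^ 2 ≤ t → t < s → c / 2 * m ≤ v (z, t) := by
  have hn1 : (1 : ℝ) ≤ n := by exact_mod_cast hn
  have hn0 : (0 : ℝ) < n := by linarith
  -- Two scales: coordinates below η'r count as small, while the barrier region lets them grow to
  -- ηr. The gap puts q in F ≤ H/4 with H = (ηr)², and η = 1/(8n) keeps the region within r/4 of q.
  obtain ⟨η, hη⟩ : ∃ η : ℝ, η = 1 / (8 * n) := ⟨_, rfl⟩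
  obtain ⟨η', hη'⟩ : ∃ η' : ℝ, η' = η / (2 * n) := ⟨_, rfl⟩
  have hη0 : 0 < η := by rw [hη]; positivity
  have hη'0 : 0 < η' := by rw [hη']; positivity
  have hη'η : η' ≤ η := by
    rw [hη', div_le_iff₀ (by positivity)]
    nlinarith
  -- The slope that climbs H = (ηr)² in the time κ²r²/4.
  obtain ⟨μ, hμ⟩ : ∃ μ : ℝ, μ = 4 * η ^ 2 / κ ^ 2 := ⟨_, rfl⟩
  have hμ0 : 0 < μ := by rw [hμ]; positivity
  obtain ⟨T, hT⟩ : ∃ T : ℝ, T = μ + C * K * (16 * n ^ 3) + 1 := ⟨_, rfl⟩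
  have hT0 : 0 < T := by rw [hT]; positivity
  -- The second entry lets the roots dominate `T`; the first keeps the conic coordinates outside S,
  -- which stay at least η'r/2, above dr.
  obtain ⟨d, hd⟩ : ∃ d : ℝ, d = min (η' / 2) (η / (4 * n) * (K⁻¹ * b0) / (2 * T)) := ⟨_, rfl⟩
  have hd0 : 0 < d := by rw [hd]; exact lt_min (by positivity) (by positivity)
  have hdη : d ≤ η' / 2 := by rw [hd]; exact min_le_left _ _
  have hdT : T ≤ η / (4 * n) * (K⁻¹ * b0 / (2 * d)) := by
    have h1 : d ≤ η / (4 * n) * (K⁻¹ * b0) / (2 * T) := by rw [hd]; exact min_le_right _ _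
    rw [le_div_iff₀ (by positivity)] at h1
    have h2 : η / (4 * n) * (K⁻¹ * b0 / (2 * d)) = η / (4 * n) * (K⁻¹ * b0) / (2 * d) := by ring
    rw [h2, le_div_iff₀ (by positivity)]
    linarith
  obtain ⟨w, c, hw0, hwκ, hc0, hc1, hmain⟩ := positivity_away hn hβ hK hκ hκ1 hd0 hC
  refine ⟨w, c, hw0, hwκ, hc0, hc1, ?_⟩
  intro k ε hε y s r hr v hv hvc hv0 a m t0 ha haj hm ht0 hinit z hz hzy t ht hts
  have haway := hmain k ε hε y s r hr v hv hvc hv0 a m t0 ha haj hm ht0 hinit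
  obtain ⟨q, hq⟩ : ∃ q, q = polarMap k β ε z := ⟨_, rfl⟩
  rw [← hq] at hzy
  classical
  obtain ⟨S, hS⟩ : ∃ S : Finset (Fin n),
      ∀ j, j ∈ S ↔ j.val < k ∧ ‖q j‖ < η' * r :=
    ⟨Finset.univ.filter fun j => j.val < k ∧ ‖q j‖ < η' * r, fun j => by simp⟩
  obtain ⟨p, hp⟩ : ∃ p : Fin n → ℂ, ∀ j, p j = if j ∈ S then 0 else q j := ⟨_, fun _ => rfl⟩
  -- The weight (4n)² confines the coordinates outside S to within ηr/(4n) = η'r/2 of those of q,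
  -- while the small ones may range up to ηr.
  obtain ⟨Λ, hΛ⟩ : ∃ Λ : Fin n → ℝ, ∀ j, Λ j = if j ∈ S then 1 else 16 * (n : ℝ) ^ 2 :=
    ⟨_, fun _ => rfl⟩
  have h16 : (1 : ℝ) ≤ 16 * (n : ℝ) ^ 2 := by nlinarith
  have hΛ1 : ∀ j, 1 ≤ Λ j := by
    intro j
    rw [hΛ]
    split_ifs
    · exact le_rfl
    · exact h16
  have hΛsum : ∑ j, Λ j ≤ 16 * n ^ 3 := by
    have h1 : ∀ j ∈ (Finset.univ : Finset (Fin n)), Λ j ≤ 16 * (n : ℝ) ^ 2 := by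
      intro j _
      rw [hΛ]
      split_ifs
      · exact h16
      · exact le_rfl
    refine (Finset.sum_le_sum h1).trans (le_of_eq ?_)
    simp
    ring
  have hηr : 0 < η * r := mul_pos hη0 hr
  have hη'r : 0 < η' * r := mul_pos hη'0 hr
  have hη'n : η * r / (4 * n) = η' * r / 2 := by
    rw [hη']
    field_simp
    norm_num
  have hcoord : ∀ ξ : Cn n, ∑ j, Λ j * ‖ξ j - p j‖ ^ 2 ≤ (η * r) ^ 2 →
      (∀ j ∈ S, ‖ξ j‖ ≤ η * r) ∧ ∀ j, j ∉ S → ‖ξ j - q j‖ ≤ η' * r / 2 := by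
    intro ξ hξ
    have h1 : ∀ j, Λ j * ‖ξ j - p j‖ ^ 2 ≤ (η * r) ^ 2 := fun j =>
      (Finset.single_le_sum (f := fun j => Λ j * ‖ξ j - p j‖ ^ 2)
        (fun i _ => mul_nonneg (zero_le_one.trans (hΛ1 i)) (sq_nonneg _))
        (Finset.mem_univ j)).trans hξ
    constructor
    · intro j hj
      have h2 := h1 j
      rw [hΛ, hp, if_pos hj, if_pos hj, one_mul, sub_zero] at h2
      exact le_of_sq_le_sq h2 hηr.le
    · intro j hj
      have h2 := h1 j
      rw [hΛ, hp, if_neg hj, if_neg hj] at h2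
      rw [← hη'n, le_div_iff₀ (by positivity)]
      refine le_of_sq_le_sq (le_trans (le_of_eq ?_) h2) hηr.le
      ring
  -- The filling uses the last κ²r²/4 of the available 3κ²r²/4, leaving κ²r²/2 for
  -- `positivity_away`. The factor A is chosen so that A n ηr = H/4.
  have hfill := filling (Ω := cylinder k β ε y s r) (v := v) (Λ := Λ) (p := p) (S := S)
    (m := c * m) (H := (η * r) ^ 2) (μ := μ) (A := η / (4 * n) * r) (d := d * r)
    (t0 := t - κ ^ 2 / 4 * r ^ 2) (t1 := t) hβ hε hC hb0 hK hv hvc hv0 hΛ1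
    (fun j hj => ((hS j).mp hj).1) (by positivity) (by positivity) (by positivity)
    (by positivity) (by linarith [show 0 ≤ κ ^ 2 / 4 * r ^ 2 by positivity]) ?_ hμ0.le ?_ ?_ hz ?_
  · linarith
  · rw [hμ]
    field_simp
    ring
  · have h1 : C * K * ∑ j, Λ j ≤ C * K * (16 * n ^ 3) := by gcongr
    have h2 : η / (4 * n) * r * (K⁻¹ * b0 / (2 * (d * r)))
        = η / (4 * n) * (K⁻¹ * b0 / (2 * d)) := by
      field_simp
    rw [h2]
    linarith
  · intro x hx hxH
    obtain ⟨hx1, hx2⟩ := hcoord _ hxH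
    have hbig : ∀ j : Fin n, j.val < k → j ∉ S → η' * r ≤ ‖q j‖ := by
      intro j hj hjS
      by_contra hlt
      exact hjS ((hS j).mpr ⟨hj, not_le.mp hlt⟩)
    have hxb : ∀ j : Fin n, j ∉ S → ‖q j‖ - η' * r / 2 ≤ ‖polarMap k β ε x j‖ := by
      intro j hjS
      have h1 := hx2 j hjS
      have h2 := norm_sub_norm_le (q j) (polarMap k β ε x j)
      rw [norm_sub_rev] at h2
      linarith
    have hxq : ‖polarMap k β ε x - q‖ ≤ r / 4 := by
      refine (norm_le_sum_coord _).trans ?_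
      have h1 : ∀ j ∈ (Finset.univ : Finset (Fin n)), ‖(polarMap k β ε x - q) j‖ ≤ 2 * (η * r) := by
        intro j _
        rw [PiLp.sub_apply]
        have h3 : η' * r ≤ η * r := by gcongr
        by_cases hjS : j ∈ S
        · have h2 := ((hS j).mp hjS).2
          have h4 := hx1 j hjS
          have h5 := norm_sub_le (polarMap k β ε x j) (q j)
          linarith
        · have h2 := hx2 j hjS
          linarith
      refine (Finset.sum_le_sum h1).trans (le_of_eq ?_)
      simp [hη]
      field_simp
      norm_num
    have hxy : ‖polarMap k β ε x - y‖ ≤ 3 / 4 * r := by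
      have h1 := norm_add_le (polarMap k β ε x - q) (q - y)
      rw [sub_add_sub_cancel] at h1
      linarith
    refine ⟨?_, ?_, ?_, ?_⟩
    · intro j hj
      rw [hp]
      split_ifs with hjS
      · rw [norm_zero]
        positivity
      · have h1 := hbig j hj hjS
        have h2 := hxb j hjS
        linarith
    · have h1 : ∑ j ∈ S, ‖polarMap k β ε x j‖ ≤ n * (η * r) := by
        refine (Finset.sum_le_sum hx1).trans ?_
        rw [Finset.sum_const, nsmul_eq_mul]
        have h2 : (S.card : ℝ) ≤ n := by
          have := S.card_le_univ
          rw [Fintype.card_fin] at this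
          exact_mod_cast this
        gcongr
      calc η / (4 * n) * r * ∑ j ∈ S, ‖polarMap k β ε x j‖
          ≤ η / (4 * n) * r * (n * (η * r)) := by gcongr
        _ = (η * r) ^ 2 / 4 := by field_simp
    · intro θ hθ
      refine ⟨⟨hx, ?_⟩, ?_, hθ.2.trans_lt hts⟩
      · rw [mem_ball_iff_norm]
        linarith
      · have h1 := hθ.1
        have h2 : 0 < κ ^ 2 * r ^ 2 := by positivity
        linarith
    · intro hSd θ hθ
      refine haway x hx hxy (fun j hj => ?_) θ ?_ (hθ.2.trans_lt hts)
      · by_cases hjS : j ∈ S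
        · exact hSd j hjS
        · have h1 := hbig j hj hjS
          have h2 := hxb j hjS
          have h3 : d * r ≤ η' / 2 * r := by gcongr
          linarith
      · have h1 := hθ.1
        linarith
  · rw [← hq]
    have h1 : ∀ j ∈ (Finset.univ : Finset (Fin n)), Λ j * ‖q j - p j‖ ^ 2 ≤ (η' * r) ^ 2 := by
      intro j _
      rw [hΛ, hp]
      split_ifs with hjS
      · have h2 := ((hS j).mp hjS).2
        rw [one_mul, sub_zero]
        gcongr
      · rw [sub_self, norm_zero]
        simp only [ne_eq, OfNat.ofNat_ne_zero, not_false_eq_true, zero_pow, mul_zero]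
        positivity
    refine (Finset.sum_le_sum h1).trans ?_
    rw [Finset.sum_const, nsmul_eq_mul, Finset.card_univ, Fintype.card_fin, hη']
    have h2 : (n : ℝ) * (η / (2 * n) * r) ^ 2 = (η * r) ^ 2 / 4 * (1 / n) := by
      field_simp
      norm_num
    rw [h2]
    refine mul_le_of_le_one_right (by positivity) ?_
    rw [div_le_one hn0]
    exact hn1

/-! ### The polar balls are nonempty -/

/-- Combining bR ≤ xR' with R' ≤ x^(b-1)R'(1) bounds R by a multiple of x^b on (0, 1). -/
theorem tendsto_polarRadius_zero {b : ℝ} (hb0 : 0 < b) (hb1 : b ≤ 1) :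
    Tendsto (polarRadius b ε) (𝓝[>] 0) (𝓝 0) := by
  have h1 : Tendsto (fun x : ℝ => x ^ b * (radialSpeed b ε 1 / b)) (𝓝[>] 0) (𝓝 0) := by
    have h2 := (Real.continuousAt_rpow_const 0 b (Or.inr hb0.le)).tendsto.mono_left
      (nhdsWithin_le_nhds (s := Ioi 0))
    rw [Real.zero_rpow hb0.ne'] at h2
    simpa using h2.mul_const (radialSpeed b ε 1 / b)
  refine squeeze_zero' ?_ ?_ h1
  · filter_upwards [self_mem_nhdsWithin] with x hx
    exact (polarRadius_pos hb0 hb1 hx).le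
  · filter_upwards [Ioo_mem_nhdsGT zero_lt_one] with x hx
    have h3 := le_mul_radialSpeed (ε := ε) hb0 hb1 hx.1
    have h4 := radialSpeed_le (ε := ε) hb0 hb1 hx.1 hx.2.le
    rw [Real.one_rpow, one_mul] at h4
    have h5 : x * (x ^ (b - 1) * radialSpeed b ε 1) = x ^ b * radialSpeed b ε 1 := by
      rw [← mul_assoc, Real.rpow_sub_one hx.1.ne', mul_div_cancel₀ _ hx.1.ne']
    rw [mul_div_assoc', le_div_iff₀ hb0, mul_comm, ← h5]
    exact h3.trans (mul_le_mul_of_nonneg_left h4 hx.1.le)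

/-- The radius takes every positive value by the intermediate value theorem, and the polar map
preserves arguments. -/
theorem exists_polarMap_eq (hβ : ∀ j, 0 < β j ∧ β j ≤ 1) (hε : 0 ≤ ε) (ξ : Cn n)
    (hξ : ∀ j : Fin n, j.val < k → ξ j ≠ 0) : ∃ z ∉ divisor k, polarMap k β ε z = ξ := by
  have h1 : ∀ j : Fin n, ∃ w : ℂ, (j.val < k → w ≠ 0) ∧
      (if j.val < k then polarCoord (β j) ε w else w) = ξ j := by
    intro j
    by_cases hj : j.val < k
    · have hξj : 0 < ‖ξ j‖ := norm_pos_iff.mpr (hξ j hj)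
      obtain ⟨x2, hx2, hx20⟩ := (((tendsto_polarRadius (hβ j).1 (hβ j).2 hε).eventually_ge_atTop
        ‖ξ j‖).and (eventually_gt_atTop 0)).exists
      obtain ⟨x1, hx1, hx10⟩ := (((tendsto_polarRadius_zero (ε := ε) (hβ j).1 (hβ j).2).eventually_le_const
        hξj).and self_mem_nhdsWithin).exists
      obtain ⟨x, hx, hxξ⟩ := (isPreconnected_Ioi (a := (0 : ℝ))).intermediate_value hx10 hx20
        (continuousOn_polarRadius (ε := ε) (hβ j).1 (hβ j).2) ⟨hx1, hx2⟩
      have hx0 : 0 < x := hx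
      refine ⟨((x / ‖ξ j‖ : ℝ) : ℂ) * ξ j, fun _ => mul_ne_zero ?_ (hξ j hj), ?_⟩
      · exact_mod_cast (div_pos hx0 hξj).ne'
      · rw [if_pos hj, polarCoord, norm_mul, Complex.norm_real,
          Real.norm_of_nonneg (div_pos hx0 hξj).le, div_mul_cancel₀ _ hξj.ne', hxξ, ← mul_assoc,
          ← Complex.ofReal_mul]
        have : ‖ξ j‖ / x * (x / ‖ξ j‖) = 1 := by field_simp
        rw [this, Complex.ofReal_one, one_mul]
    · exact ⟨ξ j, fun h => absurd h hj, if_neg hj⟩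
  choose z hz1 hz2 using h1
  refine ⟨WithLp.toLp 2 z, ?_, ?_⟩
  · rintro ⟨j, hj, h0⟩
    exact hz1 j hj h0
  · ext j
    exact hz2 j

/-- A point near `y`, all of whose first `k` coordinates are at least `d` in modulus. -/
theorem exists_far_point (y : Cn n) {d : ℝ} (hd : 0 < d) :
    ∃ a : Cn n, ‖a - y‖ ≤ n * d ∧ ∀ j, d ≤ ‖a j‖ := by
  have h1 : ∀ j : Fin n, ∃ w : ℂ, ‖w - y j‖ ≤ d ∧ d ≤ ‖w‖ := by
    intro j
    by_cases h0 : y j = 0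
    · refine ⟨d, ?_, ?_⟩ <;> simp [h0, abs_of_pos hd]
    · have hy : 0 < ‖y j‖ := norm_pos_iff.mpr h0
      refine ⟨((1 + d / ‖y j‖ : ℝ) : ℂ) * y j, ?_, ?_⟩
      · have : ((1 + d / ‖y j‖ : ℝ) : ℂ) * y j - y j = ((d / ‖y j‖ : ℝ) : ℂ) * y j := by
          push_cast
          ring
        rw [this, norm_mul, Complex.norm_real, Real.norm_of_nonneg (by positivity),
          div_mul_cancel₀ _ hy.ne']
      · rw [norm_mul, Complex.norm_real, Real.norm_of_nonneg (by positivity), add_mul,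
          div_mul_cancel₀ _ hy.ne']
        linarith
  choose a h2 h3 using h1
  refine ⟨WithLp.toLp 2 a, ?_, h3⟩
  refine (norm_le_sum_coord _).trans ((Finset.sum_le_sum fun j _ => h2 j).trans (le_of_eq ?_))
  simp

theorem polarBall_nonempty (hn : 0 < n) (hβ : ∀ j, 0 < β j ∧ β j ≤ 1) (hε : 0 ≤ ε) (y : Cn n)
    {r : ℝ} (hr : 0 < r) : (polarBall k β ε y r).Nonempty := by
  have hn0 : (0 : ℝ) < n := by exact_mod_cast hn
  obtain ⟨a, ha, haj⟩ := exists_far_point y (d := r / (2 * n)) (by positivity)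
  obtain ⟨z, hz, hza⟩ := exists_polarMap_eq (k := k) hβ hε a fun j _ h0 => by
    have := haj j
    rw [h0, norm_zero] at this
    exact absurd this (not_le.mpr (by positivity))
  refine ⟨z, hz, ?_⟩
  rw [hza, mem_ball_iff_norm]
  refine ha.trans_lt ?_
  have : n * (r / (2 * n)) = r / 2 := by field_simp
  linarith

end ConicHeat

namespace ConicHeat

variable {n k : ℕ} {β : Fin n → ℝ} {ε K : ℝ}

/-! ### The initial time -/

/-- Move from z straight away from y by nearly ρ. If z = y any unit vector serves, and one exists
because n > 0. -/
theorem norm_sub_add_le_of_ball_subset (hn : 0 < n) {z y : Cn n} {ρ r : ℝ} (hρ : 0 < ρ)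
    (h : Metric.ball z ρ ⊆ Metric.ball y r) : ‖z - y‖ + ρ ≤ r := by
  obtain ⟨e, he, hze⟩ : ∃ e : Cn n, ‖e‖ = 1 ∧ z - y = ‖z - y‖ • e := by
    by_cases h0 : z - y = 0
    · exact ⟨EuclideanSpace.single ⟨0, hn⟩ 1, by simp, by simp [h0]⟩
    · have h1 : ‖z - y‖ ≠ 0 := norm_ne_zero_iff.mpr h0
      refine ⟨‖z - y‖⁻¹ • (z - y), ?_, ?_⟩
      · rw [norm_smul, norm_inv, norm_norm, inv_mul_cancel₀ h1]
      · rw [smul_smul, mul_inv_cancel₀ h1, one_smul]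
  rw [← le_sub_iff_add_le']
  refine le_of_forall_lt_imp_le_of_dense fun t ht => ?_
  rcases le_or_gt t 0 with ht0 | ht0
  · have h1 := h (Metric.mem_ball_self hρ)
    rw [mem_ball_iff_norm] at h1
    linarith
  · have h1 : z + t • e ∈ Metric.ball z ρ := by
      rw [mem_ball_iff_norm, add_sub_cancel_left, norm_smul, he, mul_one,
        Real.norm_of_nonneg ht0.le]
      exact ht
    have h2 := h h1
    rw [mem_ball_iff_norm, add_sub_right_comm, hze, ← add_smul, norm_smul, he, mul_one,
      Real.norm_of_nonneg (by positivity)] at h2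
    linarith

/-- A closed polar ball away from the divisor is compact. -/
theorem isCompact_polarClosedBall (hβ : ∀ j, 0 < β j ∧ β j ≤ 1) (hε : 0 ≤ ε) {a : Cn n}
    {R η : ℝ} (hη : 0 < η) (ha : ∀ j : Fin n, j.val < k → R + η ≤ ‖a j‖) :
    IsCompact {z : Cn n | z ∉ divisor k ∧ ‖polarMap k β ε z - a‖ ≤ R} := by
  have h1 : ∀ᶠ x in 𝓝[>] (0 : ℝ), ∀ j, polarRadius (β j) ε x < η :=
    eventually_all.mpr fun j =>
      (tendsto_polarRadius_zero (hβ j).1 (hβ j).2).eventually_lt_const hη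
  obtain ⟨δ, hδ, hδη⟩ := mem_nhdsGT_iff_exists_Ioo_subset.mp h1
  have h2 := (isCompact_polarRegion_inter (k := k) hβ hε
    ((isCompact_closedBall a R).prod (isCompact_singleton (x := (0 : ℝ)))) hδ).image continuous_fst
  convert h2 using 1
  ext z
  constructor
  · rintro ⟨hz, hza⟩
    refine ⟨(z, 0), ⟨⟨hz, ?_, rfl⟩, fun j hj => ?_⟩, rfl⟩
    · exact mem_closedBall_iff_norm.mpr hza
    · by_contra hlt
      have hzj : 0 < ‖z j‖ := norm_pos_iff.mpr fun h0 => hz ⟨j, hj, h0⟩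
      have h3 := hδη ⟨hzj, not_le.mp hlt⟩ j
      have h4 := norm_polarMap_apply (ε := ε) hβ hz hj
      have h5 := PiLp.norm_apply_le (polarMap k β ε z - a) j
      have h6 := norm_sub_norm_le (a j) (polarMap k β ε z j)
      rw [norm_sub_rev, ← PiLp.sub_apply] at h6
      linarith [ha j hj]
  · rintro ⟨p, ⟨⟨hp, hpa⟩, -⟩, rfl⟩
    exact ⟨hp, mem_closedBall_iff_norm.mp hpa.1⟩

/-- Tube lemma: a strict inequality on a compact set at time τ persists in the weak form slightly
later. This moves the start strictly inside the cylinder when τ is its initial time. -/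
theorem exists_time_le {u : Cn n × ℝ → ℝ} {B A : Set (Cn n)} {τ s τ' m : ℝ} (hA : IsCompact A)
    (hAB : A ⊆ B) (hτs : τ < s) (hττ' : τ < τ')
    (hu : ∀ x ∈ A, ContinuousWithinAt u (B ×ˢ Ioo τ s) (x, τ)) (hm : ∀ x ∈ A, u (x, τ) < m) :
    ∃ t, τ < t ∧ t < τ' ∧ ∀ x ∈ A, u (x, t) ≤ m := by
  have h1 : ∀ᶠ t in 𝓝 τ, ∀ x ∈ A, x ∈ B → t ∈ Ioo τ s → u (x, t) ≤ m := by
    refine hA.eventually_forall_of_forall_eventually fun x hx => ?_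
    have h2 := eventually_nhdsWithin_iff.mp ((hu x hx).eventually_lt_const (hm x hx))
    have h3 : Tendsto (fun q : ℝ × Cn n => (q.2, q.1)) (𝓝 (τ, x)) (𝓝 (x, τ)) :=
      (continuous_snd.prodMk continuous_fst).tendsto _
    filter_upwards [h3.eventually h2] with q hq hqB hqt
    exact (hq ⟨hqB, hqt⟩).le
  obtain ⟨t, ht, htI⟩ := ((h1.filter_mono nhdsWithin_le_nhds).and
    (Ioo_mem_nhdsGT (lt_min hτs hττ'))).exists
  have hts := htI.2.trans_le (min_le_left _ _)
  exact ⟨t, htI.1, htI.2.trans_le (min_le_right _ _), fun x hx => ht x hx (hAB hx) ⟨htI.1, hts⟩⟩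

end ConicHeat

/-! ### From positivity of M - u to the decay of the supremum -/

theorem mainTheorem8 (n : ℕ) (hn : 0 < n) (β : Fin n → ℝ) (hβ : ∀ j, 0 < β j ∧ β j ≤ 1)
    (K κ R₀ : ℝ) (hK : 0 < K) (hκ : 0 < κ) (hR₀ : 0 < R₀) :
    ∃ lam : ℝ, 0 < lam ∧ lam < 1 ∧
      ∀ (k : ℕ) (ε : ℝ), k ≤ n → 0 ≤ ε → ε ≤ 1 →
      ∀ (y : ConicHeat.Cn n) (s r : ℝ), 0 < r → r ≤ R₀ →
      ∀ g : ℝ → ConicHeat.Cn n → Matrix (Fin n) (Fin n) ℂ,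
        ConicHeat.IsConicFamily k β ε K (ConicHeat.polarBall k β ε y r) (Set.Ioo (s - r ^ 2) s) g →
        (∀ p ∈ ConicHeat.cylinder k β ε y s r,
          deriv (fun θ => ConicHeat.volDensity (g θ) p.1) p.2
            ≤ K * ConicHeat.volDensity (g p.2) p.1) →
      ∀ u : ConicHeat.Cn n × ℝ → ℝ,
        ConicHeat.IsWeakSubsolution (ConicHeat.cylinder k β ε y s r) g u →
      ∀ (z : ConicHeat.Cn n) (ρ τ : ℝ), ρ / r = κ →
        Metric.ball z ρ ⊆ Metric.ball y r →
        s - r ^ 2 ≤ τ → τ < s - r ^ 2 / 4 - ρ ^ 2 →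
        (∀ x ∈ ConicHeat.polarBall k β ε z ρ, u (x, τ) ≤ 0) →
        (τ = s - r ^ 2 → ∀ x ∈ ConicHeat.polarBall k β ε z ρ,
          ContinuousWithinAt u
            (ConicHeat.polarBall k β ε y r ×ˢ Set.Ico (s - r ^ 2) s) (x, τ)) →
        sSup (u '' ConicHeat.cylinder k β ε y s (r / 2))
          ≤ (1 - lam) * sSup (u '' ConicHeat.cylinder k β ε y s r) := by
  open ConicHeat in
  have hn1 : (1 : ℝ) ≤ n := by exact_mod_cast hn
  have hρr : ∀ {y z : Cn n} {r ρ : ℝ}, 0 < r → ρ / r = κ → Metric.ball z ρ ⊆ Metric.ball y r →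
      ρ = κ * r ∧ ‖z - y‖ + ρ ≤ r := by
    intro y z r ρ hr hρ hsub
    have h1 : ρ = κ * r := by
      rw [← hρ]
      field_simp
    exact ⟨h1, norm_sub_add_le_of_ball_subset hn (h1 ▸ mul_pos hκ hr) hsub⟩
  -- For κ > 1 no ball of radius κr fits into the large one, so any λ will do.
  rcases lt_or_ge 1 κ with hκ1 | hκ1
  · refine ⟨1 / 2, by norm_num, by norm_num, ?_⟩
    intro k ε _ _ _ y s r hr _ g _ _ u _ z ρ τ hρ hsub
    obtain ⟨h1, h2⟩ := hρr hr hρ hsub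
    have h3 : 1 * r < κ * r := by gcongr
    linarith [norm_nonneg (z - y)]
  have : Nonempty (Fin n) := ⟨⟨0, hn⟩⟩
  obtain ⟨j0, hj0⟩ := Finite.exists_min β
  have hC0 : ∀ j, 0 ≤ distConst (β j) := fun j =>
    zero_le_four.trans (four_le_distConst (hβ j).1 (hβ j).2)
  obtain ⟨w, c, hw0, hwκ, hc0, hc1, hmain⟩ := positivity_up_to_divisor
    (C := ∑ j, distConst (β j)) hn hβ hK hκ hκ1
    (fun j => Finset.single_le_sum (fun i _ => hC0 i) (Finset.mem_univ j))
    (Finset.sum_nonneg fun i _ => hC0 i) hj0 (hβ j0).1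
  -- One factor 1/2 is lost in moving off the initial time (M to M/2), the other in the filling.
  refine ⟨c / 4, by positivity, by linarith, ?_⟩
  intro k ε _ hε _ y s r hr _ g hg _ u hu z ρ τ hρ hsub hsτ hτ hinit hcont
  obtain ⟨hρκ, hzy⟩ := hρr hr hρ hsub
  subst hρκ
  obtain ⟨M0, hM0⟩ := hu.bounded
  have hbdd : BddAbove (u '' cylinder k β ε y s r) :=
    ⟨M0, forall_mem_image.mpr fun p hp => (le_abs_self _).trans (hM0 p hp)⟩
  -- Bounding `sSup` from above by a bound on the elements requires a nonempty set.
  obtain ⟨x0, hx0⟩ := polarBall_nonempty (k := k) hn hβ hε y (half_pos hr)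
  have hne : (u '' cylinder k β ε y s (r / 2)).Nonempty :=
    ⟨_, (x0, s - (r / 2) ^ 2 / 2), ⟨hx0, by constructor <;> linarith [sq_pos_of_pos (half_pos hr)]⟩, rfl⟩
  obtain ⟨M, hM⟩ : ∃ M, M = sSup (u '' cylinder k β ε y s r) := ⟨_, rfl⟩
  have huM : ∀ p ∈ cylinder k β ε y s r, u p ≤ M := fun p hp =>
    hM ▸ le_csSup hbdd (mem_image_of_mem u hp)
  rw [← hM]
  refine csSup_le hne (forall_mem_image.mpr fun p hp => ?_)
  have hr2 : 0 < r ^ 2 := by positivity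
  obtain ⟨⟨hpD, hpy⟩, hps⟩ := hp
  rw [mem_ball_iff_norm] at hpy
  have hpΩ : p ∈ cylinder k β ε y s r := by
    refine ⟨⟨hpD, mem_ball_iff_norm.mpr (by linarith)⟩, ?_, hps.2⟩
    linarith [hps.1, show (r / 2) ^ 2 = r ^ 2 / 4 by ring]
  rcases le_or_gt M 0 with hM0' | hMpos
  · refine (huM p hpΩ).trans ?_
    nlinarith
  -- The ball about z may meet the divisor, so its centre is shifted by at most κr/4. The ball of
  -- radius wr about a still lies in the given one and has compact preimage off the divisor.
  obtain ⟨a, haz, haj⟩ := exists_far_point z (d := κ / (4 * n) * r) (by positivity)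
  have haz' : ‖a - z‖ ≤ κ / 4 * r := by
    refine haz.trans (le_of_eq ?_)
    field_simp
  have hwn : w * r ≤ κ / (8 * n) * r := by gcongr
  have hwr : w * r ≤ κ / 8 * r := by
    refine hwn.trans ?_
    gcongr
    linarith
  have hAz : ∀ x ∈ {x | x ∉ divisor k ∧ ‖polarMap k β ε x - a‖ ≤ w * r},
      x ∈ polarBall k β ε z (κ * r) := by
    rintro x ⟨hx, hxa⟩
    refine ⟨hx, mem_ball_iff_norm.mpr ?_⟩
    have h1 := norm_add_le (polarMap k β ε x - a) (a - z)
    rw [sub_add_sub_cancel] at h1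
    linarith [mul_pos hκ hr]
  have hzB : polarBall k β ε z (κ * r) ⊆ polarBall k β ε y r := fun x hx => ⟨hx.1, hsub hx.2⟩
  have hA : IsCompact {x | x ∉ divisor k ∧ ‖polarMap k β ε x - a‖ ≤ w * r} := by
    refine isCompact_polarClosedBall hβ hε (η := κ / (8 * n) * r) (by positivity) fun j _ => ?_
    have h1 : κ / (4 * n) * r = κ / (8 * n) * r + κ / (8 * n) * r := by
      field_simp
      norm_num
    linarith [haj j]
  have hκr : 0 < κ ^ 2 * r ^ 2 := by positivity
  rw [mul_pow] at hτ
  have hAc : ∀ x ∈ {x | x ∉ divisor k ∧ ‖polarMap k β ε x - a‖ ≤ w * r},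
      ContinuousWithinAt u (polarBall k β ε y r ×ˢ Ioo τ s) (x, τ) := by
    intro x hx
    rcases hsτ.eq_or_lt with h0 | h0
    · refine (hcont h0.symm x (hAz x hx)).mono (prod_mono_right fun t ht => ⟨?_, ht.2⟩)
      linarith [ht.1]
    · refine (hu.continuousOn (x, τ) ⟨hzB (hAz x hx), h0, by linarith⟩).mono
        (prod_mono_right fun t ht => ⟨h0.trans ht.1, ht.2⟩)
  -- At most κ²r²/4 of the waiting time ρ² = κ²r² is spent here, which leaves the 3κ²r²/4 needed by
  -- `positivity_up_to_divisor`.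
  obtain ⟨τ', hττ', hτ', hτu⟩ := exists_time_le (u := u) (B := polarBall k β ε y r) (s := s)
    (τ' := τ + κ ^ 2 * r ^ 2 / 4) (m := M / 2) hA (fun x hx => hzB (hAz x hx)) (by linarith)
    (by linarith) hAc fun x hx => (hinit x (hAz x hx)).trans_lt (half_pos hMpos)
  have h1 := hmain k ε hε y s r hr (fun p => M - u p) (hu.isSupersolution hβ hK hg M)
    (continuousOn_const.sub hu.continuousOn) (fun p hp => sub_nonneg.mpr (huM p hp)) a (M / 2) τ'
    ?_ (fun j _ => haj j) (half_pos hMpos) (by linarith) ?_ p.1 hpD hpy.le p.2 ?_ hps.2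
  · linarith
  · have h1 := norm_add_le (a - z) (z - y)
    rw [sub_add_sub_cancel] at h1
    linarith
  · intro x hx hxa
    linarith [hτu x ⟨hx, hxa⟩]
  · linarith [hps.1, show (r / 2) ^ 2 = r ^ 2 / 4 by ring]
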